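/- Let $k$ be a perfect field and let $q\ge 0$ be an integer. For a $k$-algebra $A$ write $\Omega^q(A)=\bigwedge^q_A\Omega^1_{A/k}$. Let $\Phi$ be the class of geometric henselian discrete valuation fields over $k$, i.e. of discrete valuation fields $(L,v_L)$ isomorphic over $k$ to $\operatorname{Frac}\mathcal{O}^h_{X,x}$ with its canonical valuation, where $X$ is a smooth $k$-scheme, $x\in X$ is a point of codimension $1$, and $\mathcal{O}^h_{X,x}$ is the henselization of $\mathcal{O}_{X,x}$. For $L\in\Phi$ let $\mathcal{O}_L$ be the valuation ring. If $L'/L$ is a finite extension, then $L'$ carries the unique extension of the valuation, whose valuation ring $\mathcal{O}_{L'}$ is the integral closure of $\mathcal{O}_L$ in $L'$ (and $L'\in\Phi$). For $L\in\Phi$ with uniformizer $t$, let $\Omega^q(\mathcal{O}_L)(\log)\subset\Omega^q(L)$ be the subgroup generated by (the images of) $\Omega^q(\mathcal{O}_L)$ and $\Omega^{q-1}(\mathcal{O}_L)\wedge \frac{dt}{t}$ (with $\Omega^{-1}=0$), and for $r\in\mathbb{Q}_{\ge 0}$ put $$\operatorname{Fil}_r\Omega^q(L)=\begin{cases}\Omega^q(\mathcal{O}_L)&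 (r=0),\\ t^{-\lceil r\rceil+1}\cdot\Omega^q(\mathcal{O}_L)(\log)& (r>0);\end{cases}$$ this does not depend on $t$. For a finite extension $E/F$ of fields over $k$ let $\operatorname{Tr}_{E/F}\colon\Omega^q(E)\to\Omega^q(F)$ be the trace (transfer) on differential forms. It is determined as follows: it is transitive in towers; if $E/F$ is separable, then $\operatorname{Tr}_{E/F}(b\,\omega)=\operatorname{Tr}_{E/F}(b)\,\omega$ for $b\in E$, $\omega\in\Omega^q(F)$; if $E=F(\theta)$ with $\theta\notin F$, $\theta^p=a\in F$ and $p=\operatorname{char} F>0$, then $\operatorname{Tr}_{E/F}(b\,\omega)=0$ for $b\in E$, $\omega\in\Omega^q(F)$, and, for $q\geq 1$, $c\in F$ and $\omega\in\Omega^{q-1}(F)$, $\operatorname{Tr}_{E/F}(c\,\theta^i\,\omega\wedge d\theta)=0$ for $0\le i<p-1$ and $\operatorname{Tr}_{E/F}(c\,\theta^{p-1}\,\omega\wedge d\theta)=c\,\omega\wedge da$. Then $\{\operatorname{Fil}_r\Omega^q(L)\}_{r\in\mathbb{Q}_{\ge0},\,L\in\Phi}$ is a ramification filtration on $\Omega^q$,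 that is: 1. for every $L\in\Phi$ it is an increasing filtration of $\Omega^q(L)$ by subgroups, and the image of $\Omega^q(\mathcal{O}_L)\to\Omega^q(L)$ is contained in $\operatorname{Fil}_0\Omega^q(L)$; 2. for every $L\in\Phi$, every finite extension $L'/L$ of ramification index $e$ and every $r\in\mathbb{Q}_{\ge 0}$, $$\operatorname{Tr}_{L'/L}\bigl(\operatorname{Fil}_r\Omega^q(L')\bigr)\subset\operatorname{Fil}_{r/e}\Omega^q(L).$$ -/

import Mathlib

open scoped KaehlerDifferential NNRat

universe u

/-- The module `Ω^q(A)` of Kähler differential `q`-forms of a `k`-algebra `A`. -/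
abbrev Forms (k A : Type u) [Field k] [CommRing A] [Algebra k A] (q : ℕ) : Type u :=
  ⋀[A]^q (Ω[A⁄k])

/-- Given a ring homomorphism `A → B`, an `A`-module `M`, a `B`-module `N` and an `A`-linear map
`f : M → N`, the induced map `⋀^q_A M → ⋀^q_B N`, `m₁ ∧ ⋯ ∧ m_q ↦ f m₁ ∧ ⋯ ∧ f m_q`. -/
noncomputable def exteriorPowerMapAlong {A B M N : Type*} [CommRing A] [CommRing B] [Algebra A B]
    [AddCommGroup M] [Module A M] [AddCommGroup N] [Module A N] [Module B N] [IsScalarTower A B N]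
    (q : ℕ) (f : M →ₗ[A] N) : ⋀[A]^q M →ₗ[A] ⋀[B]^q N :=
  exteriorPower.alternatingMapLinearEquiv
    { ((exteriorPower.ιMulti B q (M := N)).toMultilinearMap.restrictScalars A).compLinearMap
        (fun _ => f) with
      map_eq_zero_of_eq' := fun v _ _ h hij =>
        (exteriorPower.ιMulti B q (M := N)).map_eq_zero_of_eq (fun i => f (v i))
          (congrArg f h) hij }

/-- The functorial map `Ω^q(A) → Ω^q(B)` attached to a homomorphism of `k`-algebras `A → B`,
`a₀ da₁ ∧ ⋯ ∧ da_q ↦ a₀ da₁ ∧ ⋯ ∧ da_q`. -/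
noncomputable def formsMap (k A B : Type u) [Field k] [CommRing A] [Algebra k A]
    [CommRing B] [Algebra k B] [Algebra A B] [IsScalarTower k A B] (q : ℕ) :
    Forms k A q →ₗ[A] Forms k B q :=
  exteriorPowerMapAlong q (KaehlerDifferential.map k k A B)

/-- The exterior product `x ↦ x ∧ m` with a fixed vector `m`. -/
noncomputable def wedgeRight {A M : Type*} [CommRing A] [AddCommGroup M] [Module A M] (q : ℕ)
    (m : M) : ⋀[A]^q M →ₗ[A] ⋀[A]^(q + 1) M :=
  ((LinearMap.mulRight A (ExteriorAlgebra.ι A m)).comp (⋀[A]^q M).subtype).codRestrict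
    (⋀[A]^(q + 1) M) (fun x => by
      change (x : ExteriorAlgebra A M) * ExteriorAlgebra.ι A m ∈
        LinearMap.range (ExteriorAlgebra.ι A) ^ (q + 1)
      rw [pow_succ]
      exact Submodule.mul_mem_mul x.2 ⟨m, rfl⟩)

/-! ### Geometric henselian discrete valuation fields -/

/-- `φ : A → B` exhibits the local ring `B` as the henselization of the local ring `A`: it is the
initial local homomorphism from `A` to a henselian local ring. -/
structure IsHenselization {A B : Type u} [CommRing A] [IsLocalRing A] [CommRing B]
    (φ : A →+* B) : Prop where
  henselian : HenselianLocalRing B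
  isLocalHom : IsLocalHom φ
  existsUnique_lift : ∀ (R : Type u) [CommRing R] [HenselianLocalRing R] (g : A →+* R),
    IsLocalHom g → ∃! h : B →+* R, IsLocalHom h ∧ h.comp φ = g

/-- A field `L` over `k` with a discrete valuation, given by its valuation ring `O ⊆ L`, is a
geometric henselian discrete valuation field if `O` is (over `k`) the henselization of the local
ring of a smooth `k`-scheme at a point of codimension one. Since the local ring only depends on an
affine open neighbourhood of the point, the scheme may be taken to be `Spec A` with `A` a smooth
`k`-algebra, and the point is then a prime ideal of height one. -/
structure IsGeometricHenselianDVF (k : Type u) [Field k] {L : Type u} [Field L] [Algebra k L]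
    (O : Subalgebra k L) : Prop where
  isFractionRing : IsFractionRing O L
  isDiscreteValuationRing : IsDiscreteValuationRing O
  exists_smooth : ∃ (A : Type u) (_ : CommRing A) (_ : Algebra k A) (P : Ideal A)
    (_ : P.IsPrime) (φ : Localization.AtPrime P →ₐ[k] O),
    Algebra.Smooth k A ∧ P.height = 1 ∧ IsHenselization φ.toRingHom

/-- The valuation ring of a finite extension `L'` of a henselian discrete valuation field `L`
with valuation ring `O`: the integral closure of `O` in `L'`, as a `k`-subalgebra. -/
def extensionRing {k L : Type u} [Field k] [Field L] [Algebra k L] (O : Subalgebra k L)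
    (L' : Type u) [Field L'] [Algebra k L'] [Algebra L L'] [IsScalarTower k L L'] :
    Subalgebra k L' :=
  (integralClosure O L').restrictScalars k

/-! ### The logarithmic filtration -/

section LogFiltration

variable {k L : Type u} [Field k] [Field L] [Algebra k L]

/-- The image of `Ω^q(O)` in `Ω^q(L)`. -/
noncomputable def integralForms (O : Subalgebra k L) (q : ℕ) : AddSubgroup (Forms k L q) :=
  (formsMap k O L q).toAddMonoidHom.range

/-- The logarithmic differential `dlog t = t⁻¹ dt`. -/
noncomputable def dlog (k : Type u) {L : Type u} [Field k] [Field L] [Algebra k L] (t : L) :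
    Ω[L⁄k] :=
  t⁻¹ • KaehlerDifferential.D k L t

/-- `Ω^q(O)(log)`: the subgroup of `Ω^q(L)` generated by `Ω^q(O)` and `Ω^{q-1}(O) ∧ dlog t`
(where `Ω^{-1} = 0`). -/
noncomputable def logForms (O : Subalgebra k L) (t : L) : ∀ q : ℕ, AddSubgroup (Forms k L q)
  | 0 => integralForms O 0
  | q + 1 => integralForms O (q + 1) ⊔
      (integralForms O q).map (wedgeRight q (dlog k t)).toAddMonoidHom

/-- The subgroup `t^{-⌈r⌉+1} · Ω^q(O)(log)` of `Ω^q(L)`. -/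
noncomputable def twistedLogForms (O : Subalgebra k L) (t : L) (q : ℕ) (r : ℚ≥0) :
    AddSubgroup (Forms k L q) :=
  (logForms O t q).map
    (LinearMap.lsmul L (Forms k L q) (t ^ (-(⌈r⌉₊ : ℤ) + 1))).toAddMonoidHom

end LogFiltration

open Classical in
/-- The logarithmic filtration on `Ω^q(L)`: `Fil_0 = Ω^q(O)` and, for `r > 0`,
`Fil_r = t^{-⌈r⌉+1} · Ω^q(O)(log)` for a uniformizer `t` of `O`. As this does not depend on the
choice of `t` (see `logFiltration_eq`), we take the sum over all uniformizers. -/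
noncomputable def logFiltration (k : Type u) [Field k] (q : ℕ) (L : Type u) [Field L]
    [Algebra k L] (O : Subalgebra k L) (r : ℚ≥0) : AddSubgroup (Forms k L q) :=
  if r = 0 then integralForms O q
  else ⨆ (t : O) (_ : Irreducible t), twistedLogForms O (t : L) q r

/-! ### The trace of differential forms -/

/-- `T` is the trace on differential forms of a finite separable extension `E/L`: under the
identification `Ω^q(E) = E ⊗_L Ω^q(L)` it is `Tr_{E/L} ⊗ id`. -/
def IsSeparableFormTrace (k L E : Type u) [Field k] [Field L] [Algebra k L] [Field E] [Algebra k E]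
    [Algebra L E] [IsScalarTower k L E] (T : ∀ q, Forms k E q →+ Forms k L q) : Prop :=
  ∀ (q : ℕ) (b : E) (ω : Forms k L q),
    T q (b • formsMap k L E q ω) = Algebra.trace L E b • ω

/-- `T` is the trace on differential forms of the purely inseparable extension `E = F(θ)` of
degree `p = char F`, where `θ ^ p = a ∈ F`. The group `Ω^•(E)` is generated by the forms `b ω` and
`c θ^i ω ∧ dθ` with `b ∈ E`, `c ∈ F`, `0 ≤ i < p` and `ω` a form on `F`. The trace sends them to
`0`, except that `c θ^{p-1} ω ∧ dθ ↦ c ω ∧ da`. -/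
structure IsInseparableFormTrace (k F E : Type u) [Field k] [Field F] [Algebra k F] [Field E]
    [Algebra k E] [Algebra F E] [IsScalarTower k F E] (p : ℕ) (a : F) (θ : E)
    (T : ∀ q, Forms k E q →+ Forms k F q) : Prop where
  map_base : ∀ (q : ℕ) (b : E) (ω : Forms k F q), T q (b • formsMap k F E q ω) = 0
  map_low : ∀ (q i : ℕ) (c : F) (ω : Forms k F q), i + 1 < p →
    T (q + 1) ((algebraMap F E c * θ ^ i) •
      wedgeRight q (KaehlerDifferential.D k E θ) (formsMap k F E q ω)) = 0
  map_top : ∀ (q : ℕ) (c : F) (ω : Forms k F q),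
    T (q + 1) ((algebraMap F E c * θ ^ (p - 1)) •
      wedgeRight q (KaehlerDifferential.D k E θ) (formsMap k F E q ω)) =
    c • wedgeRight q (KaehlerDifferential.D k F a) ω

/-- `IsFormTrace k L E T`: the family `T q : Ω^q(E) → Ω^q(L)` is the trace `Tr_{E/L}` on
differential forms of the finite field extension `E/L`. The trace is determined by its value on
finite separable extensions, its value on purely inseparable extensions of degree `p`, and
transitivity `Tr_{E/L} = Tr_{F/L} ∘ Tr_{E/F}`; every finite extension is a separable one followed
by a tower of purely inseparable ones of degree `p`. -/
inductive IsFormTrace (k : Type u) [Field k] :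
    ∀ (L E : Type u) [Field L] [Algebra k L] [Field E] [Algebra k E]
      [Algebra L E] [IsScalarTower k L E], (∀ q, Forms k E q →+ Forms k L q) → Prop
  | separable (L E : Type u) [Field L] [Algebra k L] [Field E] [Algebra k E]
      [Algebra L E] [IsScalarTower k L E] [FiniteDimensional L E] [Algebra.IsSeparable L E]
      (T : ∀ q, Forms k E q →+ Forms k L q) (hT : IsSeparableFormTrace k L E T) :
      IsFormTrace k L E T
  | inseparable (L F E : Type u) [Field L] [Algebra k L] [Field F] [Algebra k F]
      [Field E] [Algebra k E] [Algebra L F] [IsScalarTower k L F] [Algebra F E]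
      [IsScalarTower k F E] [Algebra L E] [IsScalarTower k L E] [IsScalarTower L F E]
      (T : ∀ q, Forms k F q →+ Forms k L q) (hT : IsFormTrace k L F T)
      (p : ℕ) (hp : p.Prime) (hchar : CharP F p) (a : F) (θ : E)
      (hθ : θ ^ p = algebraMap F E a) (hθF : θ ∉ Set.range (algebraMap F E))
      (hgen : Algebra.adjoin F {θ} = ⊤)
      (S : ∀ q, Forms k E q →+ Forms k F q) (hS : IsInseparableFormTrace k F E p a θ S) :
      IsFormTrace k L E (fun q => (T q).comp (S q))

/-! ### Ramification filtrations -/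

/-- `Fil`, which assigns to every geometric henselian discrete valuation field `(L, O)` over `k` a
family of subgroups `Fil_r Ω^q(L)`, `r ∈ ℚ_{≥0}`, is a ramification filtration on the sheaf with
transfers `Ω^q`. -/
structure IsRamificationFiltration (k : Type u) [Field k] (q : ℕ)
    (Fil : ∀ (L : Type u) [Field L] [Algebra k L], Subalgebra k L → ℚ≥0 →
      AddSubgroup (Forms k L q)) : Prop where
  monotone : ∀ (L : Type u) [Field L] [Algebra k L] (O : Subalgebra k L),
    IsGeometricHenselianDVF k O → Monotone (Fil L O)
  integralForms_le : ∀ (L : Type u) [Field L] [Algebra k L] (O : Subalgebra k L),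
    IsGeometricHenselianDVF k O → integralForms O q ≤ Fil L O 0
  trace_le : ∀ (L : Type u) [Field L] [Algebra k L] (O : Subalgebra k L),
    IsGeometricHenselianDVF k O →
    ∀ (L' : Type u) [Field L'] [Algebra k L'] [Algebra L L'] [IsScalarTower k L L']
      [FiniteDimensional L L'] (Tr : ∀ i, Forms k L' i →+ Forms k L i),
    IsFormTrace k L L' Tr →
    ∀ (𝔪 : Ideal (integralClosure O L')) [𝔪.IsMaximal] (r : ℚ≥0),
      (Fil L' (extensionRing O L') r).map (Tr q) ≤ Fil L O (r / (𝔪.ramificationIdx O : ℚ≥0))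

/-! ### Sanity checks: the filtration is independent of the uniformizer, traces exist -/

section Lemmas
variable {A B M N : Type*} [CommRing A] [CommRing B] [Algebra A B]
    [AddCommGroup M] [Module A M] [AddCommGroup N] [Module A N] [Module B N] [IsScalarTower A B N]

theorem exteriorPowerMapAlong_ιMulti (q : ℕ) (f : M →ₗ[A] N) (v : Fin q → M) :
    exteriorPowerMapAlong (B := B) q f (exteriorPower.ιMulti A q v) =
      exteriorPower.ιMulti B q (fun i => f (v i)) := by
  rw [exteriorPowerMapAlong, exteriorPower.alternatingMapLinearEquiv_apply_ιMulti]
  rfl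

theorem wedgeRight_ιMulti (q : ℕ) (m : M) (v : Fin q → M) :
    wedgeRight q m (exteriorPower.ιMulti A q v) =
      exteriorPower.ιMulti A (q + 1) (Fin.snoc v m : Fin (q + 1) → M) := by
  apply Subtype.ext
  change ExteriorAlgebra.ιMulti A q v * ExteriorAlgebra.ι A m = ExteriorAlgebra.ιMulti A (q + 1) _
  rw [ExteriorAlgebra.ιMulti_apply, ExteriorAlgebra.ιMulti_apply, List.ofFn_succ']
  simp

theorem exteriorPowerMapAlong_wedgeRight (q : ℕ) (f : M →ₗ[A] N) (m : M) (x : ⋀[A]^q M) :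
    exteriorPowerMapAlong (B := B) (q + 1) f (wedgeRight q m x) =
      wedgeRight q (f m) (exteriorPowerMapAlong q f x) := by
  have : (exteriorPowerMapAlong (B := B) (q + 1) f).comp (wedgeRight q m) =
      ((wedgeRight q (f m)).restrictScalars A).comp (exteriorPowerMapAlong (B := B) q f) := by
    apply exteriorPower.linearMap_ext
    ext v
    simp only [LinearMap.compAlternatingMap_apply, LinearMap.comp_apply, wedgeRight_ιMulti,
      exteriorPowerMapAlong_ιMulti, LinearMap.restrictScalars_apply]
    congr 2
    funext i
    refine Fin.lastCases ?_ (fun j => ?_) i <;> simp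
  exact LinearMap.congr_fun this x

theorem wedgeRight_add (q : ℕ) (m n : M) (x : ⋀[A]^q M) :
    wedgeRight q (m + n) x = wedgeRight q m x + wedgeRight q n x := by
  apply Subtype.ext
  simp [wedgeRight, mul_add]

theorem wedgeRight_smul (q : ℕ) (a : A) (m : M) (x : ⋀[A]^q M) :
    wedgeRight q (a • m) x = a • wedgeRight q m x := by
  apply Subtype.ext
  simp [wedgeRight]
end Lemmas

section
variable {k L : Type u} [Field k] [Field L] [Algebra k L]

theorem integralForms_smul (O : Subalgebra k L) (q : ℕ) (c : O) {ω : Forms k L q}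
    (h : ω ∈ integralForms O q) : (c : L) • ω ∈ integralForms O q := by
  obtain ⟨η, rfl⟩ := h
  exact ⟨c • η, by simp; rfl⟩

theorem logForms_smul (O : Subalgebra k L) (t : L) (q : ℕ) (c : O) {ω : Forms k L q}
    (h : ω ∈ logForms O t q) : (c : L) • ω ∈ logForms O t q := by
  cases q with
  | zero => exact integralForms_smul O 0 c h
  | succ q =>
    rw [logForms, AddSubgroup.mem_sup] at h ⊢
    obtain ⟨x, hx, _, ⟨y, hy, rfl⟩, rfl⟩ := h
    exact ⟨(c : L) • x, integralForms_smul O _ c hx, _,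
      ⟨(c : L) • y, integralForms_smul O _ c hy, rfl⟩, by simp [smul_add]⟩

theorem dlog_mul {s t : L} (hs : s ≠ 0) (ht : t ≠ 0) : dlog k (s * t) = dlog k s + dlog k t := by
  simp only [dlog, Derivation.leibniz, smul_add, smul_smul, mul_inv]
  rw [add_comm]
  congr 2 <;> field_simp

theorem logForms_le_of_unit (O : Subalgebra k L) {t : L} (ht : t ≠ 0) (u : Oˣ) (q : ℕ) :
    logForms O ((u : O) * t : L) q ≤ logForms O t q := by
  cases q with
  | zero => exact le_rfl
  | succ q =>
    have hu : ((u : O) : L) ≠ 0 := by simp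
    rw [logForms, logForms]
    refine sup_le le_sup_left ?_
    rintro _ ⟨y, hy, rfl⟩
    change wedgeRight q (dlog k _) y ∈ _
    rw [dlog_mul hu ht, wedgeRight_add]
    refine add_mem (le_sup_left (a := integralForms O (q + 1)) ?_)
      (le_sup_right (a := integralForms O (q + 1)) ⟨y, hy, rfl⟩)
    obtain ⟨η, rfl⟩ := hy
    refine ⟨wedgeRight q (((u⁻¹ : Oˣ) : O) • KaehlerDifferential.D k O u) η, ?_⟩
    change formsMap k O L (q + 1) _ = _
    rw [formsMap, exteriorPowerMapAlong_wedgeRight]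
    congr 2
    rw [map_smul, KaehlerDifferential.map_D, algebra_compatible_smul L, dlog]
    congr 1
    have : ((u : O) : L) * (((u⁻¹ : Oˣ) : O) : L) = 1 := by
      rw [← MulMemClass.coe_mul, Units.mul_inv]; rfl
    exact (eq_inv_of_mul_eq_one_right this)

theorem twistedLogForms_le (O : Subalgebra k L) {t : L} (ht : t ≠ 0) (u : Oˣ) (q : ℕ) (r : ℚ≥0) :
    twistedLogForms O ((u : O) * t : L) q r ≤ twistedLogForms O t q r := by
  rintro _ ⟨ω, hω, rfl⟩
  have hz : ∀ n : ℤ, ((u : O) : L) ^ n = (((u ^ n : Oˣ) : O) : L) := by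
    intro n
    have := map_zpow (Units.map (O.val : O →* L)) u n
    have h2 := congrArg Units.val this
    rw [Units.val_zpow_eq_zpow_val] at h2
    exact h2.symm
  refine ⟨((u : O) : L) ^ (-(⌈r⌉₊ : ℤ) + 1) • ω, ?_, ?_⟩
  · rw [hz]
    exact logForms_smul O t q _ (logForms_le_of_unit O ht u q hω)
  · change t ^ (-(⌈r⌉₊ : ℤ) + 1) • ((u : O) : L) ^ (-(⌈r⌉₊ : ℤ) + 1) • ω =
      (((u : O) : L) * t) ^ (-(⌈r⌉₊ : ℤ) + 1) • ω
    rw [smul_smul, mul_zpow, mul_comm]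

/-- The logarithmic filtration may be computed with any one uniformizer. -/
theorem logFiltration_eq (q : ℕ) (O : Subalgebra k L) [IsDiscreteValuationRing O] (t : O)
    (ht : Irreducible t) (r : ℚ≥0) (hr : r ≠ 0) :
    logFiltration k q L O r = twistedLogForms O (t : L) q r := by
  rw [logFiltration, if_neg hr]
  refine le_antisymm (iSup₂_le fun s hs => ?_) (le_iSup₂_of_le t ht le_rfl)
  obtain ⟨u, hu⟩ := (IsDiscreteValuationRing.associated_of_irreducible O ht hs)
  have h0 : (t : L) ≠ 0 := by simpa using ht.ne_zero
  have := twistedLogForms_le O h0 u q r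
  rwa [mul_comm, ← MulMemClass.coe_mul, hu] at this
end

section TraceExistence
open scoped TensorProduct

theorem map_exteriorPowerMapAlong {A B M N P : Type*} [CommRing A] [CommRing B] [Algebra A B]
    [AddCommGroup M] [Module A M] [AddCommGroup N] [Module A N] [Module B N] [IsScalarTower A B N]
    [AddCommGroup P] [Module A P] [Module B P] [IsScalarTower A B P]
    (q : ℕ) (f : M →ₗ[A] N) (g : N →ₗ[B] P) (x : ⋀[A]^q M) :
    exteriorPower.map q g (exteriorPowerMapAlong q f x) =
      exteriorPowerMapAlong q ((g.restrictScalars A).comp f) x := by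
  have : ((exteriorPower.map q g).restrictScalars A).comp (exteriorPowerMapAlong (B := B) q f) =
      exteriorPowerMapAlong (B := B) q ((g.restrictScalars A).comp f) := by
    apply exteriorPower.linearMap_ext
    ext v
    simp [exteriorPowerMapAlong_ιMulti, exteriorPower.map_apply_ιMulti, Function.comp_def]
  exact LinearMap.congr_fun this x

theorem exists_descent_of_basis {F E V U I : Type*} [Field F] [Field E] [Algebra F E]
    [AddCommGroup V] [Module F V] [AddCommGroup U] [Module E U] [Module F U] [IsScalarTower F E U]
    [LinearOrder I] (b : Module.Basis I F V) (b' : Module.Basis I E U) (j : V →ₗ[F] U)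
    (hj : ∀ i, j (b i) = b' i) (l : E →ₗ[F] F) (q : ℕ) :
    ∃ Λ : ⋀[E]^q U →ₗ[F] ⋀[F]^q V, ∀ (x : E) (ω : ⋀[F]^q V),
      Λ (x • exteriorPowerMapAlong q j ω) = l x • ω := by
  refine ⟨((b.exteriorPower q).repr.symm.toLinearMap.comp (Finsupp.mapRange.linearMap l)).comp
      ((b'.exteriorPower q).repr.toLinearMap.restrictScalars F), fun x ω => ?_⟩
  have h1 : ∀ s, exteriorPowerMapAlong q j (b.exteriorPower q s) = b'.exteriorPower q s := by
    intro s
    rw [exteriorPower.basis_apply, exteriorPower.basis_apply, exteriorPower.ιMulti_family,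
      exteriorPowerMapAlong_ιMulti, exteriorPower.ιMulti_family]
    congr 1
    funext i
    exact hj _
  rw [← (b.exteriorPower q).linearCombination_repr ω, Finsupp.linearCombination_apply,
    Finsupp.sum, map_sum, Finset.smul_sum, map_sum, Finset.smul_sum]
  refine Finset.sum_congr rfl fun s _ => ?_
  rw [LinearMap.map_smul (exteriorPowerMapAlong q j), h1, smul_comm, LinearMap.map_smul,
    smul_comm (l x)]
  congr 1
  simp only [LinearMap.comp_apply, LinearMap.restrictScalars_apply, LinearEquiv.coe_coe, map_smul,
    Module.Basis.repr_self]
  simp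

theorem exists_descent {F E V : Type*} [Field F] [Field E] [Algebra F E] [AddCommGroup V]
    [Module F V] (l : E →ₗ[F] F) (q : ℕ) :
    ∃ Λ : ⋀[E]^q (E ⊗[F] V) →ₗ[F] ⋀[F]^q V, ∀ (b : E) (ω : ⋀[F]^q V),
      Λ (b • exteriorPowerMapAlong q (TensorProduct.mk F E V 1) ω) = l b • ω := by
  classical
  let _ : LinearOrder (Module.Basis.ofVectorSpaceIndex F V) := linearOrderOfSTO WellOrderingRel
  exact exists_descent_of_basis (Module.Basis.ofVectorSpace F V)
    ((Module.Basis.ofVectorSpace F V).baseChange E) _ (fun i => by simp) l q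

theorem exists_separable (k L E : Type u) [Field k] [Field L] [Algebra k L] [Field E] [Algebra k E]
    [Algebra L E] [IsScalarTower k L E] [Algebra.IsSeparable L E] :
    ∃ T : ∀ q, Forms k E q →+ Forms k L q, IsSeparableFormTrace k L E T := by
  have : Algebra.FormallyEtale L E := Algebra.FormallyEtale.of_isSeparable L E
  choose Λ hΛ using fun q => exists_descent (V := Ω[L⁄k]) (Algebra.trace L E) q
  let ρ : Ω[E⁄k] →ₗ[E] E ⊗[L] Ω[L⁄k] :=
    (KaehlerDifferential.tensorKaehlerEquivOfFormallyEtale k L E).symm.toLinearMap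
  have hρ : (ρ.restrictScalars L).comp (KaehlerDifferential.map k k L E) =
      TensorProduct.mk L E Ω[L⁄k] 1 := by
    refine LinearMap.ext fun x => ?_
    change (KaehlerDifferential.tensorKaehlerEquivOfFormallyEtale k L E).symm
      (KaehlerDifferential.map k k L E x) = 1 ⊗ₜ x
    rw [LinearEquiv.symm_apply_eq,
      KaehlerDifferential.tensorKaehlerEquivOfFormallyEtale_apply,
      KaehlerDifferential.mapBaseChange_tmul, one_smul]
  refine ⟨fun q => ((Λ q).comp ((exteriorPower.map q ρ).restrictScalars L)).toAddMonoidHom,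
    fun q b ω => ?_⟩
  rw [← hΛ q b ω]
  change Λ q (exteriorPower.map q ρ (b • formsMap k L E q ω)) = _
  rw [map_smul, formsMap, map_exteriorPowerMapAlong, hρ]

theorem exists_derivation_polynomial {k F E M : Type*} [Field k] [Field F] [Algebra k F] [Field E]
    [Algebra k E] [Algebra F E] [IsScalarTower k F E] [AddCommGroup M] [Module E M] [Module F M]
    [Module k M] [IsScalarTower F E M] [IsScalarTower k E M] [IsScalarTower k F M]
    (θ : E) (δ : Derivation k F M) (m : M) :
    ∃ d : Polynomial F →ₗ[k] M,
      (∀ f g, d (f * g) = Polynomial.aeval θ f • d g + Polynomial.aeval θ g • d f) ∧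
      ∀ i c, d (Polynomial.monomial i c) = θ ^ i • δ c + (c • (i * θ ^ (i - 1))) • m := by
  classical
  let d : Polynomial F →ₗ[k] M :=
    { toFun := fun f => f.sum (fun i c => θ ^ i • δ c + (c • (i * θ ^ (i - 1))) • m)
      map_add' := fun f g => Polynomial.sum_add_index f g _ (by simp)
        (by intro i a b; simp only [map_add, smul_add, add_smul]; abel)
      map_smul' := fun c f => by
        rw [Polynomial.sum_smul_index' f c _ (by simp), Polynomial.smul_sum]
        congr 1
        funext i a
        simp only [RingHom.id_apply, Derivation.map_smul, smul_add, smul_assoc]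
        rw [smul_comm] }
  have hd : ∀ i c, d (Polynomial.monomial i c) =
      θ ^ i • δ c + (c • (i * θ ^ (i - 1))) • m := fun i c =>
    Polynomial.sum_monomial_index c
      (fun i c => θ ^ i • δ c + (c • (i * θ ^ (i - 1))) • m) (by simp)
  refine ⟨d, fun f g => ?_, hd⟩
  induction f using Polynomial.induction_on' with
  | add f₁ f₂ h₁ h₂ => simp only [add_mul, map_add, h₁, h₂, add_smul, smul_add]; abel
  | monomial i c =>
    induction g using Polynomial.induction_on' with
    | add g₁ g₂ h₁ h₂ => simp only [mul_add, map_add, h₁, h₂, add_smul, smul_add]; abel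
    | monomial j e =>
      rw [Polynomial.monomial_mul_monomial, hd, hd, hd, Polynomial.aeval_monomial,
        Polynomial.aeval_monomial, Derivation.leibniz, smul_add, smul_add, smul_add,
        algebra_compatible_smul E c (δ e), algebra_compatible_smul E e (δ c)]
      simp only [smul_smul]
      have : ((c * e) • (((i + j : ℕ) : E) * θ ^ (i + j - 1))) =
          algebraMap F E c * θ ^ i * e • (↑j * θ ^ (j - 1)) +
          algebraMap F E e * θ ^ j * c • (↑i * θ ^ (i - 1)) := by
        simp only [Algebra.smul_def, map_mul]
        rcases i with _ | i <;> rcases j with _ | j <;> simp <;> ring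
      rw [this, add_smul, pow_add]
      have e1 : θ ^ i * θ ^ j * algebraMap F E c = algebraMap F E c * θ ^ i * θ ^ j := by ring
      have e2 : θ ^ i * θ ^ j * algebraMap F E e = algebraMap F E e * θ ^ j * θ ^ i := by ring
      rw [e1, e2]
      abel

theorem minpoly_eq_X_pow_sub_C {F E : Type*} [Field F] [Field E] [Algebra F E]
    {p : ℕ} (hp : p.Prime) [CharP F p] {a : F} {θ : E}
    (hθ : θ ^ p = algebraMap F E a) (hθF : θ ∉ Set.range (algebraMap F E)) :
    minpoly F θ = Polynomial.X ^ p - Polynomial.C a := by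
  have : Fact p.Prime := ⟨hp⟩
  have : CharP E p := charP_of_injective_algebraMap (algebraMap F E).injective p
  refine (minpoly.eq_of_irreducible_of_monic (X_pow_sub_C_irreducible_of_prime hp ?_) ?_
    (Polynomial.monic_X_pow_sub_C a hp.ne_zero)).symm
  · intro b hb
    refine hθF ⟨b, ?_⟩
    apply frobenius_inj E p
    simp [frobenius_def, ← map_pow, hb, hθ]
  · simp [hθ]

theorem exists_derivation {k F E M : Type*} [Field k] [Field F] [Algebra k F] [Field E]
    [Algebra k E] [Algebra F E] [IsScalarTower k F E] [AddCommGroup M] [Module E M] [Module F M]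
    [Module k M] [IsScalarTower F E M] [IsScalarTower k E M] [IsScalarTower k F M]
    {p : ℕ} (hp : p.Prime) [CharP F p] {a : F} {θ : E}
    (hθ : θ ^ p = algebraMap F E a) (hθF : θ ∉ Set.range (algebraMap F E))
    (hgen : Algebra.adjoin F {θ} = ⊤) (δ : Derivation k F M) (ha : δ a = 0) (m : M) :
    ∃ D : Derivation k E M, (∀ c, D (algebraMap F E c) = δ c) ∧ D θ = m := by
  obtain ⟨d, hd, hd'⟩ := exists_derivation_polynomial (k := k) θ δ m
  have : CharP E p := charP_of_injective_algebraMap (algebraMap F E).injective p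
  have hsurj : Function.Surjective (Polynomial.aeval (R := F) θ) := by
    rw [← AlgHom.range_eq_top, ← Algebra.adjoin_singleton_eq_range_aeval, hgen]
  have hker : ∀ f : Polynomial F, Polynomial.aeval θ f = 0 → d f = 0 := by
    intro f hf
    obtain ⟨g, rfl⟩ := minpoly.dvd F θ hf
    rw [hd, minpoly.aeval, zero_smul, zero_add, minpoly_eq_X_pow_sub_C hp hθ hθF, map_sub,
      ← Polynomial.monomial_one_right_eq_X_pow, ← Polynomial.monomial_zero_left, hd', hd']
    simp [ha]
  have heq : ∀ f g : Polynomial F, Polynomial.aeval θ f = Polynomial.aeval θ g → d f = d g := by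
    intro f g h
    rw [← sub_eq_zero, ← map_sub]
    exact hker _ (by rw [map_sub, h, sub_self])
  choose s hs using hsurj
  let D₀ : E →ₗ[k] M :=
    { toFun := fun e => d (s e)
      map_add' := fun x y => by rw [← map_add]; exact heq _ _ (by simp [hs])
      map_smul' := fun c x => by
        rw [RingHom.id_apply, ← map_smul]
        refine heq _ _ ?_
        rw [hs, algebra_compatible_smul F c (s x), map_smul, hs, algebraMap_smul] }
  refine ⟨Derivation.mk' D₀ fun x y => ?_, fun c => ?_, ?_⟩
  · change d (s (x * y)) = x • d (s y) + y • d (s x)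
    rw [heq (s (x * y)) (s x * s y) (by simp [hs]), hd, hs, hs]
  · change d (s _) = _
    rw [heq _ (Polynomial.monomial 0 c) (by simp [hs]), hd']
    simp
  · change d (s θ) = _
    rw [heq _ (Polynomial.monomial 1 1) (by simp [hs]), hd']
    simp

theorem contractRight_mem {E M : Type*} [CommRing E] [AddCommGroup M] [Module E M]
    (φ : Module.Dual E M) (q : ℕ) : ∀ x ∈ ⋀[E]^(q + 1) M,
      CliffordAlgebra.contractRight (Q := (0 : QuadraticForm E M)) x φ ∈ ⋀[E]^q M := by
  induction q with
  | zero =>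
    intro x hx
    change x ∈ LinearMap.range (ExteriorAlgebra.ι E) ^ 1 at hx
    rw [pow_one] at hx
    obtain ⟨m, rfl⟩ := hx
    change _ ∈ LinearMap.range (ExteriorAlgebra.ι E) ^ 0
    rw [pow_zero, CliffordAlgebra.contractRight_ι, Submodule.mem_one]
    exact ⟨_, rfl⟩
  | succ q ih =>
    intro x hx
    change x ∈ LinearMap.range (ExteriorAlgebra.ι E) ^ (q + 1 + 1) at hx
    rw [pow_succ] at hx
    induction hx using Submodule.mul_induction_on' with
    | mem_mul_mem y hy z hz =>
      obtain ⟨m, rfl⟩ := hz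
      rw [CliffordAlgebra.contractRight_mul_ι]
      refine sub_mem (Submodule.smul_mem _ _ hy) ?_
      change _ ∈ LinearMap.range (ExteriorAlgebra.ι E) ^ (q + 1)
      rw [pow_succ]
      exact Submodule.mul_mem_mul (ih y hy) ⟨m, rfl⟩
    | add x _ y _ hx hy =>
      rw [map_add, LinearMap.add_apply]
      exact add_mem hx hy

theorem contractRight_ιMulti {E M : Type*} [CommRing E] [AddCommGroup M] [Module E M]
    (φ : Module.Dual E M) (q : ℕ) (v : Fin q → M) (hv : ∀ i, φ (v i) = 0) :
    CliffordAlgebra.contractRight (Q := (0 : QuadraticForm E M))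
      (ExteriorAlgebra.ιMulti E q v) φ = 0 := by
  induction q with
  | zero =>
    rw [ExteriorAlgebra.ιMulti_zero_apply]
    exact CliffordAlgebra.contractRight_one _ _
  | succ q ih =>
    rw [ExteriorAlgebra.ιMulti_apply, List.ofFn_succ', List.concat_eq_append, List.prod_append,
      List.prod_singleton]
    have := CliffordAlgebra.contractRight_mul_ι (Q := (0 : QuadraticForm E M)) φ (v (Fin.last q))
      (ExteriorAlgebra.ιMulti E q (fun i => v i.castSucc))
    rw [ih _ (fun i => hv _), hv, zero_smul, zero_mul, sub_zero] at this
    exact this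

theorem exists_contraction {F E M V : Type*} [Field F] [Field E] [Algebra F E] [AddCommGroup M]
    [Module E M] [Module F M] [IsScalarTower F E M] [AddCommGroup V] [Module F V]
    (j : V →ₗ[F] M) (φ : M →ₗ[E] E) (hj : ∀ v, φ (j v) = 0) (m : M) (hm : φ m = 1) (q : ℕ) :
    ∃ C : ⋀[E]^(q + 1) M →ₗ[E] ⋀[E]^q M,
      (∀ x, C (exteriorPowerMapAlong (q + 1) j x) = 0) ∧
      ∀ x, C (wedgeRight q m (exteriorPowerMapAlong q j x)) = exteriorPowerMapAlong q j x := by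
  let C₀ : CliffordAlgebra (0 : QuadraticForm E M) →ₗ[E] CliffordAlgebra (0 : QuadraticForm E M) :=
    CliffordAlgebra.contractRight.flip φ
  let C : ⋀[E]^(q + 1) M →ₗ[E] ⋀[E]^q M :=
    (C₀.comp (⋀[E]^(q + 1) M).subtype).codRestrict _ fun x => contractRight_mem φ q _ x.2
  have key : ∀ (n : ℕ) (x : ⋀[F]^n V), CliffordAlgebra.contractRight
      (Q := (0 : QuadraticForm E M)) (exteriorPowerMapAlong (B := E) n j x : _) φ = 0 := by
    intro n x
    have : ((C₀.comp (⋀[E]^n M).subtype).restrictScalars F).comp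
        (exteriorPowerMapAlong (B := E) n j) = 0 := by
      apply exteriorPower.linearMap_ext
      ext v
      simp only [LinearMap.compAlternatingMap_apply, LinearMap.comp_apply,
        exteriorPowerMapAlong_ιMulti]
      exact contractRight_ιMulti φ n _ fun i => hj _
    exact LinearMap.congr_fun this x
  refine ⟨C, fun x => Subtype.ext (key _ x), fun x => Subtype.ext ?_⟩
  change CliffordAlgebra.contractRight (Q := (0 : QuadraticForm E M))
    ((exteriorPowerMapAlong (B := E) q j x : ExteriorAlgebra E M) * ExteriorAlgebra.ι E m) φ = _
  have := CliffordAlgebra.contractRight_mul_ι (Q := (0 : QuadraticForm E M)) φ m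
    (exteriorPowerMapAlong (B := E) q j x : ExteriorAlgebra E M)
  rw [key, hm, one_smul, zero_mul, sub_zero] at this
  exact this

theorem wedgeRight_map_of_sub_mem {F V : Type*} [Field F] [AddCommGroup V] [Module F V]
    (π : V →ₗ[F] V) (a : V) (h : ∀ v, v - π v ∈ Submodule.span F {a}) (q : ℕ) (x : ⋀[F]^q V) :
    wedgeRight q a (exteriorPower.map q π x) = wedgeRight q a x := by
  have hι : ∀ v, ExteriorAlgebra.ι F (π v) * ExteriorAlgebra.ι F a =
      ExteriorAlgebra.ι F v * ExteriorAlgebra.ι F a := by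
    intro v
    obtain ⟨c, hc⟩ := Submodule.mem_span_singleton.1 (h v)
    rw [eq_comm, ← sub_eq_zero, ← sub_mul, ← map_sub, ← hc, map_smul, smul_mul_assoc,
      ExteriorAlgebra.ι_sq_zero, smul_zero]
  have key : ∀ (n : ℕ) (v : Fin n → V),
      ExteriorAlgebra.ιMulti F n (fun i => π (v i)) * ExteriorAlgebra.ι F a =
        ExteriorAlgebra.ιMulti F n v * ExteriorAlgebra.ι F a := by
    intro n
    induction n with
    | zero => intro v; simp
    | succ n ih =>
      intro v
      have hs : ∀ w : Fin (n + 1) → V, ExteriorAlgebra.ιMulti F (n + 1) w =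
          ExteriorAlgebra.ιMulti F n (fun i => w i.castSucc) *
            ExteriorAlgebra.ι F (w (Fin.last n)) := by
        intro w
        rw [ExteriorAlgebra.ιMulti_apply, List.ofFn_succ', List.concat_eq_append,
          List.prod_append, List.prod_singleton]
        rfl
      have hswap : ExteriorAlgebra.ι F (v (Fin.last n)) * ExteriorAlgebra.ι F a =
          -(ExteriorAlgebra.ι F a * ExteriorAlgebra.ι F (v (Fin.last n))) :=
        eq_neg_of_add_eq_zero_left (ExteriorAlgebra.ι_add_mul_swap _ _)
      rw [hs, hs, mul_assoc, hι, mul_assoc, hswap, mul_neg, mul_neg, ← mul_assoc, ← mul_assoc,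
        ih (fun i => v i.castSucc)]
  have : (wedgeRight q a).comp (exteriorPower.map q π) = wedgeRight q a := by
    apply exteriorPower.linearMap_ext
    ext v
    simp only [LinearMap.compAlternatingMap_apply, LinearMap.comp_apply,
      exteriorPower.map_apply_ιMulti]
    exact key q v
  exact LinearMap.congr_fun this x

theorem exists_inseparable (k F E : Type u) [Field k] [Field F] [Algebra k F] [Field E]
    [Algebra k E] [Algebra F E] [IsScalarTower k F E]
    {p : ℕ} (hp : p.Prime) [CharP F p] {a : F} {θ : E}
    (hθ : θ ^ p = algebraMap F E a) (hθF : θ ∉ Set.range (algebraMap F E))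
    (hgen : Algebra.adjoin F {θ} = ⊤) :
    ∃ T : ∀ q, Forms k E q →+ Forms k F q, IsInseparableFormTrace k F E p a θ T := by
  have hmin := minpoly_eq_X_pow_sub_C hp hθ hθF
  have hint : IsIntegral F θ := by
    refine ⟨Polynomial.X ^ p - Polynomial.C a, Polynomial.monic_X_pow_sub_C a hp.ne_zero, ?_⟩
    simp [hθ]
  -- the coefficient of `θ ^ (p - 1)`
  obtain ⟨l, hl⟩ : ∃ l : E →ₗ[F] F, ∀ i, i < p → ∀ c : F,
      l (algebraMap F E c * θ ^ i) = if i + 1 = p then c else 0 := by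
    let pb := PowerBasis.ofAdjoinEqTop hint hgen
    have hdim : pb.dim = p := by
      change (minpoly F θ).natDegree = p
      rw [hmin, Polynomial.natDegree_X_pow_sub_C]
    have hpos : p - 1 < pb.dim := by rw [hdim]; exact Nat.sub_lt hp.pos one_pos
    refine ⟨pb.basis.coord ⟨p - 1, hpos⟩, fun i hi c => ?_⟩
    have hb : θ ^ i = pb.basis ⟨i, by rw [hdim]; exact hi⟩ := by
      rw [pb.basis_eq_pow]
      simp [pb]
    rw [hb, ← Algebra.smul_def, map_smul, Module.Basis.coord_apply, Module.Basis.repr_self,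
      Finsupp.single_apply, smul_eq_mul]
    have : i = p - 1 ↔ i + 1 = p := by have := hp.pos; omega
    simp [Fin.ext_iff, this]
  obtain ⟨π, hπa, hπ⟩ : ∃ π : Ω[F⁄k] →ₗ[F] Ω[F⁄k], π (KaehlerDifferential.D k F a) = 0 ∧
      ∀ v, v - π v ∈ Submodule.span F {KaehlerDifferential.D k F a} := by
    obtain ⟨g, hg⟩ := LinearMap.exists_leftInverse_of_injective
      (Submodule.span F {KaehlerDifferential.D k F a}).subtype (Submodule.ker_subtype _)
    refine ⟨LinearMap.id - (Submodule.subtype _).comp g, ?_, fun v => by simp⟩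
    have := LinearMap.congr_fun hg ⟨_, Submodule.mem_span_singleton_self _⟩
    simp only [LinearMap.comp_apply, Submodule.subtype_apply, LinearMap.id_apply] at this
    simp [this]
  let δ : Derivation k F (E ⊗[F] Ω[F⁄k]) :=
    ((TensorProduct.mk F E Ω[F⁄k] 1).comp π).compDer (KaehlerDifferential.D k F)
  obtain ⟨D₁, hD₁, -⟩ := exists_derivation (k := k) hp hθ hθF hgen δ
    (by simp [δ, hπa]) 0
  obtain ⟨D₂, hD₂, hD₂θ⟩ := exists_derivation (k := k) hp hθ hθF hgen
    (0 : Derivation k F E) rfl 1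
  let ρ := D₁.liftKaehlerDifferential
  let φ := D₂.liftKaehlerDifferential
  have hφ : ∀ v, φ (KaehlerDifferential.map k k F E v) = 0 := by
    have : (φ.restrictScalars F).comp (KaehlerDifferential.map k k F E) = 0 := by
      apply Derivation.liftKaehlerDifferential_unique
      ext c
      simp [φ, hD₂]
    exact fun v => LinearMap.congr_fun this v
  have hφθ : φ (KaehlerDifferential.D k E θ) = 1 := by simp [φ, hD₂θ]
  have hρ : (ρ.restrictScalars F).comp (KaehlerDifferential.map k k F E) =
      (TensorProduct.mk F E Ω[F⁄k] 1).comp π := by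
    apply Derivation.liftKaehlerDifferential_unique
    ext c
    simp [ρ, hD₁, δ]
  choose Λ hΛ using fun q => exists_descent (V := Ω[F⁄k]) l q
  choose C hC₀ hC using fun q => exists_contraction (KaehlerDifferential.map k k F E) φ hφ _ hφθ q
  let T' : ∀ q, Forms k E (q + 1) →+ Forms k F (q + 1) := fun q =>
    ((wedgeRight q (KaehlerDifferential.D k F a)).comp ((Λ q).comp
      (((exteriorPower.map q ρ).comp (C q)).restrictScalars F))).toAddMonoidHom
  have hT' : ∀ q (b : E) (ω : Forms k F q), T' q (b • wedgeRight q (KaehlerDifferential.D k E θ)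
      (formsMap k F E q ω)) = l b • wedgeRight q (KaehlerDifferential.D k F a) ω := by
    intro q b ω
    change wedgeRight q (KaehlerDifferential.D k F a) (Λ q (exteriorPower.map q ρ (C q (b • _)))) = _
    rw [map_smul, map_smul, formsMap, hC, map_exteriorPowerMapAlong, hρ]
    have : exteriorPowerMapAlong (B := E) q ((TensorProduct.mk F E Ω[F⁄k] 1).comp π) ω =
        exteriorPowerMapAlong (B := E) q (TensorProduct.mk F E Ω[F⁄k] 1)
          (exteriorPower.map q π ω) := by
      have h2 : (exteriorPowerMapAlong (B := E) q (TensorProduct.mk F E Ω[F⁄k] 1)).comp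
          (exteriorPower.map q π) =
          exteriorPowerMapAlong (B := E) q ((TensorProduct.mk F E Ω[F⁄k] 1).comp π) := by
        apply exteriorPower.linearMap_ext
        ext v
        simp [exteriorPowerMapAlong_ιMulti, exteriorPower.map_apply_ιMulti]
      exact (LinearMap.congr_fun h2 ω).symm
    rw [this, hΛ, map_smul, wedgeRight_map_of_sub_mem π _ hπ]
  refine ⟨fun q => match q with
    | 0 => 0
    | q + 1 => T' q, ⟨fun q b ω => ?_, fun q i c ω hi => ?_, fun q c ω => ?_⟩⟩
  · cases q with
    | zero => rfl
    | succ q =>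
      change wedgeRight q (KaehlerDifferential.D k F a)
        (Λ q (exteriorPower.map q ρ (C q (b • _)))) = _
      rw [map_smul, formsMap, hC₀]
      simp
  · change T' q _ = _
    rw [hT', hl i (by omega), if_neg (by omega), zero_smul]
  · change T' q _ = _
    rw [hT', hl _ (Nat.sub_lt hp.pos one_pos), if_pos (Nat.sub_add_cancel hp.one_le)]

/-- Every finite extension has a trace on differential forms. -/
theorem exists_isFormTrace (k L E : Type u) [Field k] [Field L] [Algebra k L] [Field E] [Algebra k E]
    [Algebra L E] [IsScalarTower k L E] [FiniteDimensional L E] :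
    ∃ T : ∀ q, Forms k E q →+ Forms k L q, IsFormTrace k L E T := by
  induction h : Module.finrank L E using Nat.strong_induction_on generalizing E with
  | _ n ih =>
    by_cases hsep : Algebra.IsSeparable L E
    · obtain ⟨T, hT⟩ := exists_separable k L E
      exact ⟨T, .separable L E T hT⟩
    have hne : separableClosure L E ≠ ⊤ := fun h =>
      hsep ((separableClosure.eq_top_iff L E).1 h)
    -- a maximal proper intermediate field containing the separable closure
    have : WellFoundedGT (IntermediateField L E) :=
      StrictMono.wellFoundedGT (f := fun K : IntermediateField L E => K.toSubalgebra.toSubmodule)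
        fun _ _ h => h
    obtain ⟨K, ⟨hSK, hK⟩, hmax⟩ := WellFounded.has_min
      (wellFounded_gt : WellFounded (fun a b : IntermediateField L E => a > b))
      {K | separableClosure L E ≤ K ∧ K ≠ ⊤} ⟨_, le_rfl, hne⟩
    obtain ⟨x, hx⟩ : ∃ x, x ∉ K := by
      by_contra! h
      exact hK (eq_top_iff.2 fun x _ => h x)
    obtain ⟨p, hpE⟩ := ExpChar.exists L
    have hpow : ∃ n : ℕ, x ^ p ^ n ∈ K := by
      have : ExpChar (separableClosure L E) p := expChar_of_injective_algebraMap
        (algebraMap L (separableClosure L E)).injective p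
      obtain ⟨n, y, hy⟩ := (isPurelyInseparable_iff_pow_mem (separableClosure L E) p
        (E := E)).1 inferInstance x
      exact ⟨n, hSK (hy ▸ y.2)⟩
    classical
    obtain ⟨m, hm⟩ : ∃ m, Nat.find hpow = m + 1 := Nat.exists_eq_succ_of_ne_zero fun h0 => by
      have := Nat.find_spec hpow
      rw [h0, pow_zero, pow_one] at this
      exact hx this
    let θ := x ^ p ^ m
    have hθ : θ ∉ K := Nat.find_min hpow (by omega)
    have hθp : θ ^ p ∈ K := by
      have := Nat.find_spec hpow
      rwa [hm, pow_succ, pow_mul] at this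
    have hp : p.Prime := by
      rcases hpE with _ | hp
      · exact absurd (by simpa using hθp) hθ
      · exact hp
    have hcharL : CharP L p := by
      rcases hpE with _ | hp'
      · exact absurd hp Nat.not_prime_one
      · assumption
    have hchar : CharP K p := charP_of_injective_algebraMap (algebraMap L K).injective p
    have hlt : Module.finrank L K < n := by
      rw [← h]
      have : K.toSubalgebra.toSubmodule < ⊤ := lt_top_iff_ne_top.2 fun h' =>
        hx (show x ∈ K.toSubalgebra.toSubmodule from h' ▸ Submodule.mem_top)
      exact Submodule.finrank_lt this.ne
    have hgen : Algebra.adjoin K {θ} = ⊤ := by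
      have hle : K ≤ (IntermediateField.adjoin K {θ}).restrictScalars L := fun y hy =>
        (IntermediateField.adjoin K {θ}).algebraMap_mem ⟨y, hy⟩
      have hmem : θ ∈ (IntermediateField.adjoin K {θ}).restrictScalars L :=
        IntermediateField.mem_adjoin_simple_self K θ
      have htop : (IntermediateField.adjoin K {θ}).restrictScalars L = ⊤ := by
        by_contra hnot
        exact hmax _ ⟨hSK.trans hle, hnot⟩ (lt_of_le_of_ne hle fun h' => hθ (h' ▸ hmem))
      rw [← IntermediateField.adjoin_simple_toSubalgebra_of_isAlgebraic
        (Algebra.IsAlgebraic.isAlgebraic θ), eq_top_iff]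
      intro y _
      have : y ∈ (IntermediateField.adjoin K {θ}).restrictScalars L := htop ▸ trivial
      exact this
    let _ : Algebra k K := ((algebraMap L K).comp (algebraMap k L)).toAlgebra
    have : IsScalarTower k L K := IsScalarTower.of_algebraMap_eq fun _ => rfl
    have : IsScalarTower k K E := IsScalarTower.of_algebraMap_eq fun c =>
      IsScalarTower.algebraMap_apply k L E c
    obtain ⟨T, hT⟩ := ih _ hlt K rfl
    have hθK : θ ∉ Set.range (algebraMap K E) := by
      rintro ⟨y, hy⟩
      exact hθ (hy ▸ y.2)
    obtain ⟨S, hS⟩ := exists_inseparable k K E hp (a := ⟨_, hθp⟩) (θ := θ) rfl hθK hgen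
    exact ⟨_, .inseparable L K E T hT p hp hchar _ θ rfl hθK hgen S hS⟩

end TraceExistence

/-! ### Exterior powers of lattices of differentials. -/

section WedgePowers

/-! Both pieces of the filtration are multiples of exterior powers of lattices in `Ω^1(L)`: `Ω^q(O)`
is `wedgePow (diffSpan O) q`, and `Ω^q(O)(log)` is `wedgePow (logDiffSpan O t) q`. The trace
estimate thus reduces to forms pulled back from the base, on which the trace is the field trace on
coefficients, and such forms wedged with one more differential.

Suppose the valuation ring upstairs is monogenic, `B = O[x]`, and `g = X^n + ∑ a_i X^i` is the
minimal polynomial of `x`. Then the trace of `b ω ∧ dx` is `-∑ τ(b x^i) ω ∧ da_i`, where `τ` reads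
off the coefficient of `x^(n-1)`. In the separable case this comes from `g'(x) dx = -∑ x^i da_i` and
Euler's formula `Tr(y / g'(x)) = τ(y)`; in the inseparable case of degree `p` it says that `x^(p-1)
dx` goes to `d(x^p)` for every generator `x` (`map_pow_top`). When `e = 1`, the `da_i` are integral.
When `x` is a uniformizer of a totally ramified extension, `g` is Eisenstein and `d(t o) = t (do + o
dlog t)` supplies the factor `t` needed to go from `t^(-M)` to `t^(-M+1)`. In prime degree, `e f =
p` leaves only these two cases (`IsHenselDVF.hasTraceBound_of_finrank_prime`).

If the degree is invertible in `k`, the extension is tame: Nakayama's lemma shows that the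
logarithmic differentials upstairs are generated by those of the base, so only the field trace
matters (`IsHenselDVF.hasTraceBound_of_finrank_ne_zero`).

A general separable extension is treated by Sylow theory in a Galois closure
(`IsHenselDVF.hasSeparableTraceBound_of_isGalois`). After an extension of `E` of degree prime to `p`
one reaches a field `E₀` that is a tower of degree `p` steps over an extension `F'` of `F` of degree
prime to `p`. The bound descends from `E₀` to `E`, because restricting to `E₀` and then taking the
trace is multiplication by the invertible degree. Inseparable steps of degree `p` are then added on
top.

Two facts about geometric henselian fields are needed. Integral closures in finite extensions are
local, by Hensel's lemma. The Frobenius of `O` is finite, because `k` is perfect and `O` is a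
henselization of a ring of finite type; this makes integral closures finite in inseparable
extensions. -/

theorem wedgeRight_self {A M : Type*} [CommRing A] [AddCommGroup M] [Module A M] (q : ℕ) (m : M)
    (x : ⋀[A]^q M) : wedgeRight (q + 1) m (wedgeRight q m x) = 0 := by
  apply Subtype.ext
  simp [wedgeRight, mul_assoc]

theorem wedgeRight_swap {A M : Type*} [CommRing A] [AddCommGroup M] [Module A M] (q : ℕ) (m n : M)
    (x : ⋀[A]^q M) :
    wedgeRight (q + 1) m (wedgeRight q n x) = -wedgeRight (q + 1) n (wedgeRight q m x) := by
  apply Subtype.ext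
  have : ExteriorAlgebra.ι A n * ExteriorAlgebra.ι A m =
      -(ExteriorAlgebra.ι A m * ExteriorAlgebra.ι A n) :=
    eq_neg_of_add_eq_zero_left (ExteriorAlgebra.ι_add_mul_swap _ _)
  simp [wedgeRight, mul_assoc, this]

variable {R L M : Type*} [CommRing R] [CommRing L] [Algebra R L] [AddCommGroup M] [Module L M]
  [Module R M] [IsScalarTower R L M]

/-- The `R`-submodule of `⋀^q_L M` spanned by the wedge products of `q` elements of the
`R`-submodule `W ⊆ M`. -/
noncomputable def wedgePow (W : Submodule R M) : ∀ q : ℕ, Submodule R (⋀[L]^q M)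
  | 0 => Submodule.span R {exteriorPower.ιMulti L 0 ![]}
  | q + 1 => Submodule.span R {x | ∃ η ∈ wedgePow W q, ∃ w ∈ W, x = wedgeRight q w η}

theorem wedgeRight_mem_wedgePow {W : Submodule R M} {q : ℕ} {η : ⋀[L]^q M} (hη : η ∈ wedgePow W q)
    {w : M} (hw : w ∈ W) : wedgeRight q w η ∈ wedgePow W (q + 1) :=
  Submodule.subset_span ⟨η, hη, w, hw, rfl⟩

theorem wedgePow_succ_le {W : Submodule R M} {q : ℕ} {S : Submodule R (⋀[L]^(q + 1) M)}
    (h : ∀ η ∈ wedgePow W q, ∀ w ∈ W, wedgeRight q w η ∈ S) : wedgePow W (q + 1) ≤ S :=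
  Submodule.span_le.2 fun _ ⟨η, hη, w, hw, e⟩ => e ▸ h η hη w hw

theorem wedgePow_mono {W W' : Submodule R M} (h : W ≤ W') (q : ℕ) :
    wedgePow (L := L) W q ≤ wedgePow W' q := by
  induction q with
  | zero => exact le_rfl
  | succ q ih => exact wedgePow_succ_le fun η hη w hw => wedgeRight_mem_wedgePow (ih hη) (h hw)

theorem ιMulti_mem_wedgePow {W : Submodule R M} (q : ℕ) (v : Fin q → M) (hv : ∀ i, v i ∈ W) :
    exteriorPower.ιMulti L q v ∈ wedgePow W q := by
  induction q with
  | zero =>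
    rw [Subsingleton.elim v ![]]
    exact Submodule.subset_span rfl
  | succ q ih =>
    have := wedgeRight_mem_wedgePow (ih (fun i => v i.castSucc) fun i => hv _) (hv (Fin.last q))
    rw [wedgeRight_ιMulti] at this
    convert this using 2
    exact (Fin.snoc_init_self v).symm

/-- Since `y ∧ y = 0`, a product of vectors involves `y` at most once, and that factor can be moved
to the end at the cost of a sign. -/
theorem wedgePow_sup_span_singleton (W : Submodule R M) (y : M) (q : ℕ) {x : ⋀[L]^(q + 1) M}
    (hx : x ∈ wedgePow (W ⊔ Submodule.span R {y}) (q + 1)) :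
    ∃ η ∈ wedgePow W (q + 1), ∃ ξ ∈ wedgePow W q, x = η + wedgeRight q y ξ := by
  have main : wedgePow (L := L) (W ⊔ Submodule.span R {y}) (q + 1) ≤
      wedgePow W (q + 1) ⊔ (wedgePow W q).map ((wedgeRight q y).restrictScalars R) := by
    clear hx x
    induction q with
    | zero =>
      refine wedgePow_succ_le fun η hη w hw => ?_
      change η ∈ wedgePow W 0 at hη
      obtain ⟨a, ha, b, hb, rfl⟩ := Submodule.mem_sup.1 hw
      obtain ⟨c, rfl⟩ := Submodule.mem_span_singleton.1 hb
      rw [wedgeRight_add, algebra_compatible_smul L c y, wedgeRight_smul, ← algebra_compatible_smul]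
      exact Submodule.add_mem_sup (wedgeRight_mem_wedgePow hη ha)
        (Submodule.smul_mem _ _ (Submodule.mem_map_of_mem hη))
    | succ q ih =>
      refine wedgePow_succ_le fun η hη w hw => ?_
      obtain ⟨a, ha, b, hb, rfl⟩ := Submodule.mem_sup.1 hw
      obtain ⟨c, rfl⟩ := Submodule.mem_span_singleton.1 hb
      obtain ⟨ξ, hξ, _, ⟨ζ, hζ, rfl⟩, rfl⟩ := Submodule.mem_sup.1 (ih hη)
      rw [wedgeRight_add, algebra_compatible_smul L c y, wedgeRight_smul, ← algebra_compatible_smul]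
      simp only [map_add, LinearMap.restrictScalars_apply, wedgeRight_self, add_zero]
      rw [wedgeRight_swap _ a y, add_assoc (wedgeRight (q + 1) a ξ)]
      refine Submodule.add_mem_sup (wedgeRight_mem_wedgePow hξ ha) ?_
      exact add_mem (neg_mem (Submodule.mem_map_of_mem (f := (wedgeRight _ y).restrictScalars R)
        (wedgeRight_mem_wedgePow hζ ha)))
        (Submodule.smul_mem _ _ (Submodule.mem_map_of_mem
          (f := (wedgeRight _ y).restrictScalars R) hξ))
  obtain ⟨η, hη, _, ⟨ξ, hξ, rfl⟩, rfl⟩ := Submodule.mem_sup.1 (main hx)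
  exact ⟨η, hη, ξ, hξ, rfl⟩

/-- Wedge powers of the extension of scalars of a submodule. -/
theorem wedgePow_span_le {R' L' M' : Type*} [CommRing R'] [CommRing L'] [Algebra R' L']
    [AddCommGroup M'] [Module L' M'] [Module R' M'] [IsScalarTower R' L' M'] [Algebra L L']
    [Module L M'] [IsScalarTower L L' M'] (f : M →ₗ[L] M') (W : Submodule R M) (q : ℕ) :
    wedgePow (L := L') (Submodule.span R' (f '' W)) q ≤
      Submodule.span R' (exteriorPowerMapAlong (B := L') q f '' ((wedgePow W q : Submodule R (⋀[L]^q M)) : Set (⋀[L]^q M))) := by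
  induction q with
  | zero =>
    refine Submodule.span_le.2 (Set.singleton_subset_iff.2 (Submodule.subset_span
      ⟨exteriorPower.ιMulti L 0 ![], Submodule.subset_span rfl, ?_⟩))
    rw [exteriorPowerMapAlong_ιMulti]
    congr 1
    exact Subsingleton.elim _ _
  | succ q ih =>
    refine wedgePow_succ_le fun η hη w hw => ?_
    replace hη := ih hη
    induction hη using Submodule.span_induction with
    | zero => simp
    | add a b _ _ ha hb => rw [map_add]; exact add_mem ha hb
    | smul c a _ ha =>
      rw [algebra_compatible_smul L' c a, map_smul, ← algebra_compatible_smul]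
      exact Submodule.smul_mem _ _ ha
    | mem a ha =>
      obtain ⟨a, ha, rfl⟩ := ha
      induction hw using Submodule.span_induction with
      | zero =>
        rw [show (0 : M') = (0 : L') • 0 by simp, wedgeRight_smul, zero_smul]
        exact zero_mem _
      | add a b _ _ ha hb => rw [wedgeRight_add]; exact add_mem ha hb
      | smul c a _ ha =>
        rw [algebra_compatible_smul L' c a, wedgeRight_smul, ← algebra_compatible_smul]
        exact Submodule.smul_mem _ _ ha
      | mem w hw =>
        obtain ⟨w, hw, rfl⟩ := hw
        rw [← exteriorPowerMapAlong_wedgeRight]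
        exact Submodule.subset_span ⟨_, wedgeRight_mem_wedgePow ha hw, rfl⟩

/-- The hypothesis `hR` only asks that scalars from `R` act through `R'`, so no algebra structure of
`R'` over `R` has to be chosen. -/
theorem exteriorPowerMapAlong_mem_wedgePow {R' L' M' : Type*} [CommRing R'] [CommRing L']
    [Algebra R' L'] [AddCommGroup M'] [Module L' M'] [Module R' M'] [IsScalarTower R' L' M']
    [Algebra L L'] [Module L M'] [IsScalarTower L L' M'] (f : M →ₗ[L] M') (W : Submodule R M)
    (W' : Submodule R' M') (hR : ∀ r : R, ∃ r' : R', algebraMap L L' (algebraMap R L r) =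
      algebraMap R' L' r') (hW : ∀ w ∈ W, f w ∈ W') (q : ℕ) {η : ⋀[L]^q M} (hη : η ∈ wedgePow W q) :
    exteriorPowerMapAlong (B := L') q f η ∈ wedgePow W' q := by
  have key : ∀ (q : ℕ) (r : R) (η : ⋀[L]^q M), exteriorPowerMapAlong (B := L') q f η ∈ wedgePow W' q →
      exteriorPowerMapAlong (B := L') q f (r • η) ∈ wedgePow W' q := by
    intro q r η h
    obtain ⟨r', hr'⟩ := hR r
    rw [algebra_compatible_smul L r η, map_smul, algebra_compatible_smul L', hr',
      ← algebra_compatible_smul]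
    exact Submodule.smul_mem _ _ h
  induction q with
  | zero =>
    obtain ⟨r, rfl⟩ := Submodule.mem_span_singleton.1 hη
    refine key 0 r _ ?_
    rw [exteriorPowerMapAlong_ιMulti, Subsingleton.elim (fun i => _) ![]]
    exact Submodule.subset_span rfl
  | succ q ih =>
    rw [wedgePow] at hη
    induction hη using Submodule.span_induction with
    | zero => simp
    | add a b _ _ ha hb => rw [map_add]; exact add_mem ha hb
    | smul c a _ ha => exact key _ c a ha
    | mem a ha =>
      obtain ⟨η, hη, w, hw, rfl⟩ := ha
      rw [exteriorPowerMapAlong_wedgeRight]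
      exact wedgeRight_mem_wedgePow (ih hη) (hW w hw)

end WedgePowers

/-! ### Integral and logarithmic forms as wedge powers of lattices. -/

section FormLattices

variable {k L : Type u} [Field k] [Field L] [Algebra k L]

/-- The `O`-submodule of `Ω^1(L)` spanned by the differentials of elements of `O`. -/
noncomputable def diffSpan (O : Subalgebra k L) : Submodule O Ω[L⁄k] :=
  Submodule.span O (Set.range fun b : O => KaehlerDifferential.D k L b)

/-- The `O`-submodule of `Ω^1(L)` spanned by the differentials of elements of `O` and `dlog t`. -/
noncomputable def logDiffSpan (O : Subalgebra k L) (t : L) : Submodule O Ω[L⁄k] :=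
  diffSpan O ⊔ Submodule.span O {dlog k t}

theorem D_mem_diffSpan (O : Subalgebra k L) {b : L} (hb : b ∈ O) :
    KaehlerDifferential.D k L b ∈ diffSpan O :=
  Submodule.subset_span ⟨⟨b, hb⟩, rfl⟩

theorem map_mem_diffSpan (O : Subalgebra k L) (w : Ω[O⁄k]) :
    KaehlerDifferential.map k k O L w ∈ diffSpan O := by
  have hw : w ∈ Submodule.span O (Set.range (KaehlerDifferential.D k O)) := by
    rw [KaehlerDifferential.span_range_derivation]; trivial
  induction hw using Submodule.span_induction with
  | zero => simp
  | add a b _ _ ha hb => rw [map_add]; exact add_mem ha hb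
  | smul c a _ ha => rw [map_smul]; exact Submodule.smul_mem _ _ ha
  | mem a ha =>
    obtain ⟨b, rfl⟩ := ha
    rw [KaehlerDifferential.map_D]
    exact D_mem_diffSpan O b.2

theorem exists_map_eq_of_mem_diffSpan (O : Subalgebra k L) {w : Ω[L⁄k]} (hw : w ∈ diffSpan O) :
    ∃ w', KaehlerDifferential.map k k O L w' = w := by
  rw [diffSpan] at hw
  induction hw using Submodule.span_induction with
  | zero => exact ⟨0, by simp⟩
  | add a b _ _ ha hb =>
    obtain ⟨a', rfl⟩ := ha
    obtain ⟨b', rfl⟩ := hb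
    exact ⟨a' + b', by simp⟩
  | smul c a _ ha =>
    obtain ⟨a', rfl⟩ := ha
    exact ⟨c • a', map_smul (KaehlerDifferential.map k k O L) c a'⟩
  | mem a ha =>
    obtain ⟨b, rfl⟩ := ha
    exact ⟨KaehlerDifferential.D k O b, by rw [KaehlerDifferential.map_D]; rfl⟩

theorem mem_integralForms_iff (O : Subalgebra k L) (q : ℕ) (ω : Forms k L q) :
    ω ∈ integralForms O q ↔ ω ∈ wedgePow (diffSpan O) q := by
  constructor
  · rintro ⟨η, rfl⟩
    change formsMap k O L q η ∈ _
    have hη : η ∈ Submodule.span O (Set.range (exteriorPower.ιMulti O q (M := Ω[O⁄k]))) := by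
      rw [exteriorPower.ιMulti_span]; trivial
    induction hη using Submodule.span_induction with
    | zero => simp
    | add a b _ _ ha hb => rw [map_add]; exact add_mem ha hb
    | smul c a _ ha => rw [map_smul]; exact Submodule.smul_mem _ _ ha
    | mem a ha =>
      obtain ⟨v, rfl⟩ := ha
      rw [formsMap, exteriorPowerMapAlong_ιMulti]
      exact ιMulti_mem_wedgePow _ _ fun i => map_mem_diffSpan O _
  · intro h
    induction q with
    | zero =>
      obtain ⟨c, rfl⟩ := Submodule.mem_span_singleton.1 h
      refine integralForms_smul O 0 c ⟨exteriorPower.ιMulti O 0 ![], ?_⟩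
      change formsMap k O L 0 _ = _
      rw [formsMap, exteriorPowerMapAlong_ιMulti]
      congr 1
      exact Subsingleton.elim _ _
    | succ q ih =>
      rw [wedgePow] at h
      induction h using Submodule.span_induction with
      | zero => exact zero_mem _
      | add a b _ _ ha hb => exact add_mem ha hb
      | smul c a _ ha => exact integralForms_smul O _ c ha
      | mem a ha =>
        obtain ⟨η, hη, w, hw, rfl⟩ := ha
        obtain ⟨η', rfl⟩ := ih _ hη
        obtain ⟨w', rfl⟩ := exists_map_eq_of_mem_diffSpan O hw
        exact ⟨wedgeRight q w' η', exteriorPowerMapAlong_wedgeRight q _ w' η'⟩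

/-- Allowing a single factor `dlog t`, as in `logForms`, already gives the whole exterior power,
because `dlog t ∧ dlog t = 0`. -/
theorem mem_logForms_iff (O : Subalgebra k L) (t : L) (q : ℕ) (ω : Forms k L q) :
    ω ∈ logForms O t q ↔ ω ∈ wedgePow (logDiffSpan O t) q := by
  cases q with
  | zero => exact mem_integralForms_iff O 0 ω
  | succ q =>
    rw [logForms, AddSubgroup.mem_sup]
    constructor
    · rintro ⟨x, hx, _, ⟨y, hy, rfl⟩, rfl⟩
      rw [mem_integralForms_iff] at hx
      replace hy := (mem_integralForms_iff O q y).1 hy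
      exact add_mem (wedgePow_mono le_sup_left _ hx) (wedgeRight_mem_wedgePow
        (wedgePow_mono le_sup_left _ hy)
        (Submodule.mem_sup_right (Submodule.mem_span_singleton_self _)))
    · intro h
      obtain ⟨η, hη, ξ, hξ, rfl⟩ := wedgePow_sup_span_singleton _ _ _ h
      exact ⟨η, (mem_integralForms_iff O _ η).2 hη, _,
        ⟨ξ, (mem_integralForms_iff O _ ξ).2 hξ, rfl⟩, rfl⟩

end FormLattices

/-! ### Traces of forms built from the base and one extra differential. -/

section Transfer

variable {k F E : Type u} [Field k] [Field F] [Algebra k F] [Field E] [Algebra k E]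
  [Algebra F E] [IsScalarTower k F E]

/-- The multiple `d · W^{∧q}` of a wedge power. -/
noncomputable def scaledForms {O : Subalgebra k F} (d : F) (W : Submodule O Ω[F⁄k]) (q : ℕ) :
    AddSubgroup (Forms k F q) :=
  (wedgePow (L := F) W q).toAddSubgroup.map (LinearMap.lsmul F (Forms k F q) d).toAddMonoidHom

theorem smul_mem_scaledForms {O : Subalgebra k F} {q : ℕ} (d : F) {W : Submodule O Ω[F⁄k]}
    {ω : Forms k F q} (hω : ω ∈ wedgePow W q) : d • ω ∈ scaledForms d W q := ⟨ω, hω, rfl⟩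

theorem smul_mul_mem_scaledForms {O : Subalgebra k F} {q : ℕ} (d : F)
    {W : Submodule O Ω[F⁄k]} {o : F} (ho : o ∈ O) {ω : Forms k F q} (hω : ω ∈ wedgePow W q) :
    (d * o) • ω ∈ scaledForms d W q := by
  rw [mul_smul]
  exact smul_mem_scaledForms d ((wedgePow W q).smul_mem (⟨o, ho⟩ : O) hω)

/-- The `B`-span in `Ω^1(E)` of a submodule of `Ω^1(F)`. -/
noncomputable def extSpan (B : Subalgebra k E) {O : Subalgebra k F} (W : Submodule O Ω[F⁄k]) :
    Submodule B Ω[E⁄k] :=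
  Submodule.span B (KaehlerDifferential.map k k F E '' W)

theorem map_mem_extSpan (B : Subalgebra k E) {O : Subalgebra k F} {W : Submodule O Ω[F⁄k]}
    {w : Ω[F⁄k]} (hw : w ∈ W) : KaehlerDifferential.map k k F E w ∈ extSpan B W :=
  Submodule.subset_span ⟨w, hw, rfl⟩

theorem D_algebraMap_mem_extSpan (B : Subalgebra k E) (O : Subalgebra k F) {a : F} (ha : a ∈ O) :
    KaehlerDifferential.D k E (algebraMap F E a) ∈ extSpan B (diffSpan O) := by
  rw [← KaehlerDifferential.map_D k k F E]
  exact map_mem_extSpan B (D_mem_diffSpan O ha)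

theorem extSpan_mono (B : Subalgebra k E) {O : Subalgebra k F} {W W' : Submodule O Ω[F⁄k]}
    (h : W ≤ W') : extSpan B W ≤ extSpan B W' :=
  Submodule.span_mono (Set.image_mono h)

theorem map_mem_of_mem_span_formsMap {B : Subalgebra k E} {G : Type*} [AddCommGroup G] {q : ℕ}
    (T : Forms k E q →+ G) (H : AddSubgroup G) (S : Set (Forms k F q))
    (h : ∀ b ∈ B, ∀ ω ∈ S, T (b • formsMap k F E q ω) ∈ H) {x : Forms k E q}
    (hx : x ∈ Submodule.span B (formsMap k F E q '' S)) : T x ∈ H := by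
  -- `T` is only additive, so the induction has to carry an arbitrary multiplier from `B`.
  suffices ∀ c : B, T (c • x) ∈ H by simpa using this 1
  induction hx using Submodule.span_induction with
  | zero => intro c; rw [smul_zero, map_zero]; exact zero_mem _
  | add a b _ _ ha hb => intro c; rw [smul_add, map_add]; exact add_mem (ha c) (hb c)
  | smul d a _ ha => intro c; rw [smul_smul]; exact ha (c * d)
  | mem a ha =>
    obtain ⟨ω, hω, rfl⟩ := ha
    exact fun c => h c c.2 ω hω

theorem wedgePow_extSpan_le (B : Subalgebra k E) {O : Subalgebra k F} (W : Submodule O Ω[F⁄k])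
    (q : ℕ) : wedgePow (L := E) (extSpan B W) q ≤ Submodule.span B
      (formsMap k F E q '' {ω | ω ∈ wedgePow (L := F) W q}) :=
  wedgePow_span_le (KaehlerDifferential.map k k F E) W q

/-- The trace of forms in the lattice generated by forms on `F` and one more differential. -/
theorem trace_mem_scaledForms {B : Subalgebra k E} {O : Subalgebra k F}
    (T : ∀ q, Forms k E q →+ Forms k F q) (tr : E → F)
    (hT : ∀ q b ω, T q (b • formsMap k F E q ω) = tr b • ω) {W W' : Submodule O Ω[F⁄k]}
    (hW : W ≤ W') (y : Ω[E⁄k]) (c : E) (d : F)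
    (htr : ∀ b ∈ B, ∃ o ∈ O, tr (c * b) = d * o)
    (hy : ∀ q, ∀ b ∈ B, ∀ ω ∈ wedgePow W q,
      T (q + 1) ((c * b) • wedgeRight q y (formsMap k F E q ω)) ∈
        scaledForms d W' (q + 1))
    (q : ℕ) {x : Forms k E q} (hx : x ∈ wedgePow (extSpan B W ⊔ Submodule.span B {y}) q) :
    T q (c • x) ∈ scaledForms d W' q := by
  -- Without the factor `y`, the form is a `B`-combination of forms from `F`, and `T` acts on it
  -- through `tr` alone.
  have base : ∀ q, ∀ x ∈ wedgePow (L := E) (extSpan B W) q,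
      T q (c • x) ∈ scaledForms d W' q := by
    intro q x hx
    refine map_mem_of_mem_span_formsMap
      ((T q).comp (LinearMap.lsmul E (Forms k E q) c).toAddMonoidHom) (scaledForms d W' q)
      {ω | ω ∈ wedgePow (L := F) W q} (fun b hb ω hω => ?_) (wedgePow_extSpan_le B W q hx)
    change T q (c • b • formsMap k F E q ω) ∈ _
    obtain ⟨o, ho, h⟩ := htr b hb
    rw [smul_smul, hT, h]
    exact smul_mul_mem_scaledForms d ho (wedgePow_mono hW q hω)
  cases q with
  | zero => exact base 0 x hx
  | succ q =>
    obtain ⟨η, hη, ξ, hξ, rfl⟩ := wedgePow_sup_span_singleton _ _ _ hx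
    rw [smul_add, map_add]
    refine add_mem (base _ η hη) ?_
    refine map_mem_of_mem_span_formsMap
      ((T (q + 1)).comp ((LinearMap.lsmul E (Forms k E (q + 1)) c).toAddMonoidHom.comp
        (wedgeRight q y).toAddMonoidHom)) (scaledForms d W' (q + 1))
      {ω | ω ∈ wedgePow (L := F) W q} (fun b hb ω hω => ?_) (wedgePow_extSpan_le B W q hξ)
    change T (q + 1) (c • wedgeRight q y (b • formsMap k F E q ω)) ∈ _
    rw [map_smul (wedgeRight q y) b, smul_smul]
    exact hy q b hb ω hω

/-- The coefficients of `f` are not constants over `k`; the last sum is the contribution of their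
differentials to the chain rule. -/
theorem D_aeval (f : Polynomial F) (x : E) :
    KaehlerDifferential.D k E (Polynomial.aeval x f) =
      Polynomial.aeval x (Polynomial.derivative f) • KaehlerDifferential.D k E x +
      f.sum fun i a => x ^ i • KaehlerDifferential.D k E (algebraMap F E a) := by
  induction f using Polynomial.induction_on' with
  | add f g hf hg =>
    rw [Polynomial.sum_add_index _ _ _ (by simp) (by simp [smul_add])]
    simp only [map_add, hf, hg, add_smul]
    abel
  | monomial i a =>
    rw [Polynomial.sum_monomial_index _ _ (by simp)]
    simp only [Polynomial.aeval_monomial, Derivation.leibniz, Derivation.leibniz_pow,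
      Polynomial.derivative_monomial]
    rw [← Nat.cast_smul_eq_nsmul E, smul_smul, smul_smul, map_mul, map_natCast, mul_assoc]

theorem D_aeval_sub_mem {B : Subalgebra k E} {O : Subalgebra k F} {x : E} (hx : x ∈ B)
    {f : Polynomial F} (hf : ∀ i, f.coeff i ∈ O) :
    KaehlerDifferential.D k E (Polynomial.aeval x f) -
      Polynomial.aeval x (Polynomial.derivative f) • KaehlerDifferential.D k E x ∈
    extSpan B (diffSpan O) := by
  rw [D_aeval, add_sub_cancel_left, Polynomial.sum]
  refine sum_mem fun i _ => ?_
  exact Submodule.smul_mem _ (⟨x ^ i, pow_mem hx i⟩ : B) (D_algebraMap_mem_extSpan B O (hf i))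

/-- Differentials of a monogenic extension. -/
theorem diffSpan_le_of_monogenic {B : Subalgebra k E} {O : Subalgebra k F}
    (hOB : ∀ a ∈ O, algebraMap F E a ∈ B) {x : E} (hx : x ∈ B)
    (hgen : ∀ b ∈ B, ∃ f : Polynomial F, (∀ i, f.coeff i ∈ O) ∧ Polynomial.aeval x f = b) :
    diffSpan B ≤ extSpan B (diffSpan O) ⊔
      Submodule.span B {KaehlerDifferential.D k E x} := by
  refine Submodule.span_le.2 ?_
  rintro _ ⟨⟨b, hb⟩, rfl⟩
  obtain ⟨f, hf, rfl⟩ := hgen b hb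
  have h := D_aeval_sub_mem (k := k) hx hf
  have hf' : Polynomial.aeval x (Polynomial.derivative f) ∈ B := by
    rw [Polynomial.aeval_eq_sum_range]
    refine sum_mem fun i _ => ?_
    rw [Algebra.smul_def]
    refine mul_mem (hOB _ ?_) (pow_mem hx i)
    rw [Polynomial.coeff_derivative]
    exact mul_mem (hf _) (add_mem (natCast_mem _ _) (one_mem _))
  change KaehlerDifferential.D k E (Polynomial.aeval x f) ∈ _
  rw [← sub_add_cancel (KaehlerDifferential.D k E (Polynomial.aeval x f))
    (Polynomial.aeval x (Polynomial.derivative f) • KaehlerDifferential.D k E x)]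
  exact Submodule.add_mem_sup h (Submodule.smul_mem _ (⟨_, hf'⟩ : B)
    (Submodule.mem_span_singleton_self (KaehlerDifferential.D k E x)))

theorem map_dlog (t : F) :
    KaehlerDifferential.map k k F E (dlog k t) = dlog k (algebraMap F E t) := by
  rw [dlog, dlog, map_smul, KaehlerDifferential.map_D, ← map_inv₀, algebraMap_smul]

end Transfer

/-! ### The filtration as scaled lattices, and its monotonicity. -/

section Filtration

variable {k F : Type u} [Field k] [Field F] [Algebra k F]

theorem mem_logFiltration_zero (q : ℕ) (O : Subalgebra k F) (ω : Forms k F q) :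
    ω ∈ logFiltration k q F O 0 ↔ ω ∈ wedgePow (diffSpan O) q := by
  rw [logFiltration, if_pos rfl, mem_integralForms_iff]

theorem logFiltration_eq_scaledForms (q : ℕ) (O : Subalgebra k F) [IsDiscreteValuationRing O]
    (t : O) (ht : Irreducible t) {r : ℚ≥0} (hr : r ≠ 0) :
    logFiltration k q F O r = scaledForms ((t : F) ^ (-(⌈r⌉₊ : ℤ) + 1))
      (logDiffSpan O (t : F)) q := by
  rw [logFiltration_eq q O t ht r hr, twistedLogForms, scaledForms]
  congr 1
  exact AddSubgroup.ext (mem_logForms_iff O (t : F) q)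

theorem logFiltration_zero_eq (q : ℕ) (O : Subalgebra k F) :
    logFiltration k q F O 0 = scaledForms 1 (diffSpan O) q := by
  ext ω
  rw [mem_logFiltration_zero]
  refine ⟨fun h => ⟨ω, h, one_smul F ω⟩, ?_⟩
  rintro ⟨η, hη, rfl⟩
  change (1 : F) • η ∈ _
  rwa [one_smul]

theorem D_mem_span_dlog (O : Subalgebra k F) {t : F} (ht : t ∈ O) (ht0 : t ≠ 0) :
    KaehlerDifferential.D k F t ∈ Submodule.span O {dlog k t} := by
  have : KaehlerDifferential.D k F t = (⟨t, ht⟩ : O) • dlog k t := by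
    change _ = t • dlog k t
    rw [dlog, smul_smul, mul_inv_cancel₀ ht0, one_smul]
  rw [this]
  exact Submodule.smul_mem _ _ (Submodule.mem_span_singleton_self _)

theorem monotone_logFiltration (q : ℕ) (O : Subalgebra k F) [IsDiscreteValuationRing O] :
    Monotone (logFiltration k q F O) := by
  obtain ⟨t, ht⟩ := IsDiscreteValuationRing.exists_irreducible O
  have ht0 : (t : F) ≠ 0 := by simpa using ht.ne_zero
  -- Surplus powers of `t` lie in `O` and are absorbed by the lattice, so only the inequality of
  -- exponents matters.
  have aux : ∀ (r : ℚ≥0) (hr : r ≠ 0) (n : ℤ) (hn : -(⌈r⌉₊ : ℤ) + 1 ≤ n) (W : Submodule O Ω[F⁄k])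
      (hW : W ≤ logDiffSpan O (t : F)), scaledForms ((t : F) ^ n) W q ≤
        logFiltration k q F O r := by
    intro r hr n hn W hW
    rw [logFiltration_eq_scaledForms q O t ht hr]
    rintro _ ⟨ω, hω, rfl⟩
    obtain ⟨j, hj⟩ := Int.le.dest hn
    change (t : F) ^ n • ω ∈ _
    rw [← hj, zpow_add₀ ht0 _ (j : ℤ), zpow_natCast]
    exact smul_mul_mem_scaledForms _ (pow_mem t.2 j) (wedgePow_mono hW q hω)
  intro r r' h
  rcases eq_or_ne r' 0 with rfl | hr'
  · rw [le_antisymm h zero_le]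
  rcases eq_or_ne r 0 with rfl | hr
  -- For `r' > 0` the exponent `-⌈r'⌉ + 1` is at most `0`, so the integral forms sit inside with `n
  -- = 0`.
  · rw [logFiltration_zero_eq, ← zpow_zero (t : F)]
    refine aux r' hr' 0 ?_ _ le_sup_left
    have : 0 < ⌈r'⌉₊ := Nat.ceil_pos.2 (pos_iff_ne_zero.2 hr')
    omega
  · rw [logFiltration_eq_scaledForms q O t ht hr]
    refine aux r' hr' _ ?_ _ le_rfl
    have := Nat.ceil_mono h
    omega

end Filtration

/-! ### Trace estimates in terms of uniformizers. -/

section LocalTransfer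

variable {k F E : Type u} [Field k] [Field F] [Algebra k F] [Field E] [Algebra k E]
  [Algebra F E] [IsScalarTower k F E]

/-- `t` and `s` behave like uniformizers of `O ⊆ F` and of its extension `B ⊆ E` of ramification
index `e`, and the field trace is compatible with them. -/
structure IsTracePair (O : Subalgebra k F) (B : Subalgebra k E) (t : F) (s : E) (e : ℕ) :
    Prop where
  t_mem : t ∈ O
  s_mem : s ∈ B
  t_ne : t ≠ 0
  s_ne : s ≠ 0
  e_pos : 0 < e
  algebraMap_mem : ∀ a ∈ O, algebraMap F E a ∈ B
  unit : ∃ u ∈ B, u⁻¹ ∈ B ∧ u ≠ 0 ∧ algebraMap F E t = u * s ^ e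
  trace_mem : ∀ b ∈ B, Algebra.trace F E b ∈ O
  trace_mem' : ∀ b ∈ B, ∃ o ∈ O, Algebra.trace F E (s * b) = t * o

variable {O : Subalgebra k F} {B : Subalgebra k E} {t : F} {s : E} {e : ℕ}

namespace IsTracePair

/-- From `t^M = u^M s^(eM)`: the witness is `u^M s^(eM - m)`, integral because `m ≤ e M`. -/
theorem exists_zpow_mul_eq (h : IsTracePair O B t s e) {m M : ℕ} (hm : m ≤ e * M) :
    ∃ b' ∈ B, s ^ (-(m : ℤ)) = algebraMap F E (t ^ (-(M : ℤ))) * b' := by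
  obtain ⟨u, hu, hu', hu0, e1⟩ := h.unit
  obtain ⟨j, hj⟩ := Nat.le.dest hm
  have hs := h.s_ne
  refine ⟨u ^ M * s ^ j, mul_mem (pow_mem hu _) (pow_mem h.s_mem _), ?_⟩
  rw [map_zpow₀, e1, zpow_neg, zpow_neg, zpow_natCast, zpow_natCast, mul_pow, ← pow_mul, ← hj,
    pow_add]
  field_simp

theorem zpow_add_one (h : IsTracePair O B t s e) (M : ℕ) : t ^ (-(M : ℤ) + 1) = t ^ (-(M : ℤ)) * t := by
  rw [zpow_add₀ h.t_ne, zpow_one]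

/-- The factor `t^(-M)` comes out of the trace by linearity. The one extra `s` in `s^(-m+1)` becomes
one extra `t`, because the trace maps the maximal ideal into the maximal ideal. -/
theorem trace_zpow_mul (h : IsTracePair O B t s e) {m M : ℕ} (hm : m ≤ e * M) {b : E} (hb : b ∈ B) :
    ∃ o ∈ O, Algebra.trace F E (s ^ (-(m : ℤ) + 1) * b) = t ^ (-(M : ℤ) + 1) * o := by
  obtain ⟨b', hb', e1⟩ := h.exists_zpow_mul_eq hm
  obtain ⟨o, ho, e2⟩ := h.trace_mem' (b' * b) (mul_mem hb' hb)
  refine ⟨o, ho, ?_⟩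
  rw [zpow_add₀ h.s_ne, zpow_one, e1, h.zpow_add_one,
    show algebraMap F E (t ^ (-(M : ℤ))) * b' * s * b = t ^ (-(M : ℤ)) • (s * (b' * b)) by
      rw [Algebra.smul_def]; ring,
    map_smul, e2, smul_eq_mul, mul_assoc]

/-- Rational indices are traded here for integers: all later estimates are about `m` and `M` with `m
≤ e M`. -/
theorem map_logFiltration_le (h : IsTracePair O B t s e) [IsDiscreteValuationRing O]
    [IsDiscreteValuationRing B] (ht : Irreducible (⟨t, h.t_mem⟩ : O))
    (hs : Irreducible (⟨s, h.s_mem⟩ : B)) (T : ∀ q, Forms k E q →+ Forms k F q)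
    (h0 : ∀ q, ∀ x ∈ wedgePow (diffSpan B) q, T q x ∈ wedgePow (diffSpan O) q)
    (h1 : ∀ m M : ℕ, m ≤ e * M → ∀ q, ∀ x ∈ wedgePow (logDiffSpan B s) q,
      T q (s ^ (-(m : ℤ) + 1) • x) ∈ scaledForms (t ^ (-(M : ℤ) + 1)) (logDiffSpan O t) q)
    (q : ℕ) (r : ℚ≥0) :
    (logFiltration k q E B r).map (T q) ≤ logFiltration k q F O (r / e) := by
  have he : (e : ℚ≥0) ≠ 0 := by exact_mod_cast h.e_pos.ne'
  rintro _ ⟨x, hx, rfl⟩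
  rcases eq_or_ne r 0 with rfl | hr
  · rw [zero_div, mem_logFiltration_zero]
    exact h0 q x ((mem_logFiltration_zero q B x).1 hx)
  · rw [logFiltration_eq_scaledForms q O ⟨t, h.t_mem⟩ ht (div_ne_zero hr he)]
    rw [logFiltration_eq_scaledForms q B ⟨s, h.s_mem⟩ hs hr] at hx
    obtain ⟨x, hx, rfl⟩ := hx
    -- `r ≤ e ⌈r / e⌉` and the right side is an integer, so it bounds `⌈r⌉` as well.
    refine h1 ⌈r⌉₊ ⌈r / e⌉₊ ?_ q x hx
    rw [Nat.ceil_le, Nat.cast_mul]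
    have := Nat.le_ceil (r / e)
    rwa [div_le_iff₀' (pos_iff_ne_zero.2 he)] at this

end IsTracePair

/-- The witness is `do + o dlog t`: differentiating a multiple of `t` keeps the factor `t` if a
logarithmic pole is allowed. -/
theorem exists_smul_eq_D (O : Subalgebra k F) {t o : F} (ht : t ≠ 0) (ho : o ∈ O) :
    ∃ w ∈ logDiffSpan O t, KaehlerDifferential.D k F (t * o) = t • w := by
  refine ⟨_, Submodule.add_mem_sup (D_mem_diffSpan O ho)
    (Submodule.smul_mem _ (⟨o, ho⟩ : O) (Submodule.mem_span_singleton_self (dlog k t))), ?_⟩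
  change _ = t • (_ + o • dlog k t)
  rw [Derivation.leibniz, dlog, smul_add, smul_smul, smul_smul]
  congr 2
  field_simp

/-- The trace on forms of a monogenic extension, with a generator `x` whose minimal polynomial has
coefficients `a i`. -/
structure IsMonogenicTrace (O : Subalgebra k F) (B : Subalgebra k E)
    (T : ∀ q, Forms k E q →+ Forms k F q) (x : E) (n : ℕ) (a : ℕ → F) (τ : E →ₗ[F] F) : Prop where
  x_mem : x ∈ B
  gen : ∀ b ∈ B, ∃ f : Polynomial F, (∀ i, f.coeff i ∈ O) ∧ Polynomial.aeval x f = b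
  τ_mem : ∀ b ∈ B, τ b ∈ O
  map_base : ∀ q b ω, T q (b • formsMap k F E q ω) = Algebra.trace F E b • ω
  -- This is what differentiating the minimal polynomial of `x` yields; in the applications `τ` is
  -- the coordinate of the highest power of `x`.
  map_wedge : ∀ q b ω,
    T (q + 1) (b • wedgeRight q (KaehlerDifferential.D k E x) (formsMap k F E q ω)) =
      -∑ i ∈ Finset.range n, τ (b * x ^ i) • wedgeRight q (KaehlerDifferential.D k F (a i)) ω

theorem scaledForms_one {W : Submodule O Ω[F⁄k]} {q : ℕ} {ω : Forms k F q}
    (h : ω ∈ scaledForms 1 W q) : ω ∈ wedgePow W q := by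
  obtain ⟨η, hη, rfl⟩ := h
  change (1 : F) • η ∈ _
  rwa [one_smul]

variable {T : ∀ q, Forms k E q →+ Forms k F q} {x : E} {n : ℕ} {a : ℕ → F} {τ : E →ₗ[F] F}

/-- The formula `map_wedge` produces only differentials of the `a i`, which are integral here, and
the scalar `d` comes from `F`, so it passes through both `Algebra.trace` and `τ`. -/
theorem IsMonogenicTrace.trace_mem_of_base (hM : IsMonogenicTrace O B T x n a τ)
    (h : IsTracePair O B t s e) (ha : ∀ i < n, a i ∈ O) {W : Submodule O Ω[F⁄k]}
    (hW : diffSpan O ≤ W) (d d' o : F) (ho : o ∈ O) (hd : d = d' * o) (q : ℕ) {y : Forms k E q}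
    (hy : y ∈ wedgePow (extSpan B W ⊔ Submodule.span B {KaehlerDifferential.D k E x}) q) :
    T q (algebraMap F E d • y) ∈ scaledForms d' W q := by
  refine trace_mem_scaledForms T (Algebra.trace F E) hM.map_base le_rfl _ _ _ (fun b hb => ?_)
    (fun q b hb ω hω => ?_) q hy
  · refine ⟨o * Algebra.trace F E b, mul_mem ho (h.trace_mem b hb), ?_⟩
    rw [← Algebra.smul_def, map_smul, smul_eq_mul, hd, mul_assoc]
  · rw [hM.map_wedge]
    refine neg_mem (sum_mem fun i hi => ?_)
    rw [← Algebra.smul_def, smul_mul_assoc, map_smul, hd, smul_eq_mul, mul_assoc]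
    exact smul_mul_mem_scaledForms _ (mul_mem ho (hM.τ_mem _ (mul_mem hb (pow_mem hM.x_mem _))))
      (wedgeRight_mem_wedgePow hω (hW (D_mem_diffSpan O (ha i (Finset.mem_range.1 hi)))))

theorem IsMonogenicTrace.map_zero_le (hM : IsMonogenicTrace O B T x n a τ)
    (h : IsTracePair O B t s e) (ha : ∀ i < n, a i ∈ O) (q : ℕ) (y : Forms k E q)
    (hy : y ∈ wedgePow (diffSpan B) q) : T q y ∈ wedgePow (diffSpan O) q := by
  have := hM.trace_mem_of_base h ha le_rfl 1 1 1 (one_mem _) (one_mul _).symm q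
    (wedgePow_mono (diffSpan_le_of_monogenic h.algebraMap_mem hM.x_mem hM.gen) q hy)
  rw [map_one] at this
  have h2 := scaledForms_one this
  rwa [one_smul] at h2

/-- Monogenic extensions of ramification index one. -/
theorem IsMonogenicTrace.map_le_of_unramified (hM : IsMonogenicTrace O B T x n a τ)
    (h : IsTracePair O B t (algebraMap F E t) 1) (ha : ∀ i < n, a i ∈ O) (m M : ℕ) (hm : m ≤ 1 * M)
    (q : ℕ) (y : Forms k E q) (hy : y ∈ wedgePow (logDiffSpan B (algebraMap F E t)) q) :
    T q (algebraMap F E t ^ (-(m : ℤ) + 1) • y) ∈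
      scaledForms (t ^ (-(M : ℤ) + 1)) (logDiffSpan O t) q := by
  obtain ⟨j, hj⟩ := Nat.le.dest hm
  rw [← map_zpow₀]
  refine hM.trace_mem_of_base h ha (W := logDiffSpan O t) le_sup_left _ _ (t ^ j)
    (pow_mem h.t_mem j) ?_ q (wedgePow_mono ?_ q hy)
  · rw [← zpow_natCast, ← zpow_add₀ h.t_ne]
    congr 1
    omega
  -- The uniformizer upstairs is `t` itself, so `dlog t` is pulled back from the base and `dx`
  -- remains the only extra differential.
  · rw [logDiffSpan, ← map_dlog]
    refine sup_le ((diffSpan_le_of_monogenic h.algebraMap_mem hM.x_mem hM.gen).trans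
      (sup_le_sup_right (extSpan_mono B le_sup_left) _)) ?_
    rw [Submodule.span_singleton_le_iff_mem]
    exact Submodule.mem_sup_left (map_mem_extSpan B
      (Submodule.mem_sup_right (Submodule.mem_span_singleton_self _)))

/-- Monogenic extensions generated by a uniformizer. -/
theorem IsMonogenicTrace.map_le_of_totallyRamified (hM : IsMonogenicTrace O B T s n a τ)
    (h : IsTracePair O B t s e) (ha : ∀ i < n, ∃ o ∈ O, a i = t * o) (m M : ℕ) (hm : m ≤ e * M)
    (q : ℕ) (y : Forms k E q) (hy : y ∈ wedgePow (logDiffSpan B s) q) :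
    T q (s ^ (-(m : ℤ) + 1) • y) ∈ scaledForms (t ^ (-(M : ℤ) + 1)) (logDiffSpan O t) q := by
  have hs := h.s_ne
  refine trace_mem_scaledForms T (Algebra.trace F E) hM.map_base (W := diffSpan O)
    (W' := logDiffSpan O t) le_sup_left (dlog k s) _ _ (fun b hb => h.trace_zpow_mul hm hb) (fun q b hb ω hω => ?_) q
    (wedgePow_mono ?_ q hy)
  · rw [show dlog k s = s⁻¹ • KaehlerDifferential.D k E s from rfl, wedgeRight_smul, smul_smul,
      hM.map_wedge]
    refine neg_mem (sum_mem fun i hi => ?_)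
    -- The `s⁻¹` in `dlog s` cancels the `+1` in the exponent of `s`, leaving only `t^(-M)`. The
    -- missing factor `t` is recovered from `a i = t * o`, whose differential is `t • w`.
    obtain ⟨b', hb', e1⟩ := h.exists_zpow_mul_eq hm
    obtain ⟨o, ho, e2⟩ := ha i (Finset.mem_range.1 hi)
    obtain ⟨w, hw, e3⟩ := exists_smul_eq_D (k := k) O h.t_ne ho
    have e4 : s ^ (-(m : ℤ) + 1) * b * s⁻¹ * s ^ i = t ^ (-(M : ℤ)) • (b' * b * s ^ i) := by
      rw [zpow_add₀ hs, zpow_one, e1, Algebra.smul_def]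
      field_simp
    rw [e4, map_smul, e2, e3, wedgeRight_smul, smul_smul, h.zpow_add_one, smul_eq_mul,
      mul_right_comm]
    exact smul_mul_mem_scaledForms _ (hM.τ_mem _ (mul_mem (mul_mem hb' hb) (pow_mem h.s_mem _)))
      (wedgeRight_mem_wedgePow (wedgePow_mono le_sup_left q hω) hw)
  · refine sup_le ((diffSpan_le_of_monogenic h.algebraMap_mem hM.x_mem hM.gen).trans
      (sup_le_sup_left ?_ _)) le_sup_right
    rw [Submodule.span_singleton_le_iff_mem]
    exact D_mem_span_dlog B h.s_mem hs

/-- Extensions for which the logarithmic differentials are generated by those of the base. -/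
theorem IsTracePair.map_zero_le_of_tame (h : IsTracePair O B t s e)
    (hT : ∀ q b ω, T q (b • formsMap k F E q ω) = Algebra.trace F E b • ω)
    (hB : diffSpan B ≤ extSpan B (diffSpan O) ⊔
      Submodule.span B {s • KaehlerDifferential.map k k F E (dlog k t)})
    (q : ℕ) (y : Forms k E q) (hy : y ∈ wedgePow (diffSpan B) q) :
    T q y ∈ wedgePow (diffSpan O) q := by
  refine scaledForms_one ?_
  rw [← one_smul E y]
  refine trace_mem_scaledForms T (Algebra.trace F E) hT le_rfl _ _ _
    (fun b hb => ⟨_, h.trace_mem b hb, by rw [one_mul, one_mul]⟩) (fun q b hb ω hω => ?_) q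
    (wedgePow_mono hB q hy)
  -- The trace of `s b` is divisible by `t`, and `t dlog t = dt` is integral: the logarithmic pole
  -- disappears.
  obtain ⟨o, ho, e1⟩ := h.trace_mem' b hb
  have : wedgeRight q (KaehlerDifferential.map k k F E (dlog k t)) (formsMap k F E q ω) =
      formsMap k F E (q + 1) (wedgeRight q (dlog k t) ω) :=
    (exteriorPowerMapAlong_wedgeRight q _ _ _).symm
  rw [wedgeRight_smul, smul_smul, one_mul, this, hT, mul_comm b s, e1, mul_comm t o, mul_smul,
    ← wedgeRight_smul, dlog, smul_smul, mul_inv_cancel₀ h.t_ne, one_smul, ← one_mul o]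
  exact smul_mul_mem_scaledForms _ ho (wedgeRight_mem_wedgePow hω (D_mem_diffSpan O h.t_mem))

theorem IsTracePair.map_le_of_tame (h : IsTracePair O B t s e)
    (hT : ∀ q b ω, T q (b • formsMap k F E q ω) = Algebra.trace F E b • ω)
    (hB : logDiffSpan B s ≤ extSpan B (logDiffSpan O t)) (m M : ℕ) (hm : m ≤ e * M)
    (q : ℕ) (y : Forms k E q) (hy : y ∈ wedgePow (logDiffSpan B s) q) :
    T q (s ^ (-(m : ℤ) + 1) • y) ∈ scaledForms (t ^ (-(M : ℤ) + 1)) (logDiffSpan O t) q := by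
  -- All logarithmic differentials already come from the base, so the extra differential is taken to
  -- be `0`.
  refine trace_mem_scaledForms T (Algebra.trace F E) hT le_rfl 0 _ _
    (fun b hb => h.trace_zpow_mul hm hb) (fun q b hb ω hω => ?_) q
    (wedgePow_mono (hB.trans le_sup_left) q hy)
  rw [show (0 : Ω[E⁄k]) = (0 : E) • 0 by simp, wedgeRight_smul, zero_smul, smul_zero, map_zero]
  exact zero_mem _

end LocalTransfer

/-! ### The highest coordinate in a power basis, and Euler's formula. -/

section Coordinate

variable {F E : Type*} [Field F] [Field E] [Algebra F E]

theorem span_pow_eq_top {x : E} (hint : IsIntegral F x) (hgen : Algebra.adjoin F {x} = ⊤) :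
    Submodule.span F {y | ∃ i < (minpoly F x).natDegree, y = x ^ i} = ⊤ := by
  let pb := PowerBasis.ofAdjoinEqTop hint hgen
  rw [eq_top_iff, ← pb.basis.span_eq]
  refine Submodule.span_mono ?_
  rintro _ ⟨i, rfl⟩
  exact ⟨i, i.2, by rw [pb.basis_eq_pow]; simp [pb]⟩

/-- The coordinate of the highest power of a generator. -/
theorem exists_top_coordinate {x : E} (hint : IsIntegral F x) (hgen : Algebra.adjoin F {x} = ⊤) :
    ∃ τ : E →ₗ[F] F, ∀ i < (minpoly F x).natDegree,
      τ (x ^ i) = if i + 1 = (minpoly F x).natDegree then 1 else 0 := by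
  let pb := PowerBasis.ofAdjoinEqTop hint hgen
  have hdim : pb.dim = (minpoly F x).natDegree := rfl
  have hpos : 0 < (minpoly F x).natDegree := minpoly.natDegree_pos hint
  refine ⟨pb.basis.coord ⟨(minpoly F x).natDegree - 1, by omega⟩, fun i hi => ?_⟩
  have hb : x ^ i = pb.basis ⟨i, hi⟩ := by
    rw [pb.basis_eq_pow]
    simp [pb]
  rw [hb, Module.Basis.coord_apply, Module.Basis.repr_self, Finsupp.single_apply]
  have : i = (minpoly F x).natDegree - 1 ↔ i + 1 = (minpoly F x).natDegree := by omega
  simp [Fin.ext_iff, this]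

/-- Division by the minimal polynomial, which is monic with coefficients in `O`, leaves a remainder
over `O` whose coefficients are the coordinates. -/
theorem top_coordinate_mem {k : Type*} [Field k] [Algebra k F] (O : Subalgebra k F) {x : E}
    (hint : IsIntegral F x) (hO : ∀ i, (minpoly F x).coeff i ∈ O) {τ : E →ₗ[F] F}
    (hτ : ∀ i < (minpoly F x).natDegree,
      τ (x ^ i) = if i + 1 = (minpoly F x).natDegree then 1 else 0)
    {f : Polynomial F} (hf : ∀ i, f.coeff i ∈ O) : τ (Polynomial.aeval x f) ∈ O := by
  have hlift : ∀ h : Polynomial F, (∀ i, h.coeff i ∈ O) → h ∈ Polynomial.lifts (algebraMap O F) :=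
    fun h hh => (Polynomial.lifts_iff_coeff_lifts _).2 fun i => ⟨⟨_, hh i⟩, rfl⟩
  obtain ⟨g, hg, -, hgm⟩ := Polynomial.lifts_and_natDegree_eq_and_monic (hlift _ hO)
    (minpoly.monic hint)
  obtain ⟨f, rfl⟩ := (Polynomial.mem_lifts _).1 (hlift f hf)
  have e1 : Polynomial.aeval x (f.map (algebraMap O F)) =
      Polynomial.aeval x ((f %ₘ g).map (algebraMap O F)) := by
    rw [Polynomial.map_modByMonic _ hgm, hg, Polynomial.aeval_modByMonic_eq_self_of_root]
    exact minpoly.aeval F x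
  have hdeg : ((f %ₘ g).map (algebraMap O F)).natDegree < (minpoly F x).natDegree := by
    rw [Polynomial.map_modByMonic _ hgm, hg]
    exact Polynomial.natDegree_modByMonic_lt _ (minpoly.monic hint) (minpoly.ne_one F x)
  rw [e1, Polynomial.aeval_eq_sum_range' hdeg, map_sum]
  refine sum_mem fun i hi => ?_
  rw [map_smul, hτ i (Finset.mem_range.1 hi), Polynomial.coeff_map]
  split_ifs
  · rw [smul_eq_mul, mul_one]
    exact ((f %ₘ g).coeff i).2
  · rw [smul_zero]
    exact zero_mem _

/-- Euler's formula: the trace of `y / g'(x)` is the highest coordinate of `y`. -/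
theorem trace_div_aeval_derivative [FiniteDimensional F E] [Algebra.IsSeparable F E] {x : E}
    (hgen : Algebra.adjoin F {x} = ⊤) {τ : E →ₗ[F] F}
    (hτ : ∀ i < (minpoly F x).natDegree,
      τ (x ^ i) = if i + 1 = (minpoly F x).natDegree then 1 else 0) (y : E) :
    Algebra.trace F E (y / Polynomial.aeval x (Polynomial.derivative (minpoly F x))) = τ y := by
  have hint : IsIntegral F x := Algebra.IsIntegral.isIntegral x
  have hfin : Module.finrank F E = (minpoly F x).natDegree :=
    (PowerBasis.ofAdjoinEqTop hint hgen).finrank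
  have hsucc := natDegree_minpolyDiv_succ hint
  have hy : y ∈ Submodule.span F {y | ∃ i < (minpoly F x).natDegree, y = x ^ i} := by
    rw [span_pow_eq_top hint hgen]; trivial
  induction hy using Submodule.span_induction with
  | zero => simp
  | add a b _ _ ha hb => rw [add_div, map_add, map_add, ha, hb]
  | smul c a _ ha => rw [smul_div_assoc, map_smul, map_smul, ha]
  | mem y hy =>
    obtain ⟨r, hr, rfl⟩ := hy
    -- Lagrange interpolation of `X^r` at the conjugates of `x`; comparing coefficients in degree `n
    -- - 1`, where each monic quotient `g / (X - σ x)` contributes `1`, gives the trace of `x^r /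
    -- g'(x)`.
    have h := congrArg (fun f => Polynomial.coeff f (minpolyDiv F x).natDegree)
      (sum_smul_minpolyDiv_eq_X_pow (K := F) (L := E) (AlgebraicClosure E) hgen (hfin ▸ hr))
    simp only [Polynomial.finset_sum_coeff, Polynomial.coeff_map, Polynomial.coeff_smul,
      (minpolyDiv_monic hint).coeff_natDegree, smul_eq_mul, mul_one, Polynomial.coeff_X_pow] at h
    apply (algebraMap F (AlgebraicClosure E)).injective
    rw [trace_eq_sum_embeddings (AlgebraicClosure E), hτ r hr]
    refine h.trans ?_
    have : (minpolyDiv F x).natDegree = r ↔ r + 1 = (minpoly F x).natDegree := by omega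
    simp only [this]
    split_ifs <;> simp

end Coordinate

/-! ### The trace of forms in separable monogenic extensions. -/

section Monogenic

variable {k F E : Type u} [Field k] [Field F] [Algebra k F] [Field E] [Algebra k E]
  [Algebra F E] [IsScalarTower k F E]

theorem wedgeRight_sum {A M ι : Type*} [CommRing A] [AddCommGroup M] [Module A M] (q : ℕ)
    (I : Finset ι) (m : ι → M) (x : ⋀[A]^q M) :
    wedgeRight q (∑ i ∈ I, m i) x = ∑ i ∈ I, wedgeRight q (m i) x := by
  classical
  induction I using Finset.induction_on with
  | empty =>
    rw [Finset.sum_empty, Finset.sum_empty, show (0 : M) = (0 : A) • 0 by simp, wedgeRight_smul,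
      zero_smul]
  | insert i I hi ih => rw [Finset.sum_insert hi, Finset.sum_insert hi, wedgeRight_add, ih]

theorem wedgeRight_D_formsMap (q : ℕ) (c : F) (ω : Forms k F q) :
    wedgeRight q (KaehlerDifferential.D k E (algebraMap F E c)) (formsMap k F E q ω) =
      formsMap k F E (q + 1) (wedgeRight q (KaehlerDifferential.D k F c) ω) := by
  rw [← KaehlerDifferential.map_D k k F E]
  exact (exteriorPowerMapAlong_wedgeRight q _ _ _).symm

/-- Differentiating `g(x) = 0` expresses `g'(x) dx` as `-∑ x^i da_i` with forms from the base;
Euler's formula then evaluates the traces with denominator `g'(x)`. -/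
theorem isMonogenicTrace_of_isSeparable [FiniteDimensional F E] [Algebra.IsSeparable F E]
    {O : Subalgebra k F} {B : Subalgebra k E} {T : ∀ q, Forms k E q →+ Forms k F q}
    (hT : IsSeparableFormTrace k F E T) {x : E} (hx : x ∈ B) (hgen : Algebra.adjoin F {x} = ⊤)
    (hO : ∀ i, (minpoly F x).coeff i ∈ O)
    (hB : ∀ b ∈ B, ∃ f : Polynomial F, (∀ i, f.coeff i ∈ O) ∧ Polynomial.aeval x f = b) :
    ∃ τ, IsMonogenicTrace O B T x (minpoly F x).natDegree (minpoly F x).coeff τ := by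
  have hint : IsIntegral F x := Algebra.IsIntegral.isIntegral x
  obtain ⟨τ, hτ⟩ := exists_top_coordinate hint hgen
  refine ⟨τ, hx, hB, fun b hb => ?_, hT, fun q b ω => ?_⟩
  · obtain ⟨f, hf, rfl⟩ := hB b hb
    exact top_coordinate_mem O hint hO hτ hf
  · set d := Polynomial.aeval x (Polynomial.derivative (minpoly F x)) with hd
    have hd0 : d ≠ 0 :=
      (Algebra.IsSeparable.isSeparable F x).aeval_derivative_ne_zero (minpoly.aeval F x)
    have hD : d • KaehlerDifferential.D k E x = -∑ i ∈ Finset.range (minpoly F x).natDegree,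
        x ^ i • KaehlerDifferential.D k E (algebraMap F E ((minpoly F x).coeff i)) := by
      have := D_aeval (k := k) (minpoly F x) x
      rw [minpoly.aeval, map_zero, Polynomial.sum_over_range _ (by simp), Finset.sum_range_succ,
        Polynomial.coeff_natDegree, (minpoly.monic hint).leadingCoeff, map_one,
        Derivation.map_one_eq_zero, smul_zero, add_zero] at this
      exact eq_neg_of_add_eq_zero_left this.symm
    have h1 : KaehlerDifferential.D k E x = (-d⁻¹) • ∑ i ∈ Finset.range (minpoly F x).natDegree,
        x ^ i • KaehlerDifferential.D k E (algebraMap F E ((minpoly F x).coeff i)) := by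
      rw [neg_smul, ← smul_neg, ← hD, smul_smul, inv_mul_cancel₀ hd0, one_smul]
    rw [h1, wedgeRight_smul, wedgeRight_sum, smul_smul, Finset.smul_sum, map_sum,
      ← Finset.sum_neg_distrib]
    refine Finset.sum_congr rfl fun i _ => ?_
    have h2 : Algebra.trace F E (b * -d⁻¹ * x ^ i) = -τ (b * x ^ i) := by
      rw [← trace_div_aeval_derivative hgen hτ, ← map_neg, ← hd]
      congr 1
      field_simp
    rw [wedgeRight_smul, smul_smul, wedgeRight_D_formsMap, hT, h2]
    exact neg_smul (τ (b * x ^ i))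
      (wedgeRight q (KaehlerDifferential.D k F ((minpoly F x).coeff i)) ω)

end Monogenic

/-! ### The trace of forms in inseparable extensions of degree `p`. -/

section Inseparable

variable {k F E : Type u} [Field k] [Field F] [Algebra k F] [Field E] [Algebra k E]
  [Algebra F E] [IsScalarTower k F E] {p : ℕ} {a : F} {θ : E}
  {T : ∀ q, Forms k E q →+ Forms k F q}

theorem wedgeRight_zero_left {A M : Type*} [CommRing A] [AddCommGroup M] [Module A M] (q : ℕ)
    (x : ⋀[A]^q M) : wedgeRight q (0 : M) x = 0 := by
  rw [show (0 : M) = (0 : A) • 0 by simp, wedgeRight_smul, zero_smul]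

theorem algebraMap_smul_wedgeRight_formsMap (q : ℕ) (y : Ω[E⁄k]) (c : F) (ω : Forms k F q) :
    algebraMap F E c • wedgeRight q y (formsMap k F E q ω) =
      wedgeRight q y (formsMap k F E q (c • ω)) := by
  rw [map_smul (formsMap k F E q) c ω, ← algebraMap_smul E c (formsMap k F E q ω),
    map_smul (wedgeRight q y)]

theorem exists_algebraMap_eq_pow (hp : p.Prime) [CharP F p] (hθ : θ ^ p = algebraMap F E a)
    (hgen : Algebra.adjoin F {θ} = ⊤) (x : E) : ∃ c : F, algebraMap F E c = x ^ p := by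
  have : Fact p.Prime := ⟨hp⟩
  have : CharP E p := charP_of_injective_algebraMap (algebraMap F E).injective p
  have hx : x ∈ Algebra.adjoin F {θ} := by rw [hgen]; trivial
  induction hx using Algebra.adjoin_induction with
  | mem x hx => exact ⟨a, by rw [Set.mem_singleton_iff.1 hx, hθ]⟩
  | algebraMap c => exact ⟨c ^ p, map_pow _ _ _⟩
  | add x y _ _ hx hy =>
    obtain ⟨c, hc⟩ := hx
    obtain ⟨d, hd⟩ := hy
    exact ⟨c + d, by rw [map_add, hc, hd, add_pow_char]⟩
  | mul x y _ _ hx hy =>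
    obtain ⟨c, hc⟩ := hx
    obtain ⟨d, hd⟩ := hy
    exact ⟨c * d, by rw [map_mul, hc, hd, mul_pow]⟩

theorem isIntegral_of_pow_eq (hp : p.Prime) {x : E} {c : F} (h : algebraMap F E c = x ^ p) :
    IsIntegral F x :=
  ⟨Polynomial.X ^ p - Polynomial.C c, Polynomial.monic_X_pow_sub_C c hp.ne_zero, by simp [h]⟩

namespace IsInseparableFormTrace

/-- For `z = θ^i` with `i < p` the form `dz` is a multiple of `θ^(i-1) dθ`, which `map_low` kills. A
coefficient `c` from `F` is moved into `ω`, the term with `dc` being killed by `map_base`; this is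
why `ω` varies in the induction. -/
theorem map_exact (hT : IsInseparableFormTrace k F E p a θ T) (hp : p.Prime) [CharP F p]
    (hθ : θ ^ p = algebraMap F E a) (hθF : θ ∉ Set.range (algebraMap F E))
    (hgen : Algebra.adjoin F {θ} = ⊤) (z : E) (q : ℕ) (ω : Forms k F q) :
    T (q + 1) (wedgeRight q (KaehlerDifferential.D k E z) (formsMap k F E q ω)) = 0 := by
  have hz : z ∈ Submodule.span F {y | ∃ i < (minpoly F θ).natDegree, y = θ ^ i} := by
    rw [span_pow_eq_top (isIntegral_of_pow_eq hp hθ.symm) hgen]; trivial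
  induction hz using Submodule.span_induction generalizing ω with
  | zero =>
    rw [map_zero, wedgeRight_zero_left, map_zero]
  | add x y _ _ hx hy => rw [map_add, wedgeRight_add, map_add, hx, hy, add_zero]
  | smul c x _ hx =>
    rw [Algebra.smul_def, Derivation.leibniz, wedgeRight_add, map_add, wedgeRight_smul,
      wedgeRight_smul, wedgeRight_D_formsMap, hT.map_base, add_zero,
      algebraMap_smul_wedgeRight_formsMap]
    exact hx (c • ω)
  | mem x hx =>
    obtain ⟨i, hi, rfl⟩ := hx
    rw [minpoly_eq_X_pow_sub_C hp hθ hθF, Polynomial.natDegree_X_pow_sub_C] at hi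
    rw [Derivation.leibniz_pow, ← Nat.cast_smul_eq_nsmul E, smul_smul, wedgeRight_smul,
      ← map_natCast (algebraMap F E)]
    rcases Nat.eq_zero_or_pos i with rfl | h
    · simp
    · exact hT.map_low q (i - 1) _ ω (by omega)

/-- For `i + 1 < p` the form `x^i dx` is exact: it is `d(x^(i+1))` divided by the unit `i + 1`. -/
theorem map_pow_low (hT : IsInseparableFormTrace k F E p a θ T) (hp : p.Prime) [CharP F p]
    (hθ : θ ^ p = algebraMap F E a) (hθF : θ ∉ Set.range (algebraMap F E))
    (hgen : Algebra.adjoin F {θ} = ⊤) (x : E) (q i : ℕ) (hi : i + 1 < p) (c : F)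
    (ω : Forms k F q) : T (q + 1) ((algebraMap F E c * x ^ i) •
      wedgeRight q (KaehlerDifferential.D k E x) (formsMap k F E q ω)) = 0 := by
  have hi0 : ((i + 1 : ℕ) : F) ≠ 0 := by
    rw [Ne, CharP.cast_eq_zero_iff F p]
    exact Nat.not_dvd_of_pos_of_lt (Nat.succ_pos _) hi
  have hi1 : ((i + 1 : ℕ) : E) ≠ 0 := by
    rw [← map_natCast (algebraMap F E)]
    exact (map_ne_zero _).2 hi0
  have h := hT.map_exact hp hθ hθF hgen (x ^ (i + 1)) q ((c * ((i + 1 : ℕ) : F)⁻¹) • ω)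
  rw [← algebraMap_smul_wedgeRight_formsMap, Derivation.leibniz_pow,
    ← Nat.cast_smul_eq_nsmul E, smul_smul, wedgeRight_smul, smul_smul, Nat.add_sub_cancel] at h
  rw [← h]
  congr 2
  rw [map_mul, map_inv₀, map_natCast]
  field_simp

/-- The definition gives this for `θ` only, but a generator of the valuation ring need not be `θ`.
The elements satisfying it contain `F` and `θ`, and form a ring: products follow from the Leibniz
rule, `x^p` and `y^p` being in `F`, and sums reduce to the case `x + 1`. -/
theorem map_pow_top (hT : IsInseparableFormTrace k F E p a θ T) (hp : p.Prime) [CharP F p]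
    (hθ : θ ^ p = algebraMap F E a) (hθF : θ ∉ Set.range (algebraMap F E))
    (hgen : Algebra.adjoin F {θ} = ⊤) (x : E) (c : F) (hc : algebraMap F E c = x ^ p) (q : ℕ)
    (ω : Forms k F q) : T (q + 1) (x ^ (p - 1) •
      wedgeRight q (KaehlerDifferential.D k E x) (formsMap k F E q ω)) =
      wedgeRight q (KaehlerDifferential.D k F c) ω := by
  have : Fact p.Prime := ⟨hp⟩
  have hE : CharP E p := charP_of_injective_algebraMap (algebraMap F E).injective p
  have hp1 : p - 1 + 1 = p := Nat.sub_add_cancel hp.one_le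
  have hDp : ∀ d : F, KaehlerDifferential.D k F (d ^ p) = 0 := fun d => by
    rw [Derivation.leibniz_pow, ← Nat.cast_smul_eq_nsmul F, CharP.cast_eq_zero, zero_smul]
  let P : E → Prop := fun x => ∀ c : F, algebraMap F E c = x ^ p → ∀ (q : ℕ) (ω : Forms k F q),
    T (q + 1) (x ^ (p - 1) • wedgeRight q (KaehlerDifferential.D k E x) (formsMap k F E q ω)) =
      wedgeRight q (KaehlerDifferential.D k F c) ω
  have halg : ∀ d, P (algebraMap F E d) := by
    intro d c hc q ω
    rw [wedgeRight_D_formsMap, hT.map_base]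
    have : c = d ^ p := (algebraMap F E).injective (by rw [hc, map_pow])
    rw [this, hDp, wedgeRight_zero_left]
  have hθP : P θ := by
    intro c hc q ω
    have := hT.map_top q 1 ω
    rw [map_one, one_mul, one_smul] at this
    rw [this, (algebraMap F E).injective (hc.trans hθ)]
  have hmul : ∀ x y, P x → P y → P (x * y) := by
    intro x y hx hy c hc q ω
    obtain ⟨d, hd⟩ := exists_algebraMap_eq_pow hp hθ hgen x
    obtain ⟨e, he⟩ := exists_algebraMap_eq_pow hp hθ hgen y
    have hcde : c = d * e := (algebraMap F E).injective (by rw [hc, map_mul, hd, he, mul_pow])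
    rw [hcde, Derivation.leibniz, Derivation.leibniz, wedgeRight_add, wedgeRight_add, smul_add,
      map_add, wedgeRight_smul, wedgeRight_smul, wedgeRight_smul, wedgeRight_smul, smul_smul,
      smul_smul]
    have e1 : (x * y) ^ (p - 1) * x = y ^ (p - 1) * algebraMap F E d := by
      rw [hd, mul_pow, mul_comm (y ^ (p - 1)), mul_right_comm, ← pow_succ, hp1]
    have e2 : (x * y) ^ (p - 1) * y = x ^ (p - 1) * algebraMap F E e := by
      rw [he, mul_pow, mul_assoc, ← pow_succ, hp1]
    rw [e1, e2, mul_smul, mul_smul, algebraMap_smul_wedgeRight_formsMap,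
      algebraMap_smul_wedgeRight_formsMap, hy e he, hx d hd, map_smul, map_smul]
  -- In the binomial expansion of `(x + 1)^(p-1) dx` all terms but `x^(p-1) dx` are killed by
  -- `map_pow_low`.
  have hone : ∀ x, P x → P (x + 1) := by
    intro x hx c hc q ω
    obtain ⟨d, hd⟩ := exists_algebraMap_eq_pow hp hθ hgen x
    have hcd : c = d + 1 := (algebraMap F E).injective (by
      rw [hc, map_add, hd, map_one, add_pow_char, one_pow])
    rw [hcd, map_add, map_add, Derivation.map_one_eq_zero, Derivation.map_one_eq_zero, add_zero,
      add_zero, add_pow, Finset.sum_range_succ, add_smul, map_add, Finset.sum_smul, map_sum,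
      Finset.sum_eq_zero, zero_add]
    · simpa using hx d hd q ω
    · intro i hi
      have := hT.map_pow_low hp hθ hθF hgen x q i (by have := Finset.mem_range.1 hi; omega)
        ((p - 1).choose i : F) ω
      rw [map_natCast, mul_comm] at this
      simpa using this
  have hpow : ∀ x, P x → ∀ n, P (x ^ n) := by
    intro x hx n
    induction n with
    | zero => simpa using halg 1
    | succ n ih => rw [pow_succ]; exact hmul _ _ ih hx
  have hadd : ∀ x y, P x → P y → P (x + y) := by
    intro x y hx hy
    rcases eq_or_ne y 0 with rfl | hy0
    · rwa [add_zero]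
    obtain ⟨e, he⟩ := exists_algebraMap_eq_pow hp hθ hgen y
    -- Closure under sums uses `x + y = y (x y⁻¹ + 1)`, and `y⁻¹` is reached through products
    -- because `y^p` lies in `F`.
    have hinv : y⁻¹ = y ^ (p - 1) * algebraMap F E e⁻¹ := by
      rw [map_inv₀, he]
      obtain ⟨n, hn⟩ : ∃ n, p = n + 1 := ⟨p - 1, hp1.symm⟩
      rw [hn, Nat.add_sub_cancel, pow_succ]
      field_simp
    have : x + y = y * (x * y⁻¹ + 1) := by field_simp
    rw [this]
    refine hmul _ _ hy (hone _ (hmul _ _ hx ?_))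
    rw [hinv]
    exact hmul _ _ (hpow y hy _) (halg _)
  have hx : x ∈ Algebra.adjoin F {θ} := by rw [hgen]; trivial
  suffices P x from this c hc q ω
  clear hc
  induction hx using Algebra.adjoin_induction with
  | mem x hx => rw [Set.mem_singleton_iff.1 hx]; exact hθP
  | algebraMap c => exact halg c
  | add x y _ _ hx hy => exact hadd x y hx hy
  | mul x y _ _ hx hy => exact hmul x y hx hy

/-- The field trace vanishes, in agreement with `map_base`. The minimal polynomial is `X^p - c`, so
in the sum only `a_0 = -c` has a nonzero differential, and the two signs cancel. -/
theorem isMonogenicTrace [FiniteDimensional F E] (hT : IsInseparableFormTrace k F E p a θ T)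
    (hp : p.Prime) [CharP F p]
    (hθ : θ ^ p = algebraMap F E a) (hθF : θ ∉ Set.range (algebraMap F E))
    (hgen : Algebra.adjoin F {θ} = ⊤) {O : Subalgebra k F} {B : Subalgebra k E} {x : E}
    (hx : x ∈ B) (hxgen : Algebra.adjoin F {x} = ⊤)
    (hO : ∀ i, (minpoly F x).coeff i ∈ O)
    (hB : ∀ b ∈ B, ∃ f : Polynomial F, (∀ i, f.coeff i ∈ O) ∧ Polynomial.aeval x f = b) :
    ∃ τ, IsMonogenicTrace O B T x (minpoly F x).natDegree (minpoly F x).coeff τ := by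
  have hint : IsIntegral F x := Algebra.IsIntegral.isIntegral x
  obtain ⟨τ, hτ⟩ := exists_top_coordinate hint hxgen
  have htr : Algebra.trace F E = 0 := by
    refine Algebra.trace_eq_zero_of_not_isSeparable fun hsep => ?_
    have h1 := Algebra.IsSeparable.isSeparable F θ
    rw [IsSeparable, minpoly_eq_X_pow_sub_C hp hθ hθF, Polynomial.separable_def] at h1
    have h2 : Polynomial.derivative (Polynomial.X ^ p - Polynomial.C a) = 0 := by
      rw [Polynomial.derivative_sub, Polynomial.derivative_C, sub_zero,
        Polynomial.derivative_X_pow, CharP.cast_eq_zero, map_zero, zero_mul]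
    rw [h2, isCoprime_zero_right] at h1
    have h3 := Polynomial.natDegree_eq_zero_of_isUnit h1
    rw [Polynomial.natDegree_X_pow_sub_C] at h3
    exact hp.ne_zero h3
  obtain ⟨c, hc⟩ := exists_algebraMap_eq_pow hp hθ hgen x
  have hxF : x ∉ Set.range (algebraMap F E) := by
    rintro ⟨y, rfl⟩
    refine hθF ?_
    have h1 : θ ∈ Algebra.adjoin F {algebraMap F E y} := by rw [hxgen]; trivial
    have h2 : Algebra.adjoin F {algebraMap F E y} ≤ ⊥ :=
      Algebra.adjoin_le (Set.singleton_subset_iff.2 ⟨y, rfl⟩)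
    exact h2 h1
  have hmin := minpoly_eq_X_pow_sub_C hp hc.symm hxF
  have hn : (minpoly F x).natDegree = p := by rw [hmin, Polynomial.natDegree_X_pow_sub_C]
  refine ⟨τ, hx, hB, fun b hb => ?_, fun q b ω => ?_, fun q b ω => ?_⟩
  · obtain ⟨f, hf, rfl⟩ := hB b hb
    exact top_coordinate_mem O hint hO hτ hf
  · rw [hT.map_base, htr, LinearMap.zero_apply, zero_smul]
  · rw [hn, Finset.sum_eq_single_of_mem 0 (Finset.mem_range.2 hp.pos)]
    · have h0 : (minpoly F x).coeff 0 = -c := by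
        rw [hmin, Polynomial.coeff_sub, Polynomial.coeff_X_pow, Polynomial.coeff_C_zero,
          if_neg hp.ne_zero.symm, zero_sub]
      have hneg : wedgeRight q (KaehlerDifferential.D k F (-c)) ω =
          -wedgeRight q (KaehlerDifferential.D k F c) ω := by
        refine eq_neg_of_add_eq_zero_left ?_
        rw [← wedgeRight_add, map_neg, neg_add_cancel, wedgeRight_zero_left]
      rw [h0, pow_zero, mul_one, hneg, smul_neg, neg_neg]
      clear hneg
      have hb : b ∈ Submodule.span F {y | ∃ i < (minpoly F x).natDegree, y = x ^ i} := by
        rw [span_pow_eq_top hint hxgen]; trivial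
      induction hb using Submodule.span_induction generalizing ω with
      | zero => rw [zero_smul, map_zero, map_zero]; exact (zero_smul F _).symm
      | add y z _ _ hy hz =>
        rw [add_smul, map_add, hy ω, hz ω, map_add]
        exact (add_smul (τ y) (τ z) (wedgeRight q (KaehlerDifferential.D k F c) ω)).symm
      | smul d y _ hy =>
        rw [Algebra.smul_def, mul_comm, mul_smul, algebraMap_smul_wedgeRight_formsMap,
          hy, mul_comm, ← Algebra.smul_def, map_smul, map_smul, smul_smul, mul_comm]
        rfl
      | mem y hy =>
        obtain ⟨i, hi, rfl⟩ := hy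
        rw [hτ i hi, hn]
        rw [hn] at hi
        split_ifs with h
        · rw [← hT.map_pow_top hp hθ hθF hgen x c hc, ← h, Nat.add_sub_cancel]
          exact (one_smul F _).symm
        · have := hT.map_pow_low hp hθ hθF hgen x q i (by omega) 1 ω
          rw [map_one, one_mul] at this
          rw [this]
          exact (zero_smul F _).symm
    · intro i hi hi0
      rw [hmin, Polynomial.coeff_sub, Polynomial.coeff_X_pow, Polynomial.coeff_C,
        if_neg (Finset.mem_range.1 hi).ne, if_neg hi0, sub_zero, map_zero,
        wedgeRight_zero_left, smul_zero]

end IsInseparableFormTrace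

end Inseparable

/-! ### Integral closures of discrete valuation rings: trace, ramification, generators. -/

section IntegralClosureDVR

open IsLocalRing

variable (A F E : Type*) [CommRing A] [IsDomain A] [IsDiscreteValuationRing A] [Field F]
  [Algebra A F] [IsFractionRing A F] [Field E] [Algebra F E] [Algebra A E] [IsScalarTower A F E]
  [FiniteDimensional F E]

include F in
theorem isDedekindDomain_integralClosure [Module.Finite A (integralClosure A E)] :
    IsDedekindDomain (integralClosure A E) := by
  have : IsNoetherianRing (integralClosure A E) := IsNoetherianRing.of_finite A _
  have : IsIntegrallyClosed (integralClosure A E) :=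
    integralClosure.isIntegrallyClosedOfFiniteExtension F
  have : Ring.DimensionLEOne (integralClosure A E) := Ring.DimensionLEOne.of_isIntegral A _
  exact { }

include F in
theorem algebraMap_integralClosure_injective :
    Function.Injective (algebraMap A (integralClosure A E)) := by
  intro x y h
  have h2 := congrArg (algebraMap (integralClosure A E) E) h
  rw [← IsScalarTower.algebraMap_apply, ← IsScalarTower.algebraMap_apply,
    IsScalarTower.algebraMap_apply A F E, IsScalarTower.algebraMap_apply A F E] at h2
  exact IsFractionRing.injective A F ((algebraMap F E).injective h2)

include F in
theorem isDiscreteValuationRing_integralClosure [Module.Finite A (integralClosure A E)]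
    [IsLocalRing (integralClosure A E)] : IsDiscreteValuationRing (integralClosure A E) := by
  have hd := isDedekindDomain_integralClosure A F E
  have hnf : ¬ IsField (integralClosure A E) := by
    rw [← Algebra.IsIntegral.isField_iff_isField (algebraMap_integralClosure_injective A F E)]
    exact IsDiscreteValuationRing.not_isField A
  exact ((IsDiscreteValuationRing.TFAE (integralClosure A E) hnf).out 0 2).2 hd

include F in
theorem faithfulSMul_integralClosure : FaithfulSMul A (integralClosure A E) :=
  (faithfulSMul_iff_algebraMap_injective _ _).2 (algebraMap_integralClosure_injective A F E)

include F in
theorem not_isUnit_algebraMap_integralClosure [IsLocalRing (integralClosure A E)] {t : A}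
    (ht : Irreducible t) : ¬ IsUnit (algebraMap A (integralClosure A E) t) := by
  have := faithfulSMul_integralClosure A F E
  have hl : (maximalIdeal (integralClosure A E)).LiesOver (maximalIdeal A) := inferInstance
  have h1 : t ∈ maximalIdeal A := (IsLocalRing.mem_maximalIdeal _).2 ht.not_isUnit
  rw [hl.over] at h1
  exact (IsLocalRing.mem_maximalIdeal _).1 h1

/-- Modulo the maximal ideal of `A`, the element `x` is nilpotent; so is its trace, which lives in
the residue field of `A` and hence is `0`. -/
theorem exists_trace_eq_of_mem_maximalIdeal [Module.Finite A (integralClosure A E)]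
    [IsLocalRing (integralClosure A E)] {x : integralClosure A E} (hx : x ∈ maximalIdeal _) :
    ∃ a ∈ maximalIdeal A, Algebra.trace F E x = algebraMap A F a := by
  have := isDiscreteValuationRing_integralClosure A F E
  have := faithfulSMul_integralClosure A F E
  have : Module.IsTorsionFree A (integralClosure A E) := inferInstance
  refine ⟨Algebra.trace A (integralClosure A E) x, ?_, ?_⟩
  · have hnil : IsNilpotent (Ideal.Quotient.mk
        (Ideal.map (algebraMap A (integralClosure A E)) (maximalIdeal A)) x) := by
      obtain ⟨t, ht⟩ := IsDiscreteValuationRing.exists_irreducible A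
      obtain ⟨s, hs⟩ := IsDiscreteValuationRing.exists_irreducible (integralClosure A E)
      obtain ⟨e, he⟩ := IsDiscreteValuationRing.associated_pow_irreducible
        ((map_ne_zero_iff _ (algebraMap_integralClosure_injective A F E)).2 ht.ne_zero) hs
      refine ⟨e, ?_⟩
      rw [← map_pow, Ideal.Quotient.eq_zero_iff_mem]
      rw [hs.maximalIdeal_eq, Ideal.mem_span_singleton] at hx
      have h1 : algebraMap A (integralClosure A E) t ∣ x ^ e :=
        he.dvd.trans (pow_dvd_pow_of_dvd hx e)
      exact Ideal.mem_of_dvd _ h1 (Ideal.mem_map_of_mem _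
        ((IsLocalRing.mem_maximalIdeal _).2 ht.not_isUnit))
    have := Algebra.isNilpotent_trace_of_isNilpotent (R := A ⧸ maximalIdeal A) hnil
    rw [Algebra.trace_quotient_mk] at this
    exact Ideal.Quotient.eq_zero_iff_mem.1 this.eq_zero
  · rw [← Algebra.intTrace_eq_trace A]
    exact (Algebra.algebraMap_intTrace (A := A) (K := F) (L := E) x).symm

variable {A E}

theorem ramificationIdx'_eq_of_associated
    [IsDiscreteValuationRing (integralClosure A E)] {t : A} (ht : Irreducible t)
    {s : integralClosure A E} (hs : Irreducible s) {e : ℕ}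
    (he : Associated (algebraMap A (integralClosure A E) t) (s ^ e)) :
    (maximalIdeal A).ramificationIdx' (maximalIdeal (integralClosure A E)) = e := by
  have h1 : Ideal.map (algebraMap A (integralClosure A E)) (maximalIdeal A) =
      maximalIdeal (integralClosure A E) ^ e := by
    rw [ht.maximalIdeal_eq, hs.maximalIdeal_eq, Ideal.map_span, Set.image_singleton,
      Ideal.span_singleton_pow, Ideal.span_singleton_eq_span_singleton]
    exact he
  refine Ideal.ramificationIdx'_spec h1.le ?_
  rw [h1, hs.maximalIdeal_eq, Ideal.span_singleton_pow, Ideal.span_singleton_pow,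
    Ideal.span_singleton_le_span_singleton, pow_dvd_pow_iff hs.ne_zero hs.not_isUnit]
  omega

include F in
/-- An extension of prime degree is generated by a lift of a generator of the residue field, or by
a uniformizer. -/
theorem exists_adjoin_eq_top_of_finrank_prime [Module.Finite A (integralClosure A E)]
    [IsDiscreteValuationRing (integralClosure A E)]
    (hp : (Module.finrank F E).Prime) {t : A} (ht : Irreducible t)
    {s : integralClosure A E} (hs : Irreducible s) {e : ℕ}
    (he : Associated (algebraMap A (integralClosure A E) t) (s ^ e)) :
    (e = 1 ∧ ∃ x : integralClosure A E, Algebra.adjoin A {x} = ⊤) ∨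
      (e = Module.finrank F E ∧ Algebra.adjoin A {s} = ⊤) := by
  have := faithfulSMul_integralClosure A F E
  have : IsFractionRing (integralClosure A E) E :=
    integralClosure.isFractionRing_of_finite_extension F E
  have hef := Ideal.ramificationIdx_mul_inertiaDeg_of_isLocalRing (integralClosure A E) F E
    (p := maximalIdeal A) (IsDiscreteValuationRing.not_a_field A)
  have : (maximalIdeal (integralClosure A E)).LiesOver (maximalIdeal A) := inferInstance
  rw [ramificationIdx'_eq_of_associated ht hs he, Ideal.inertiaDeg'_algebraMap] at hef
  -- Nakayama: a subalgebra that fills the integral closure modulo `t` is everything.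
  have hnak : ∀ S : Subalgebra A (integralClosure A E),
      (∀ y, ∃ z ∈ S, algebraMap A (integralClosure A E) t ∣ y - z) → S = ⊤ := by
    intro S hS
    rw [← Algebra.toSubmodule_eq_top, eq_top_iff]
    refine Submodule.le_of_le_smul_of_le_jacobson_bot (I := maximalIdeal A) Module.Finite.fg_top
      (IsLocalRing.maximalIdeal_le_jacobson _) fun y _ => ?_
    obtain ⟨z, hz, c, hc⟩ := hS y
    rw [← sub_add_cancel y z, hc, add_comm, ← Algebra.smul_def]
    exact Submodule.add_mem_sup hz (Submodule.smul_mem_smul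
      ((IsLocalRing.mem_maximalIdeal _).2 ht.not_isUnit) trivial)
  let _ : Field (A ⧸ maximalIdeal A) := Ideal.Quotient.field _
  let _ : Field (integralClosure A E ⧸ maximalIdeal (integralClosure A E)) := Ideal.Quotient.field _
  let κ := A ⧸ maximalIdeal A
  let κ' := integralClosure A E ⧸ maximalIdeal (integralClosure A E)
  rcases hp.eq_one_or_self_of_dvd e (Dvd.intro _ hef) with rfl | rfl
  · left
    refine ⟨rfl, ?_⟩
    rw [one_mul] at hef
    -- A residue extension of prime degree has no intermediate ring, so any element outside `κ`
    -- generates it, separable or not. Since `e = 1`, lifting modulo `s` is lifting modulo `t`.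
    have : IsSimpleOrder (Subalgebra κ κ') :=
      Subalgebra.isSimpleOrder_of_finrank_prime κ κ' (by rw [← hef] at hp; exact hp)
    obtain ⟨x, hx⟩ : ∃ x : κ', x ∉ (⊥ : Subalgebra κ κ') := by
      by_contra! h
      exact (bot_ne_top : (⊥ : Subalgebra κ κ') ≠ ⊤) (Algebra.eq_top_iff.2 h)
    have htop : Algebra.adjoin κ {x} = ⊤ :=
      (eq_bot_or_eq_top _).resolve_left fun h =>
        hx (h ▸ Algebra.self_mem_adjoin_singleton κ x)
    obtain ⟨x, rfl⟩ := Ideal.Quotient.mk_surjective x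
    refine ⟨x, hnak _ fun y => ?_⟩
    have hy : Ideal.Quotient.mk (maximalIdeal (integralClosure A E)) y ∈
        Algebra.adjoin κ {Ideal.Quotient.mk (maximalIdeal (integralClosure A E)) x} := by
      rw [htop]; trivial
    obtain ⟨z, hz, hzy⟩ : ∃ z ∈ Algebra.adjoin A {x},
        Ideal.Quotient.mk (maximalIdeal (integralClosure A E)) z =
          Ideal.Quotient.mk (maximalIdeal (integralClosure A E)) y := by
      generalize Ideal.Quotient.mk (maximalIdeal (integralClosure A E)) y = y' at hy
      induction hy using Algebra.adjoin_induction with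
      | mem y hy => exact ⟨x, Algebra.self_mem_adjoin_singleton A x, hy.symm⟩
      | algebraMap c =>
        obtain ⟨c, rfl⟩ := Ideal.Quotient.mk_surjective c
        exact ⟨algebraMap A _ c, Subalgebra.algebraMap_mem _ _, rfl⟩
      | add a b _ _ ha hb =>
        obtain ⟨a, ha, rfl⟩ := ha
        obtain ⟨b, hb, rfl⟩ := hb
        exact ⟨a + b, add_mem ha hb, map_add _ _ _⟩
      | mul a b _ _ ha hb =>
        obtain ⟨a, ha, rfl⟩ := ha
        obtain ⟨b, hb, rfl⟩ := hb
        exact ⟨a * b, mul_mem ha hb, map_mul _ _ _⟩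
    refine ⟨z, hz, ?_⟩
    rw [pow_one] at he
    rw [he.dvd_iff_dvd_left, ← Ideal.mem_span_singleton, ← hs.maximalIdeal_eq]
    exact Ideal.Quotient.eq.1 hzy.symm
  · right
    refine ⟨rfl, ?_⟩
    have hf : Module.finrank κ κ' = 1 := by
      have := hp.pos
      exact Nat.eq_of_mul_eq_mul_left this (hef.trans (mul_one _).symm)
    have hsurj : ∀ y : integralClosure A E, ∃ a : A, s ∣ y - algebraMap A _ a := by
      intro y
      have htop : (⊥ : Subalgebra κ κ') = ⊤ := Subalgebra.bot_eq_top_of_finrank_eq_one hf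
      have hy : Ideal.Quotient.mk (maximalIdeal (integralClosure A E)) y ∈
        (⊥ : Subalgebra κ κ') := by rw [htop]; trivial
      obtain ⟨a, ha⟩ := Algebra.mem_bot.1 hy
      obtain ⟨a, rfl⟩ := Ideal.Quotient.mk_surjective a
      refine ⟨a, ?_⟩
      rw [← Ideal.mem_span_singleton, ← hs.maximalIdeal_eq]
      exact Ideal.Quotient.eq.1 ha.symm
    -- The residue fields agree, so elements have `s`-adic expansions with digits in `A`; truncation
    -- at `j = e` is enough for `hnak`.
    have hj : ∀ (j : ℕ) (y : integralClosure A E), ∃ z ∈ Algebra.adjoin A {s}, s ^ j ∣ y - z := by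
      intro j
      induction j with
      | zero => exact fun y => ⟨0, zero_mem _, by simp⟩
      | succ j ih =>
        intro y
        obtain ⟨z, hz, c, hc⟩ := ih y
        obtain ⟨a, d, hd⟩ := hsurj c
        refine ⟨z + s ^ j * algebraMap A _ a, add_mem hz (mul_mem (pow_mem
          (Algebra.self_mem_adjoin_singleton A s) _) (Subalgebra.algebraMap_mem _ _)), d, ?_⟩
        rw [← sub_sub, hc, ← mul_sub, hd, pow_succ, mul_assoc]
    refine hnak _ fun y => ?_
    obtain ⟨z, hz, h⟩ := hj _ y
    exact ⟨z, hz, he.dvd.trans h⟩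

include F in
/-- The minimal polynomial of a uniformizer of a totally ramified extension is an Eisenstein
polynomial. -/
theorem dvd_coeff_minpoly_of_totallyRamified
    [IsDiscreteValuationRing (integralClosure A E)] {t : A} (ht : Irreducible t)
    {s : integralClosure A E} (hs : Irreducible s) {e : ℕ}
    (he : Associated (algebraMap A (integralClosure A E) t) (s ^ e))
    (hn : (minpoly A s).natDegree ≤ e) (j : ℕ) (hj : j < (minpoly A s).natDegree) :
    t ∣ (minpoly A s).coeff j := by
  have := faithfulSMul_integralClosure A F E
  induction j using Nat.strong_induction_on with
  | _ j ih =>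
    have h0 := minpoly.aeval A s
    rw [Polynomial.aeval_eq_sum_range, ← Finset.add_sum_erase _ _ (Finset.mem_range.2
      (Nat.lt_succ_of_lt hj))] at h0
    -- Solve the minimal equation for its `j`-th term: earlier coefficients are divisible by `t`,
    -- hence by `s^e` with `j + 1 ≤ e`, and later terms contain `s^(j+1)`.
    have hdvd : s ^ (j + 1) ∣ (minpoly A s).coeff j • s ^ j := by
      rw [eq_neg_of_add_eq_zero_left h0, dvd_neg]
      refine Finset.dvd_sum fun i hi => ?_
      rw [Algebra.smul_def]
      rcases lt_or_gt_of_ne (Finset.ne_of_mem_erase hi) with h | h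
      · refine Dvd.dvd.mul_right ?_ _
        refine (pow_dvd_pow s (show j + 1 ≤ e by omega)).trans (he.symm.dvd.trans ?_)
        exact map_dvd _ (ih i h (h.trans hj))
      · exact Dvd.dvd.mul_left (pow_dvd_pow s h) _
    rw [Algebra.smul_def, pow_succ, mul_comm, mul_dvd_mul_iff_right (pow_ne_zero _ hs.ne_zero)]
      at hdvd
    have hnu : ¬ IsUnit ((minpoly A s).coeff j) := fun hu =>
      hs.not_isUnit (isUnit_of_dvd_unit hdvd (hu.map _))
    rw [← Ideal.mem_span_singleton, ← ht.maximalIdeal_eq]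
    exact (IsLocalRing.mem_maximalIdeal _).2 hnu

include F in
theorem adjoin_eq_top_of_adjoin_integralClosure_eq_top {x : integralClosure A E}
    (hx : Algebra.adjoin A {x} = ⊤) : Algebra.adjoin F {(x : E)} = ⊤ := by
  have := faithfulSMul_integralClosure A F E
  rw [Algebra.eq_top_iff]
  intro y
  have hy : IsAlgebraic A y :=
    (IsFractionRing.isAlgebraic_iff A F E).2 (Algebra.IsAlgebraic.isAlgebraic y)
  obtain ⟨z, a, ha, hz⟩ : ∃ z : integralClosure A E, ∃ a : A, a ≠ 0 ∧ (z : E) = a • y := by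
    obtain ⟨a, ha, h⟩ := hy.exists_integral_multiple
    exact ⟨⟨_, h⟩, a, ha, rfl⟩
  have hz' : z ∈ Algebra.adjoin A {x} := by rw [hx]; trivial
  rw [Algebra.adjoin_singleton_eq_range_aeval] at hz'
  obtain ⟨f, rfl⟩ : ∃ f, Polynomial.aeval x f = z := hz'
  have hz2 : ((Polynomial.aeval x f : integralClosure A E) : E) ∈
      Algebra.adjoin F {(x : E)} := by
    rw [show ((Polynomial.aeval x f : integralClosure A E) : E) = Polynomial.aeval (x : E) f from
      (Polynomial.aeval_algHom_apply (integralClosure A E).val x f).symm,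
      ← Polynomial.aeval_map_algebraMap F]
    exact Polynomial.aeval_mem_adjoin_singleton _ _
  have ha0 : algebraMap A F a ≠ 0 :=
    (map_ne_zero_iff _ (IsFractionRing.injective A F)).2 ha
  rw [hz, ← algebraMap_smul F a y] at hz2
  have := Subalgebra.smul_mem _ hz2 (algebraMap A F a)⁻¹
  rwa [smul_smul, inv_mul_cancel₀ ha0, one_smul] at this

theorem exists_polynomial_of_adjoin_eq_top {R S : Type*} [CommRing R] [CommRing S] [Algebra R S]
    {x : S} (hx : Algebra.adjoin R {x} = ⊤) (y : S) : ∃ f : Polynomial R,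
      Polynomial.aeval x f = y := by
  have hy : y ∈ Algebra.adjoin R {x} := by rw [hx]; trivial
  rwa [Algebra.adjoin_singleton_eq_range_aeval] at hy

end IntegralClosureDVR

/-! ### Henselian discrete valuation fields and extensions of prime degree. -/

section HenselDVF

open IsLocalRing

variable {k F E : Type u} [Field k] [Field F] [Algebra k F] [Field E] [Algebra k E]
  [Algebra F E] [IsScalarTower k F E]

/-- The properties of the valuation ring of a geometric henselian discrete valuation field which
are used to bound the trace: finite extensions have local integral closures, and in characteristic
`p` the Frobenius is finite. -/
structure IsHenselDVF (k : Type u) [Field k] {F : Type u} [Field F] [Algebra k F]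
    (O : Subalgebra k F) : Prop where
  isFractionRing : IsFractionRing O F
  isDiscreteValuationRing : IsDiscreteValuationRing O
  isLocalRing_integralClosure : ∀ (E : Type u) [Field E] [Algebra F E] [FiniteDimensional F E],
    IsLocalRing (integralClosure O E)
  finite_frobenius : ∀ (p : ℕ) [Fact p.Prime] [CharP O p], (frobenius O p).Finite

namespace IsHenselDVF

variable {O : Subalgebra k F}

theorem finite_integralClosure_of_isSeparable (h : IsHenselDVF k O) (E : Type u) [Field E]
    [Algebra F E] [FiniteDimensional F E]
    [Algebra.IsSeparable F E] : Module.Finite O (integralClosure O E) := by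
  have := h.isFractionRing
  have := h.isDiscreteValuationRing
  exact IsIntegralClosure.finite O F E (integralClosure O E)

theorem finite_of_comp_finite_of_injective {R S T : Type*} [CommRing R] [CommRing S] [CommRing T]
    [IsNoetherianRing R] {f : R →+* S} {g : S →+* T} (hfg : (g.comp f).Finite)
    (hg : Function.Injective g) : f.Finite := by
  algebraize [f, g, g.comp f]
  have : Module.Finite R T := hfg
  have : Module.Finite R S :=
    Module.Finite.of_injective (IsScalarTower.toAlgHom R S T).toLinearMap hg
  exact this

/-- The `p`-th power map embeds the integral closure into `O`, and precomposed with `O →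
integralClosure O E` it is the Frobenius of `O`. So the closure sits inside a finite module over a
noetherian ring. -/
theorem finite_integralClosure_of_pow (h : IsHenselDVF k O) {p : ℕ} (hp : p.Prime) [CharP F p]
    (hE : ∀ x : E, ∃ c : F, algebraMap F E c = x ^ p) :
    Module.Finite O (integralClosure O E) := by
  have := h.isFractionRing
  have := h.isDiscreteValuationRing
  have : Fact p.Prime := ⟨hp⟩
  have : CharP O p := (RingHom.charP_iff (algebraMap O F) Subtype.val_injective p).2 inferInstance
  have : CharP E p := charP_of_injective_algebraMap (algebraMap F E).injective p
  have hc : ∀ x : integralClosure O E, ∃ c : O, algebraMap F E c = (x : E) ^ p := by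
    intro x
    obtain ⟨c, hc⟩ := hE x
    have hint : IsIntegral O c := by
      have := x.2.pow p
      change IsIntegral O ((x : E) ^ p) at this
      rw [← hc] at this
      exact (isIntegral_algebraMap_iff (algebraMap F E).injective).1 this
    obtain ⟨d, rfl⟩ := IsIntegrallyClosed.isIntegral_iff.1 hint
    exact ⟨d, hc⟩
  choose φ hφ using hc
  have hinj : Function.Injective fun c : O => algebraMap F E c :=
    (algebraMap F E).injective.comp Subtype.val_injective
  let g : integralClosure O E →+* O :=
    { toFun := φ
      map_one' := hinj (by simp [hφ])
      map_zero' := hinj (by simp [hφ, hp.ne_zero])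
      map_mul' := fun x y => hinj (by simp [hφ, mul_pow])
      map_add' := fun x y => hinj (by simp [hφ, add_pow_char]) }
  have hg : Function.Injective g := (injective_iff_map_eq_zero g).2 fun x hx => by
    have h1 := hφ x
    rw [show φ x = 0 from hx, ZeroMemClass.coe_zero, map_zero] at h1
    exact Subtype.ext (pow_eq_zero_iff hp.ne_zero |>.1 h1.symm)
  refine RingHom.finite_algebraMap.1 (finite_of_comp_finite_of_injective (f := algebraMap O (integralClosure O E)) (g := g) ?_ hg)
  convert h.finite_frobenius p
  ext x
  exact congrArg Subtype.val (hinj (by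
    change algebraMap F E (φ _) = algebraMap F E ((x : F) ^ p)
    rw [hφ, map_pow]; rfl) : g (algebraMap O _ x) = frobenius O p x)

theorem isDiscreteValuationRing_extensionRing (h : IsHenselDVF k O) [FiniteDimensional F E]
    [hfin : Module.Finite O (integralClosure O E)] :
    IsDiscreteValuationRing (extensionRing O E) := by
  have := h.isFractionRing
  have := h.isDiscreteValuationRing
  have := h.isLocalRing_integralClosure E
  exact isDiscreteValuationRing_integralClosure O F E

theorem isIntegral_extensionRing_iff (O : Subalgebra k F) {K : Type*} [Field K] [Algebra F K]
    [Algebra E K] [IsScalarTower F E K] (x : K) :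
    IsIntegral (extensionRing O E) x ↔ IsIntegral O x := by
  let _ : Algebra O (extensionRing O E) := inferInstanceAs (Algebra O (integralClosure O E))
  have : IsScalarTower O (extensionRing O E) K := IsScalarTower.of_algebraMap_eq fun a => by
    change algebraMap F K a = algebraMap E K (algebraMap F E a)
    exact IsScalarTower.algebraMap_apply F E K a
  have : Algebra.IsIntegral O (extensionRing O E) :=
    inferInstanceAs (Algebra.IsIntegral O (integralClosure O E))
  exact ⟨isIntegral_trans x, fun h => h.tower_top⟩

theorem extensionRing_extensionRing (O : Subalgebra k F) (K : Type u) [Field K] [Algebra k K]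
    [Algebra F K] [Algebra E K] [IsScalarTower F E K] [IsScalarTower k F K] [IsScalarTower k E K] :
    extensionRing (extensionRing O E) K = extensionRing O K := by
  ext x
  exact isIntegral_extensionRing_iff O x

/-- Passing to the extension is what allows towers to be treated one step at a time. -/
theorem isHenselDVF_extensionRing (h : IsHenselDVF k O) [FiniteDimensional F E]
    [hfin : Module.Finite O (integralClosure O E)] : IsHenselDVF k (extensionRing O E) where
  isFractionRing := by
    have := h.isFractionRing
    exact integralClosure.isFractionRing_of_finite_extension (A := O) F E
  isDiscreteValuationRing := h.isDiscreteValuationRing_extensionRing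
  isLocalRing_integralClosure K _ _ _ := by
    let _ : Algebra F K := ((algebraMap E K).comp (algebraMap F E)).toAlgebra
    have : IsScalarTower F E K := IsScalarTower.of_algebraMap_eq fun _ => rfl
    have : FiniteDimensional F K := FiniteDimensional.trans F E K
    have := h.isLocalRing_integralClosure K
    let f : integralClosure O K →+* integralClosure (extensionRing O E) K :=
      (integralClosure O K).toSubring.subtype.codRestrict
        (integralClosure (extensionRing O E) K).toSubring
        fun x => (isIntegral_extensionRing_iff O _).2 x.2
    exact IsLocalRing.of_surjective' f fun x =>
      ⟨⟨x, (isIntegral_extensionRing_iff O _).1 x.2⟩, rfl⟩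
  finite_frobenius p _ hchar := by
    let f : O →+* extensionRing O E := algebraMap O (integralClosure O E)
    have hinj : Function.Injective f := by
      have := h.isFractionRing
      have := h.isDiscreteValuationRing
      exact algebraMap_integralClosure_injective O F E
    have hf : f.Finite := RingHom.finite_algebraMap (A := O) (B := integralClosure O E).2 hfin
    have : CharP O p := (RingHom.charP_iff f hinj p).2 hchar
    -- Frobenius commutes with `f`: as `f ∘ Frob` is finite, so is `Frob ∘ f`, and hence Frobenius
    -- upstairs.
    have h1 := hf.comp (h.finite_frobenius p)
    refine RingHom.Finite.of_comp_finite (f := f) ?_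
    convert h1 using 1
    ext x
    simp [frobenius_def]

theorem exists_associated_pow (h : IsHenselDVF k O) [FiniteDimensional F E]
    [hfin : Module.Finite O (integralClosure O E)] {t : O} (ht : Irreducible t) :
    ∃ (s : integralClosure O E) (e : ℕ), 0 < e ∧ Irreducible s ∧
      Associated (algebraMap O _ t) (s ^ e) := by
  have := h.isFractionRing
  have := h.isDiscreteValuationRing
  have := h.isLocalRing_integralClosure E
  have := isDiscreteValuationRing_integralClosure O F E
  have hinj := algebraMap_integralClosure_injective O F E
  obtain ⟨s, hs⟩ := IsDiscreteValuationRing.exists_irreducible (integralClosure O E)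
  obtain ⟨e, he⟩ := IsDiscreteValuationRing.associated_pow_irreducible
    ((map_ne_zero_iff _ hinj).2 ht.ne_zero) hs
  refine ⟨s, e, Nat.pos_of_ne_zero ?_, hs, he⟩
  rintro rfl
  rw [pow_zero, associated_one_iff_isUnit] at he
  exact not_isUnit_algebraMap_integralClosure O F E ht he

theorem exists_associated (h : IsHenselDVF k O) [FiniteDimensional F E]
    [hfin : Module.Finite O (integralClosure O E)] : ∃ (t : O) (s : integralClosure O E) (e : ℕ),
      0 < e ∧ Irreducible t ∧ Irreducible s ∧ Associated (algebraMap O _ t) (s ^ e) := by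
  have := h.isDiscreteValuationRing
  obtain ⟨t, ht⟩ := IsDiscreteValuationRing.exists_irreducible O
  obtain ⟨s, e, he0, hs, he⟩ := h.exists_associated_pow (E := E) ht
  exact ⟨t, s, e, he0, ht, hs, he⟩

theorem isTracePair (h : IsHenselDVF k O) [FiniteDimensional F E]
    [hfin : Module.Finite O (integralClosure O E)] {t : O} {s : integralClosure O E} {e : ℕ}
    (he0 : 0 < e) (ht : Irreducible t) (hs : Irreducible s)
    (he : Associated (algebraMap O _ t) (s ^ e)) :
    IsTracePair O (extensionRing O E) (t : F) (s : E) e := by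
  have := h.isFractionRing
  have := h.isDiscreteValuationRing
  have := h.isLocalRing_integralClosure E
  have := isDiscreteValuationRing_integralClosure O F E
  refine ⟨t.2, s.2, ?_, ?_, he0, fun a ha => ?_, ?_, fun b hb => ?_, fun b hb => ?_⟩
  · exact fun h0 => ht.ne_zero (Subtype.ext h0)
  · exact fun h0 => hs.ne_zero (Subtype.ext h0)
  · exact isIntegral_algebraMap (R := O) (A := E) (x := ⟨a, ha⟩)
  · obtain ⟨u, hu⟩ := he.symm
    have huE : ((u : integralClosure O E) : E) ≠ 0 := fun h0 => u.ne_zero (Subtype.ext h0)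
    refine ⟨(u : integralClosure O E), u.1.2, ?_, huE, ?_⟩
    · have h1 : ((u : integralClosure O E) : E) * ((u⁻¹ : (integralClosure O E)ˣ) :
          integralClosure O E) = 1 := congrArg Subtype.val u.mul_inv
      rw [inv_eq_of_mul_eq_one_right h1]
      exact Subtype.property _
    · exact (congrArg Subtype.val hu).symm.trans (mul_comm _ _)
  · have := Algebra.isIntegral_trace (L := F) (show IsIntegral O b from hb)
    obtain ⟨c, hc⟩ := IsIntegrallyClosed.isIntegral_iff.1 this
    exact hc ▸ c.2
  · obtain ⟨a, ha, h1⟩ := exists_trace_eq_of_mem_maximalIdeal O F E (x := s * ⟨b, hb⟩)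
      (Ideal.mul_mem_right _ _ ((IsLocalRing.mem_maximalIdeal _).2 hs.not_isUnit))
    rw [ht.maximalIdeal_eq, Ideal.mem_span_singleton] at ha
    obtain ⟨c, rfl⟩ := ha
    exact ⟨c, c.2, h1⟩

end IsHenselDVF

/-- The trace `T` from `E ⊇ B` to `F ⊇ O` is compatible with the logarithmic filtrations. -/
def HasTraceBound (O : Subalgebra k F) (B : Subalgebra k E)
    (T : ∀ q, Forms k E q →+ Forms k F q) : Prop :=
  ∃ e : ℕ, 0 < e ∧ (∃ (t : O) (s u : B), Irreducible t ∧ Irreducible s ∧ IsUnit u ∧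
    algebraMap F E t = u * s ^ e) ∧
    ∀ q r, (logFiltration k q E B r).map (T q) ≤ logFiltration k q F O (r / e)

/-- The two uniformizers of `B` occurring in the hypotheses differ by a unit, so the indices
multiply; the filtration indices compose by `r / f / e = r / (e f)`. -/
theorem HasTraceBound.comp {K : Type u} [Field K] [Algebra k K] [Algebra E K] [Algebra F K]
    [IsScalarTower F E K] [IsScalarTower k E K] [IsScalarTower k F K]
    {O : Subalgebra k F} {B : Subalgebra k E} {C : Subalgebra k K}
    [IsDiscreteValuationRing B] (hBC : ∀ b ∈ B, algebraMap E K b ∈ C)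
    {T : ∀ q, Forms k E q →+ Forms k F q} {S : ∀ q, Forms k K q →+ Forms k E q}
    (hT : HasTraceBound O B T) (hS : HasTraceBound B C S) :
    HasTraceBound O C fun q => (T q).comp (S q) := by
  obtain ⟨e, he, ⟨t, s, u, ht, hs, hu, h1⟩, hT⟩ := hT
  obtain ⟨f, hf, ⟨s', σ, w, hs', hσ, hw, h2⟩, hS⟩ := hS
  refine ⟨e * f, mul_pos he hf, ?_, fun q r => ?_⟩
  · obtain ⟨v, hv⟩ := IsDiscreteValuationRing.associated_of_irreducible (R := B) hs' hs
    let φ : B →+* C := ((algebraMap E K).comp B.toSubring.subtype).codRestrict C.toSubring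
      fun b => hBC b b.2
    refine ⟨t, σ, φ (u * v ^ e) * w ^ e, ht, hσ,
      ((hu.mul (v.isUnit.pow e)).map φ).mul (hw.pow e), ?_⟩
    have h3 : (s : E) = s' * (v : B) := (congrArg Subtype.val hv).symm
    rw [IsScalarTower.algebraMap_apply F E K, h1, h3]
    have h4 : ((φ (u * v ^ e) : C) : K) = algebraMap E K (u * (v : B) ^ e) := by
      change algebraMap E K ((u * v ^ e : B) : E) = _
      push_cast
      rfl
    change _ = ((φ (u * v ^ e) : C) : K) * (w : K) ^ e * (σ : K) ^ (e * f)
    rw [h4, mul_pow, map_mul, map_mul, map_mul, map_pow, map_pow, h2]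
    ring
  · rintro _ ⟨x, hx, rfl⟩
    have := hT q _ ⟨S q x, hS q r ⟨x, hx, rfl⟩, rfl⟩
    rwa [div_div, ← Nat.cast_mul, mul_comm f e] at this

/-- The trace formula for generators is taken as the hypothesis `hT`, so separable and inseparable
extensions of prime degree are covered by one argument. -/
theorem IsHenselDVF.hasTraceBound_of_finrank_prime {O : Subalgebra k F} (h : IsHenselDVF k O)
    [FiniteDimensional F E] [hfin : Module.Finite O (integralClosure O E)]
    (hp : (Module.finrank F E).Prime) {T : ∀ q, Forms k E q →+ Forms k F q}
    (hT : ∀ x ∈ extensionRing O E, Algebra.adjoin F {x} = ⊤ →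
      (∀ i, (minpoly F x).coeff i ∈ O) →
      (∀ b ∈ extensionRing O E, ∃ f : Polynomial F, (∀ i, f.coeff i ∈ O) ∧
        Polynomial.aeval x f = b) →
      ∃ τ, IsMonogenicTrace O (extensionRing O E) T x (minpoly F x).natDegree
        (minpoly F x).coeff τ) :
    HasTraceBound O (extensionRing O E) T := by
  have := h.isFractionRing
  have := h.isDiscreteValuationRing
  have := h.isLocalRing_integralClosure E
  have hB := isDiscreteValuationRing_integralClosure O F E
  have hB' : IsDiscreteValuationRing (extensionRing O E) := hB
  have hfs := faithfulSMul_integralClosure O F E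
  have hmin : ∀ x : integralClosure O E,
      minpoly F (x : E) = (minpoly O x).map (algebraMap O F) := fun x => by
    rw [minpoly.isIntegrallyClosed_eq_field_fractions' F x.2]
    congr 1
    exact minpoly.algebraMap_eq (B := integralClosure O E) (B' := E) Subtype.val_injective x
  have hcoeff : ∀ (x : integralClosure O E) i, (minpoly F (x : E)).coeff i =
      ((minpoly O x).coeff i : F) := fun x i => by
    rw [hmin, Polynomial.coeff_map]; rfl
  have hgen : ∀ x : integralClosure O E, Algebra.adjoin O {x} = ⊤ →
      ∀ b ∈ extensionRing O E, ∃ f : Polynomial F, (∀ i, f.coeff i ∈ O) ∧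
        Polynomial.aeval (x : E) f = b := fun x hx b hb => by
    obtain ⟨f, hf⟩ := exists_polynomial_of_adjoin_eq_top hx ⟨b, hb⟩
    refine ⟨f.map (algebraMap O F), fun i => ?_, ?_⟩
    · rw [Polynomial.coeff_map]
      exact Subtype.property _
    · rw [Polynomial.aeval_map_algebraMap]
      exact (Polynomial.aeval_algHom_apply (integralClosure O E).val x f).trans
        (congrArg Subtype.val hf)
  have hmono : ∀ x : integralClosure O E, Algebra.adjoin O {x} = ⊤ → ∃ τ,
      IsMonogenicTrace O (extensionRing O E) T (x : E) (minpoly F (x : E)).natDegree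
        (minpoly F (x : E)).coeff τ := fun x hx =>
    hT x x.2 (adjoin_eq_top_of_adjoin_integralClosure_eq_top F hx)
      (fun i => by rw [hcoeff]; exact Subtype.property _) (hgen x hx)
  obtain ⟨t, s, e, he0, ht, hs, he⟩ := h.exists_associated (E := E)
  rcases exists_adjoin_eq_top_of_finrank_prime F hp ht hs he with ⟨rfl, x, hx⟩ | ⟨hen, hx⟩
  · rw [pow_one] at he
    -- With `e = 1`, the uniformizer `t` of `O` stays one upstairs and replaces `s`.
    have hs' : Irreducible (algebraMap O (integralClosure O E) t) := he.symm.irreducible hs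
    have hpair := h.isTracePair (E := E) one_pos ht hs' (by rw [pow_one])
    obtain ⟨τ, hM⟩ := hmono x hx
    have ha : ∀ i < (minpoly F (x : E)).natDegree, (minpoly F (x : E)).coeff i ∈ O :=
      fun i _ => by rw [hcoeff]; exact Subtype.property _
    refine ⟨1, one_pos, ⟨t, algebraMap O (integralClosure O E) t, 1, ht, hs', isUnit_one, ?_⟩,
      hpair.map_logFiltration_le ht hs' T (hM.map_zero_le hpair ha)
        (hM.map_le_of_unramified hpair ha)⟩
    rw [pow_one]
    exact (one_mul _).symm
  · have hpair := h.isTracePair (E := E) he0 ht hs he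
    obtain ⟨τ, hM⟩ := hmono s hx
    have hn : (minpoly F (s : E)).natDegree = e := by
      rw [hen]
      exact (PowerBasis.ofAdjoinEqTop (Algebra.IsIntegral.isIntegral (s : E))
        (adjoin_eq_top_of_adjoin_integralClosure_eq_top F hx)).finrank.symm
    have hn' : (minpoly O s).natDegree = e := by
      rw [← hn, hmin, Polynomial.natDegree_map_eq_of_injective Subtype.val_injective]
    have ha : ∀ i < (minpoly F (s : E)).natDegree, ∃ o ∈ O,
        (minpoly F (s : E)).coeff i = t * o := fun i hi => by
      obtain ⟨o, ho⟩ := dvd_coeff_minpoly_of_totallyRamified F ht hs he hn'.le i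
        (by rwa [hn', ← hn])
      exact ⟨o, o.2, by rw [hcoeff, ho]; rfl⟩
    obtain ⟨u, hu⟩ := he.symm
    refine ⟨e, he0, ⟨t, s, (u : integralClosure O E), ht, hs, u.isUnit, ?_⟩,
      hpair.map_logFiltration_le ht hs T (hM.map_zero_le hpair fun i hi => ?_)
        (hM.map_le_of_totallyRamified hpair ha)⟩
    · exact (congrArg Subtype.val hu).symm.trans (mul_comm _ _)
    · rw [hcoeff]; exact Subtype.property _

end HenselDVF

/-! ### Separability of the residue extension in invertible degree. -/

section TameResidue

open IsLocalRing

/-- An inseparable irreducible polynomial is a polynomial in `X^p`, so `p` would divide its degree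
and thus the degree of the extension. -/
theorem separable_minpoly_of_finrank_ne_zero {K K' : Type*} [Field K] [Field K'] [Algebra K K']
    [FiniteDimensional K K'] (h : (Module.finrank K K' : K) ≠ 0) (x : K') :
    (minpoly K x).Separable := by
  obtain ⟨p, hp⟩ := CharP.exists K
  have hint : IsIntegral K x := Algebra.IsIntegral.isIntegral x
  refine (Polynomial.separable_or p (minpoly.irreducible hint)).resolve_right ?_
  rintro ⟨-, g, -, hg⟩
  refine h ((CharP.cast_eq_zero_iff K p _).2 ?_)
  refine dvd_trans ?_ (minpoly.degree_dvd hint)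
  rw [← hg, Polynomial.natDegree_expand]
  exact Dvd.intro_left _ rfl

variable {A E : Type*} (F : Type*) [CommRing A] [IsDomain A] [IsDiscreteValuationRing A] [Field F]
  [Algebra A F] [IsFractionRing A F] [Field E] [Algebra F E] [Algebra A E] [IsScalarTower A F E]
  [FiniteDimensional F E]

/-- If the degree is invertible, then so is the ramification index, and the residue field extension
is separable. -/
theorem exists_polynomial_isUnit_aeval_derivative [Module.Finite A (integralClosure A E)]
    [IsDiscreteValuationRing (integralClosure A E)] {t : A} (ht : Irreducible t)
    {s : integralClosure A E} (hs : Irreducible s) {e : ℕ}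
    (he : Associated (algebraMap A (integralClosure A E) t) (s ^ e))
    (hn : IsUnit (Module.finrank F E : A)) :
    e ∣ Module.finrank F E ∧ ∀ b : integralClosure A E, ∃ f : Polynomial A,
      s ∣ Polynomial.aeval b f ∧ IsUnit (Polynomial.aeval b (Polynomial.derivative f)) := by
  have := faithfulSMul_integralClosure A F E
  have : IsFractionRing (integralClosure A E) E :=
    integralClosure.isFractionRing_of_finite_extension F E
  have hef := Ideal.ramificationIdx_mul_inertiaDeg_of_isLocalRing (integralClosure A E) F E
    (p := maximalIdeal A) (IsDiscreteValuationRing.not_a_field A)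
  have : (maximalIdeal (integralClosure A E)).LiesOver (maximalIdeal A) := inferInstance
  rw [ramificationIdx'_eq_of_associated ht hs he, Ideal.inertiaDeg'_algebraMap] at hef
  let _ : Field (A ⧸ maximalIdeal A) := Ideal.Quotient.field _
  let _ : Field (integralClosure A E ⧸ maximalIdeal (integralClosure A E)) := Ideal.Quotient.field _
  let κ := A ⧸ maximalIdeal A
  let κ' := integralClosure A E ⧸ maximalIdeal (integralClosure A E)
  refine ⟨Dvd.intro _ hef, fun b => ?_⟩
  have hf : (Module.finrank κ κ' : κ) ≠ 0 := by
    rw [← hef, Nat.cast_mul] at hn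
    have := (isUnit_of_mul_isUnit_right hn).map (Ideal.Quotient.mk (maximalIdeal A))
    rw [map_natCast] at this
    exact this.ne_zero
  have hsep := separable_minpoly_of_finrank_ne_zero hf
    (algebraMap (integralClosure A E) κ' b)
  -- `f` lifts the minimal polynomial of the residue class of `b`: separability makes the derivative
  -- at `b` nonzero modulo the maximal ideal.
  obtain ⟨f, hf⟩ := Polynomial.map_surjective (algebraMap A κ) Ideal.Quotient.mk_surjective
    (minpoly κ (algebraMap (integralClosure A E) κ' b))
  have haux : ∀ f : Polynomial A, Polynomial.aeval (algebraMap (integralClosure A E) κ' b)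
      (f.map (algebraMap A κ)) = algebraMap (integralClosure A E) κ' (Polynomial.aeval b f) := by
    intro f
    rw [Polynomial.aeval_def, Polynomial.eval₂_map, Polynomial.aeval_def, Polynomial.hom_eval₂]
    rfl
  refine ⟨f, ?_, ?_⟩
  · rw [← Ideal.mem_span_singleton, ← hs.maximalIdeal_eq, ← Ideal.Quotient.eq_zero_iff_mem]
    refine (haux f).symm.trans ?_
    rw [hf]
    exact minpoly.aeval κ (algebraMap (integralClosure A E) κ' b)
  · have h1 := hsep.aeval_derivative_ne_zero
      (minpoly.aeval κ (algebraMap (integralClosure A E) κ' b))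
    rw [← hf, Polynomial.derivative_map, haux] at h1
    by_contra hu
    exact h1 (Ideal.Quotient.eq_zero_iff_mem.2 ((IsLocalRing.mem_maximalIdeal _).2 hu))

end TameResidue

/-! ### Differentials of tame extensions. -/

section TameDifferentials

/-- Nakayama for `W` modulo `V`. Only the finitely generated `N`, which fills `W` up to `V`, is
needed; `W` itself may fail to be finitely generated. -/
theorem Submodule.le_of_le_sup_singleton_smul {R M : Type*} [CommRing R] [IsLocalRing R]
    [AddCommGroup M] [Module R M] {s : R} (hs : ¬ IsUnit s) {V N W : Submodule R M} (hN : N.FG)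
    (hNW : N ≤ W) (hWN : W ≤ V ⊔ N) (hW : W ≤ V ⊔ Ideal.span {s} • W) : W ≤ V := by
  refine hWN.trans (sup_le le_rfl ?_)
  refine Submodule.le_of_le_smul_of_le_jacobson_bot (I := Ideal.span {s}) hN ?_
    (hNW.trans (hW.trans (sup_le le_sup_left ?_)))
  · refine le_trans ?_ (IsLocalRing.maximalIdeal_le_jacobson _)
    rw [Ideal.span_singleton_le_iff_mem]
    exact (IsLocalRing.mem_maximalIdeal _).2 hs
  · refine (smul_mono_right (Ideal.span {s}) hWN).trans ?_
    rw [Submodule.smul_sup]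
    exact sup_le_sup_right Submodule.smul_le_right _

variable {k F E : Type u} [Field k] [Field F] [Algebra k F] [Field E] [Algebra k E]
  [Algebra F E] [IsScalarTower k F E]
  {O : Subalgebra k F} {B : Subalgebra k E} {t : F} {s : E} {e : ℕ}

/-- Logarithmic differentiation of `t = u * s ^ e`. -/
theorem IsTracePair.exists_dlog_eq (h : IsTracePair O B t s e) : ∃ u ∈ B, u⁻¹ ∈ B ∧ u ≠ 0 ∧
    (e : E) • dlog k s =
      KaehlerDifferential.map k k F E (dlog k t) - u⁻¹ • KaehlerDifferential.D k E u := by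
  obtain ⟨u, hu, hu', hu0, h1⟩ := h.unit
  refine ⟨u, hu, hu', hu0, ?_⟩
  have hs := h.s_ne
  obtain ⟨j, rfl⟩ : ∃ j, e = j + 1 := Nat.exists_eq_succ_of_ne_zero h.e_pos.ne'
  rw [map_dlog, h1, dlog, dlog, Derivation.leibniz, Derivation.leibniz_pow, smul_add, eq_sub_iff_add_eq,
    smul_smul, smul_smul, smul_smul, Nat.add_sub_cancel, ← Nat.cast_smul_eq_nsmul E, smul_smul,
    smul_smul]
  congr 2 <;> field_simp
  ring

theorem smul_mem_of_mem (M : Submodule B Ω[E⁄k]) {b : E} (hb : b ∈ B) {w : Ω[E⁄k]} (hw : w ∈ M) :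
    b • w ∈ M := M.smul_mem (⟨b, hb⟩ : B) hw

/-- Modulo differentials from `O`, the derivation is `O`-linear, so module generators of `B`
suffice. This provides the finitely generated part for Nakayama. -/
theorem diffSpan_le_sup_span_of_generators (hOB : ∀ a ∈ O, algebraMap F E a ∈ B) {S : Set E}
    (hSB : S ⊆ B) (hgen : ∀ b ∈ B, b ∈ Submodule.span O S) :
    diffSpan B ≤ extSpan B (diffSpan O) ⊔ Submodule.span B (KaehlerDifferential.D k E '' S) := by
  refine Submodule.span_le.2 ?_
  rintro _ ⟨⟨b, hb⟩, rfl⟩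
  suffices b ∈ B ∧ KaehlerDifferential.D k E b ∈ extSpan B (diffSpan O) ⊔
    Submodule.span B (KaehlerDifferential.D k E '' S) from this.2
  have hbS := hgen b hb
  clear hb
  induction hbS using Submodule.span_induction with
  | mem x hx => exact ⟨hSB hx, Submodule.mem_sup_right (Submodule.subset_span ⟨x, hx, rfl⟩)⟩
  | zero => rw [map_zero]; exact ⟨zero_mem _, zero_mem _⟩
  | add x y _ _ hx hy => rw [map_add]; exact ⟨add_mem hx.1 hy.1, add_mem hx.2 hy.2⟩
  | smul a x hxS hx =>
    rw [show a • x = algebraMap F E a * x from Algebra.smul_def (a : F) x, Derivation.leibniz]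
    exact ⟨mul_mem (hOB a a.2) hx.1, add_mem (smul_mem_of_mem _ (hOB a a.2) hx.2)
      (smul_mem_of_mem _ hx.1
        (Submodule.mem_sup_left (D_algebraMap_mem_extSpan B O a.2)))⟩

/-- Modulo `s Ω`, `ds` is `e⁻¹ s dlog t` by logarithmic differentiation of `t = u s^e`. For other
`b`, differentiate `f(b) = s c` and divide by the unit `f'(b)`. The module `M` is left free so that
Nakayama can be applied with `s Ω` included in it. -/
theorem IsTracePair.diffSpan_le_sup_smul_of_tame (h : IsTracePair O B t s e)
    (he : (e : E)⁻¹ ∈ B) (he0 : (e : E) ≠ 0)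
    (hres : ∀ b ∈ B, ∃ f : Polynomial F, (∀ i, f.coeff i ∈ O) ∧
      (∃ c ∈ B, Polynomial.aeval b f = s * c) ∧ Polynomial.aeval b (Polynomial.derivative f) ≠ 0 ∧
      (Polynomial.aeval b (Polynomial.derivative f))⁻¹ ∈ B)
    {M : Submodule B Ω[E⁄k]} (hM : extSpan B (diffSpan O) ≤ M)
    (hMt : s • KaehlerDifferential.map k k F E (dlog k t) ∈ M)
    (hMs : ∀ w ∈ diffSpan B, s • w ∈ M) : diffSpan B ≤ M := by
  have hDs : KaehlerDifferential.D k E s ∈ M := by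
    obtain ⟨u, hu, hu', hu0, h1⟩ := h.exists_dlog_eq
    have h2 : KaehlerDifferential.D k E s = (e : E)⁻¹ •
        (s • KaehlerDifferential.map k k F E (dlog k t) -
          u⁻¹ • s • KaehlerDifferential.D k E u) := by
      rw [smul_comm u⁻¹ s, ← smul_sub, ← h1, dlog, smul_smul, smul_smul, smul_smul,
        show (e : E)⁻¹ * s * e * s⁻¹ = 1 by have := h.s_ne; field_simp, one_smul]
    rw [h2]
    exact smul_mem_of_mem _ he (sub_mem hMt (smul_mem_of_mem _ hu' (hMs _ (D_mem_diffSpan B hu))))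
  refine Submodule.span_le.2 ?_
  rintro _ ⟨⟨b, hb⟩, rfl⟩
  change KaehlerDifferential.D k E b ∈ M
  obtain ⟨f, hf, ⟨c, hc, hfc⟩, h0, hinv⟩ := hres b hb
  have h1 := hM (D_aeval_sub_mem hb hf)
  have h2 : KaehlerDifferential.D k E (Polynomial.aeval b f) ∈ M := by
    rw [hfc, Derivation.leibniz]
    exact add_mem (hMs _ (D_mem_diffSpan B hc)) (smul_mem_of_mem _ hc hDs)
  have h3 := sub_mem h2 h1
  rw [sub_sub_cancel] at h3
  have h4 := smul_mem_of_mem _ hinv h3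
  rwa [smul_smul, inv_mul_cancel₀ h0, one_smul] at h4

theorem IsTracePair.diffSpan_le_of_tame (h : IsTracePair O B t s e) [IsLocalRing B]
    (hs : ¬ IsUnit (⟨s, h.s_mem⟩ : B)) (he : (e : E)⁻¹ ∈ B) (he0 : (e : E) ≠ 0)
    {S : Set E} (hS : S.Finite) (hSB : S ⊆ B)
    (hgen : ∀ b ∈ B, b ∈ Submodule.span O S)
    (hres : ∀ b ∈ B, ∃ f : Polynomial F, (∀ i, f.coeff i ∈ O) ∧
      (∃ c ∈ B, Polynomial.aeval b f = s * c) ∧ Polynomial.aeval b (Polynomial.derivative f) ≠ 0 ∧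
      (Polynomial.aeval b (Polynomial.derivative f))⁻¹ ∈ B) :
    diffSpan B ≤ extSpan B (diffSpan O) ⊔
      Submodule.span B {s • KaehlerDifferential.map k k F E (dlog k t)} := by
  refine Submodule.le_of_le_sup_singleton_smul hs
    (N := Submodule.span B (KaehlerDifferential.D k E '' S)) (Submodule.fg_span (hS.image _)) ?_ ?_ ?_
  · refine Submodule.span_mono ?_
    rintro _ ⟨x, hx, rfl⟩
    exact ⟨⟨x, hSB hx⟩, rfl⟩
  · exact (diffSpan_le_sup_span_of_generators h.algebraMap_mem hSB hgen).trans
      (sup_le_sup_right le_sup_left _)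
  · have hMs : ∀ w ∈ diffSpan B, s • w ∈ extSpan B (diffSpan O) ⊔
        Submodule.span B {s • KaehlerDifferential.map k k F E (dlog k t)} ⊔
        Ideal.span {(⟨s, h.s_mem⟩ : B)} • diffSpan B := fun w hw => by
      have := Submodule.smul_mem_smul (Ideal.mem_span_singleton_self (⟨s, h.s_mem⟩ : B)) hw
      exact Submodule.mem_sup_right this
    refine h.diffSpan_le_sup_smul_of_tame he he0 hres (le_sup_left.trans le_sup_left) ?_ hMs
    exact Submodule.mem_sup_left (Submodule.mem_sup_right (Submodule.mem_span_singleton_self _))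

/-- Since `e` is invertible, `dlog s = e⁻¹ (dlog t - u⁻¹ du)`, and `s dlog t` is a multiple of `dlog
t`. -/
theorem IsTracePair.logDiffSpan_le_of_tame (h : IsTracePair O B t s e)
    (he : (e : E)⁻¹ ∈ B) (he0 : (e : E) ≠ 0)
    (hB : diffSpan B ≤ extSpan B (diffSpan O) ⊔
      Submodule.span B {s • KaehlerDifferential.map k k F E (dlog k t)}) :
    logDiffSpan B s ≤ extSpan B (logDiffSpan O t) := by
  have hsmul : ∀ (M : Submodule B Ω[E⁄k]) {b : E} (_ : b ∈ B) {w : Ω[E⁄k]} (_ : w ∈ M), b • w ∈ M :=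
    fun M b hb w hw => M.smul_mem (⟨b, hb⟩ : B) hw
  have hdt : KaehlerDifferential.map k k F E (dlog k t) ∈ extSpan B (logDiffSpan O t) :=
    map_mem_extSpan B (Submodule.mem_sup_right (Submodule.mem_span_singleton_self _))
  have h1 : diffSpan B ≤ extSpan B (logDiffSpan O t) := by
    refine hB.trans (sup_le (extSpan_mono B le_sup_left) ?_)
    rw [Submodule.span_singleton_le_iff_mem]
    exact hsmul _ h.s_mem hdt
  refine sup_le h1 ?_
  rw [Submodule.span_singleton_le_iff_mem]
  obtain ⟨u, hu, hu', hu0, h2⟩ := h.exists_dlog_eq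
  have h3 : (e : E) • dlog k s ∈ extSpan B (logDiffSpan O t) := by
    rw [h2]
    exact sub_mem hdt (hsmul _ hu' (h1 (D_mem_diffSpan B hu)))
  have h4 := hsmul _ he h3
  rwa [smul_smul, inv_mul_cancel₀ he0, one_smul] at h4

end TameDifferentials

/-- Separable extensions whose degree is prime to the characteristic. -/
theorem IsHenselDVF.hasTraceBound_of_finrank_ne_zero {k F E : Type u} [Field k] [Field F]
    [Algebra k F] [Field E] [Algebra k E] [Algebra F E] [IsScalarTower k F E]
    {O : Subalgebra k F} (h : IsHenselDVF k O)
    [FiniteDimensional F E] [hfin : Module.Finite O (integralClosure O E)]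
    (hn : (Module.finrank F E : k) ≠ 0) {T : ∀ q, Forms k E q →+ Forms k F q}
    (hT : IsSeparableFormTrace k F E T) : HasTraceBound O (extensionRing O E) T := by
  have := h.isFractionRing
  have := h.isDiscreteValuationRing
  have := h.isLocalRing_integralClosure E
  have hB := isDiscreteValuationRing_integralClosure O F E
  have hB' : IsDiscreteValuationRing (extensionRing O E) := hB
  obtain ⟨t, s, e, he0, ht, hs, he⟩ := h.exists_associated (E := E)
  have hpair := h.isTracePair (E := E) he0 ht hs he
  have hnO : IsUnit (Module.finrank F E : O) := by
    rw [← map_natCast (algebraMap k O)]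
    exact (isUnit_iff_ne_zero.2 hn).map _
  obtain ⟨hdvd, hpoly⟩ := exists_polynomial_isUnit_aeval_derivative F ht hs he hnO
  have hek : (e : k) ≠ 0 := fun h0 => hn (by
    obtain ⟨f, hf⟩ := hdvd
    rw [hf, Nat.cast_mul, h0, zero_mul])
  have heE : (e : E) ≠ 0 := by
    rw [← map_natCast (algebraMap k E)]
    exact (map_ne_zero _).2 hek
  have heB : (e : E)⁻¹ ∈ extensionRing O E := by
    rw [← map_natCast (algebraMap k E), ← map_inv₀]
    exact Subalgebra.algebraMap_mem _ _
  obtain ⟨S, hS⟩ := hfin.fg_top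
  have hval : ∀ (b : integralClosure O E) (f : Polynomial O),
      Polynomial.aeval (b : E) (f.map (algebraMap O F)) =
        ((Polynomial.aeval b f : integralClosure O E) : E) := fun b f => by
    rw [Polynomial.aeval_map_algebraMap]
    exact Polynomial.aeval_algHom_apply (integralClosure O E).val b f
  have hdiff := hpair.diffSpan_le_of_tame hs.not_isUnit heB heE
    (S := (integralClosure O E).val '' S) (S.finite_toSet.image _) (by
      rintro _ ⟨x, -, rfl⟩
      exact x.2) (fun b hb => by
      rw [show (integralClosure O E).val '' (S : Set (integralClosure O E)) =
        (integralClosure O E).val.toLinearMap '' S from rfl, ← Submodule.map_span, hS]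
      exact ⟨⟨b, hb⟩, trivial, rfl⟩) (fun b hb => by
      obtain ⟨f, ⟨c, hc⟩, hu⟩ := hpoly ⟨b, hb⟩
      obtain ⟨v, hv⟩ := hu.exists_right_inv
      refine ⟨f.map (algebraMap O F), fun i => ?_, ⟨c, c.2, ?_⟩, ?_, ?_⟩
      · rw [Polynomial.coeff_map]; exact Subtype.property _
      · rw [hval ⟨b, hb⟩, hc]; rfl
      · rw [Polynomial.derivative_map, hval ⟨b, hb⟩]
        exact fun h0 => hu.ne_zero (Subtype.ext h0)
      · rw [Polynomial.derivative_map, hval ⟨b, hb⟩]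
        have h1 : ((Polynomial.aeval (⟨b, hb⟩ : integralClosure O E)
          (Polynomial.derivative f) : integralClosure O E) : E) * (v : E) = 1 :=
          congrArg Subtype.val hv
        rw [inv_eq_of_mul_eq_one_right h1]
        exact v.2)
  obtain ⟨u, hu⟩ := he.symm
  refine ⟨e, he0, ⟨t, s, (u : integralClosure O E), ht, hs, u.isUnit, ?_⟩,
    hpair.map_logFiltration_le ht hs T (hpair.map_zero_le_of_tame hT hdiff)
      (hpair.map_le_of_tame hT (hpair.logDiffSpan_le_of_tame heB heE hdiff))⟩
  exact (congrArg Subtype.val hu).symm.trans (mul_comm _ _)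

/-! ### Integral closures of henselian domains are local. -/

section HenselianLocal

open IsLocalRing Pointwise

theorem IsLocalRing.isUnit_of_algebraMap_notMem {A C : Type*} [CommRing A] [IsLocalRing A]
    [CommRing C] [Algebra A C] [Algebra.IsIntegral A C] (m : Ideal C) [hm : m.IsMaximal] {a : A}
    (ha : algebraMap A C a ∉ m) : IsUnit a := by
  by_contra hu
  have h1 : m.comap (algebraMap A C) = maximalIdeal A :=
    eq_maximalIdeal (Ideal.isMaximal_comap_of_isIntegral_of_isMaximal m)
  have h2 : a ∈ maximalIdeal A := (IsLocalRing.mem_maximalIdeal _).2 hu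
  rw [← h1] at h2
  exact ha h2

/-- The polynomial with roots the conjugates of `γ` descends to `A`. Modulo `m` one root is `1` and
all others are `0`, so `1` is a simple residual root; its Hensel lift in `A` must be one of the
conjugates. -/
theorem HenselianLocalRing.exists_smul_eq_algebraMap {A C : Type*} (G : Type*) [CommRing A]
    [HenselianLocalRing A] [CommRing C] [IsDomain C] [Algebra A C] [Algebra.IsIntegral A C]
    [Group G] [Finite G] [MulSemiringAction G C] [Algebra.IsInvariant A C G]
    (m : Ideal C) [hm : m.IsMaximal] {γ : C} (h1 : γ - 1 ∈ m)
    (hγ : ∀ g : G, g • γ = γ ∨ g • γ ∈ m) : ∃ (a : A) (g : G), g • γ = algebraMap A C a := by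
  classical
  cases nonempty_fintype G
  set P := prodXSubSMul G C γ with hP
  have hcoset : ∀ c : G ⧸ MulAction.stabilizer G γ, ∃ g : G,
      (g : G ⧸ MulAction.stabilizer G γ) = c ∧ MulAction.ofQuotientStabilizer G γ c = g • γ :=
    fun c => by
      obtain ⟨g, rfl⟩ := QuotientGroup.mk_surjective c
      exact ⟨g, rfl, rfl⟩
  obtain ⟨g, hg, -, hgm⟩ := Polynomial.lifts_and_natDegree_eq_and_monic
    (f := algebraMap A C) (p := P) ((Polynomial.lifts_iff_coeff_lifts _).2 fun n =>
      Algebra.IsInvariant.isInvariant (G := G) _ fun σ => prodXSubSMul.coeff G C γ σ n)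
    (prodXSubSMul.monic G C γ)
  -- The product runs over the orbit and not over `G`, so that `γ` occurs once and the root `1` is
  -- simple.
  let Q := ∏ c ∈ Finset.univ.erase ((1 : G) : G ⧸ MulAction.stabilizer G γ),
    (Polynomial.X - Polynomial.C (MulAction.ofQuotientStabilizer G γ c))
  have hPQ : P = (Polynomial.X - Polynomial.C γ) * Q := by
    rw [hP, prodXSubSMul, ← Finset.mul_prod_erase _ _ (Finset.mem_univ
      ((1 : G) : G ⧸ MulAction.stabilizer G γ))]
    simp [Q]
  have hQ : Ideal.Quotient.mk m (Q.eval 1) = 1 := by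
    rw [Polynomial.eval_prod, map_prod]
    refine Finset.prod_eq_one fun c hc => ?_
    obtain ⟨σ, rfl, hσ⟩ := hcoset c
    rw [hσ]
    have : σ • γ ≠ γ := fun h => Finset.ne_of_mem_erase hc
      (QuotientGroup.eq.2 (by simpa using (MulAction.stabilizer G γ).inv_mem h))
    simp [Ideal.Quotient.eq_zero_iff_mem.2 ((hγ σ).resolve_left this)]
  have hγ1 : Ideal.Quotient.mk m γ = 1 := (Ideal.Quotient.mk_eq_one_iff_sub_mem γ).2 h1
  have hg0 : g.eval 1 ∈ maximalIdeal A := by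
    refine (IsLocalRing.mem_maximalIdeal _).2 fun hu => ?_
    have := (hu.map (algebraMap A C)).map (Ideal.Quotient.mk m)
    rw [← Polynomial.eval_map_apply, hg, map_one, hPQ, Polynomial.eval_mul, map_mul] at this
    simp [hγ1] at this
  have hg1 : IsUnit ((Polynomial.derivative g).eval 1) := by
    refine isUnit_of_algebraMap_notMem m fun h => ?_
    rw [← Polynomial.eval_map_apply, ← Polynomial.derivative_map, hg, map_one, hPQ,
      Polynomial.derivative_mul, ← Ideal.Quotient.eq_zero_iff_mem] at h
    simp [hγ1, hQ] at h
  obtain ⟨a, ha, -⟩ := HenselianLocalRing.is_henselian g hgm 1 hg0 hg1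
  have ha' : P.eval (algebraMap A C a) = 0 := by
    rw [← hg, Polynomial.eval_map_apply, ha.eq_zero, map_zero]
  rw [hP, prodXSubSMul, Polynomial.eval_prod, Finset.prod_eq_zero_iff] at ha'
  obtain ⟨c, -, hc⟩ := ha'
  obtain ⟨σ, -, hσ⟩ := hcoset c
  refine ⟨a, σ, ?_⟩
  rw [hσ, Polynomial.eval_sub, Polynomial.eval_X, Polynomial.eval_C, sub_eq_zero] at hc
  exact hc.symm

/-- Two distinct maximal ideals `m` and `τ • m` are conjugate. The Chinese remainder theorem gives
`γ` congruent to `1` modulo `m` all of whose other conjugates lie in `m`. A conjugate of `γ` then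
lies in `A`, so `γ` is invariant, whereas `τ • γ ∈ m`. -/
theorem HenselianLocalRing.isLocalRing_of_isInvariant {A C : Type*} (G : Type*) [CommRing A]
    [HenselianLocalRing A] [CommRing C] [IsDomain C] [Algebra A C] [Algebra.IsIntegral A C]
    [Group G] [Finite G] [MulSemiringAction G C] [SMulCommClass G A C]
    [Algebra.IsInvariant A C G] : IsLocalRing C := by
  classical
  cases nonempty_fintype G
  obtain ⟨m, hm⟩ := Ideal.exists_maximal C
  refine IsLocalRing.of_unique_max_ideal ⟨m, hm, fun m' hm' => ?_⟩
  have hu : ∀ I : Ideal C, I.IsMaximal → I.under A = maximalIdeal A := fun I hI =>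
    eq_maximalIdeal (Ideal.isMaximal_comap_of_isIntegral_of_isMaximal I)
  obtain ⟨τ, rfl⟩ := Algebra.IsInvariant.exists_smul_of_under_eq A C G m m'
    ((hu m hm).trans (hu m' hm').symm)
  by_contra hne
  have hmax : ∀ σ : G, (σ • m).IsMaximal := fun σ => by
    have := Ideal.map_isMaximal_of_equiv (MulSemiringAction.toRingEquiv G C σ) (p := m)
    exact this
  let I : Ideal C := ⨅ σ ∈ (Finset.univ.filter fun σ : G => σ • m ≠ m), σ • m
  have hI : m ⊔ I = ⊤ := Ideal.sup_iInf_eq_top fun σ hσ =>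
    Ideal.IsMaximal.coprime_of_ne hm (hmax σ) (Finset.mem_filter.1 hσ).2.symm
  obtain ⟨x, hx, β, hβ, hxβ⟩ := Submodule.mem_sup.1 (hI ▸ Submodule.mem_top : (1 : C) ∈ m ⊔ I)
  have hβ1 : β - 1 ∈ m := by
    rw [← hxβ, sub_add_cancel_right]
    exact neg_mem hx
  have hβI : ∀ σ : G, σ • m ≠ m → β ∈ σ • m := fun σ hσ =>
    (Submodule.mem_iInf _).1 ((Submodule.mem_iInf _).1 hβ σ)
      (Finset.mem_filter.2 ⟨Finset.mem_univ _, hσ⟩)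
  have hinv : ∀ σ : G, σ • m ≠ m → σ • β ∈ m := fun σ hσ => by
    have := hβI σ⁻¹ fun h => hσ (by rw [← h, smul_inv_smul, h])
    rwa [Ideal.mem_inv_pointwise_smul_iff] at this
  -- Multiplying over the stabilizer of `m` makes `γ` fixed by it, so a conjugate either equals `γ`
  -- or lies in `m`.
  let γ := ∏ σ : MulAction.stabilizer G m, (σ : G) • β
  have hγ1 : γ - 1 ∈ m := by
    rw [← Ideal.Quotient.mk_eq_one_iff_sub_mem, map_prod]
    refine Finset.prod_eq_one fun σ _ => ?_
    rw [Ideal.Quotient.mk_eq_one_iff_sub_mem]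
    have h1 := Ideal.smul_mem_pointwise_smul (σ : G) _ m hβ1
    rwa [smul_sub, smul_one, show (σ : G) • m = m from σ.2] at h1
  have hγ : ∀ σ : G, σ • γ = γ ∨ σ • γ ∈ m := fun σ => by
    by_cases hσ : σ • m = m
    · left
      rw [Finset.smul_prod']
      refine Fintype.prod_equiv (Equiv.mulLeft (⟨σ, hσ⟩ : MulAction.stabilizer G m)) _ _ fun ρ => ?_
      rw [smul_smul]
      rfl
    · right
      rw [Finset.smul_prod']
      refine Ideal.mem_of_dvd _ (Finset.dvd_prod_of_mem _
        (Finset.mem_univ (1 : MulAction.stabilizer G m))) ?_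
      simpa using hinv σ hσ
  have hγτ : τ • γ ∈ m := by
    rw [Finset.smul_prod']
    refine Ideal.mem_of_dvd _ (Finset.dvd_prod_of_mem _
      (Finset.mem_univ (1 : MulAction.stabilizer G m))) ?_
    simpa using hinv τ hne
  obtain ⟨a, σ, ha⟩ := HenselianLocalRing.exists_smul_eq_algebraMap (A := A) G m hγ1 hγ
  have hfix : ∀ ρ : G, ρ • γ = γ := fun ρ => by
    have h2 : γ = algebraMap A C a := by
      rw [← inv_smul_smul σ γ, ha, smul_algebraMap]
    rw [h2, smul_algebraMap]
  rw [hfix] at hγτ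
  refine hm.ne_top ((Ideal.eq_top_iff_one _).2 ?_)
  have := sub_mem hγτ hγ1
  rwa [sub_sub_cancel] at this

variable (A F : Type*) [CommRing A] [IsDomain A] [HenselianLocalRing A] [IsIntegrallyClosed A]
  [Field F] [Algebra A F] [IsFractionRing A F]

theorem HenselianLocalRing.isLocalRing_integralClosure_of_isGalois (N : Type*) [Field N]
    [Algebra F N] [Algebra A N] [IsScalarTower A F N] [FiniteDimensional F N] [IsGalois F N] :
    IsLocalRing (integralClosure A N) := by
  have : IsFractionRing (integralClosure A N) N :=
    integralClosure.isFractionRing_of_finite_extension F N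
  have : Algebra.IsInvariant A (integralClosure A N) (integralClosure A N ≃ₐ[A] integralClosure A N) :=
    Algebra.isInvariant_of_isGalois' A F N (integralClosure A N)
  have : Finite (integralClosure A N ≃ₐ[A] integralClosure A N) :=
    Finite.of_equiv _ (galRestrict A F N (integralClosure A N)).toEquiv
  exact HenselianLocalRing.isLocalRing_of_isInvariant (A := A)
    (integralClosure A N ≃ₐ[A] integralClosure A N)

theorem isUnit_integralClosure_of_isIntegral_inv {A E : Type*} [CommRing A] [Field E] [Algebra A E]
    {x : integralClosure A E} (hx : (x : E) ≠ 0) (h : IsIntegral A (x : E)⁻¹) : IsUnit x :=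
  IsUnit.of_mul_eq_one ⟨_, h⟩ (Subtype.ext (mul_inv_cancel₀ hx))

theorem isUnit_integralClosure_iff {A E : Type*} [CommRing A] [Field E] [Algebra A E]
    {x : integralClosure A E} : IsUnit x ↔ (x : E) ≠ 0 ∧ IsIntegral A (x : E)⁻¹ := by
  refine ⟨fun h => ?_, fun h => isUnit_integralClosure_of_isIntegral_inv h.1 h.2⟩
  obtain ⟨y, hy⟩ := h.exists_right_inv
  have h1 : (x : E) * y = 1 := congrArg Subtype.val hy
  refine ⟨left_ne_zero_of_mul_eq_one h1, ?_⟩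
  rw [inv_eq_of_mul_eq_one_right h1]
  exact y.2

/-- Locality descends along the inclusion of integral closures: an element that becomes invertible
upstairs has an integral inverse already in `E`. -/
theorem isLocalRing_integralClosure_of_algebra {A E N : Type*} [CommRing A] [Field E] [Algebra A E]
    [Field N] [Algebra A N] [Algebra E N] [IsScalarTower A E N]
    [IsLocalRing (integralClosure A N)] : IsLocalRing (integralClosure A E) := by
  let f : integralClosure A E →+* integralClosure A N :=
    ((algebraMap E N).comp (integralClosure A E).toSubring.subtype).codRestrict
      (integralClosure A N).toSubring fun x => x.2.algebraMap
  have : IsLocalHom f := ⟨fun x hx => by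
    obtain ⟨h1, h2⟩ := isUnit_integralClosure_iff.1 hx
    change algebraMap E N x ≠ 0 at h1
    change IsIntegral A (algebraMap E N x)⁻¹ at h2
    rw [← map_inv₀] at h2
    exact isUnit_integralClosure_iff.2 ⟨fun h0 => h1 (by rw [h0, map_zero]),
      (isIntegral_algebraMap_iff (algebraMap E N).injective).1 h2⟩⟩
  exact RingHom.domain_isLocalRing f

theorem HenselianLocalRing.isLocalRing_integralClosure_of_isSeparable (E : Type*) [Field E]
    [Algebra F E] [Algebra A E] [IsScalarTower A F E] [FiniteDimensional F E]
    [Algebra.IsSeparable F E] : IsLocalRing (integralClosure A E) := by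
  have : Algebra.IsSeparable F (SeparableClosure E) := Algebra.IsSeparable.trans F E _
  have : IsSepClosure F (SeparableClosure E) := ⟨inferInstance, inferInstance⟩
  have : IsGalois F (SeparableClosure E) := inferInstance
  let N := IntermediateField.normalClosure F E (SeparableClosure E)
  let _ : Algebra A N := ((algebraMap F N).comp (algebraMap A F)).toAlgebra
  have : IsScalarTower A F N := IsScalarTower.of_algebraMap_eq fun _ => rfl
  have : IsScalarTower A E N := IsScalarTower.of_algebraMap_eq fun a => by
    rw [IsScalarTower.algebraMap_apply A F N, IsScalarTower.algebraMap_apply A F E,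
      ← IsScalarTower.algebraMap_apply F E N]
  have := HenselianLocalRing.isLocalRing_integralClosure_of_isGalois A F N
  exact isLocalRing_integralClosure_of_algebra (N := N)

/-- Integral closures of a henselian local normal domain in finite field extensions are local. -/
theorem HenselianLocalRing.isLocalRing_integralClosure (E : Type*) [Field E]
    [Algebra F E] [Algebra A E] [IsScalarTower A F E] [FiniteDimensional F E] :
    IsLocalRing (integralClosure A E) := by
  obtain ⟨p, hp⟩ := ExpChar.exists F
  let K := separableClosure F E
  have : ExpChar E p := expChar_of_injective_algebraMap (algebraMap F E).injective p
  have : ExpChar K p := expChar_of_injective_algebraMap (algebraMap F K).injective p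
  have : IsScalarTower A K E := IsScalarTower.of_algebraMap_eq fun a => by
    rw [IsScalarTower.algebraMap_apply A F K, IsScalarTower.algebraMap_apply A F E,
      ← IsScalarTower.algebraMap_apply F K E]
  have := HenselianLocalRing.isLocalRing_integralClosure_of_isSeparable A F K
  -- All larger exponents are recorded as well, so that two elements can be raised to a common power
  -- of `p`, which is additive.
  have hpow : ∀ x : integralClosure A E, ∃ n : ℕ, ∀ j, ∃ y : integralClosure A K,
      algebraMap K E y = (x : E) ^ p ^ (n + j) := fun x => by
    obtain ⟨n, y, hy⟩ := IsPurelyInseparable.pow_mem K p (x : E)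
    refine ⟨n, fun j => ⟨⟨y ^ p ^ j, ?_⟩, ?_⟩⟩
    · have h1 : IsIntegral A ((x : E) ^ p ^ n) := x.2.pow _
      rw [← hy] at h1
      exact ((isIntegral_algebraMap_iff (algebraMap K E).injective).1 h1).pow _
    · change algebraMap K E (y ^ p ^ j) = _
      rw [map_pow, hy, ← pow_mul, pow_add]
  have hunit : ∀ (x : integralClosure A E) (y : integralClosure A K) (n : ℕ),
      algebraMap K E y = (x : E) ^ p ^ n → (IsUnit x ↔ IsUnit y) := fun x y n h => by
    have hpn : p ^ n ≠ 0 := pow_ne_zero _ (expChar_pos F p).ne'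
    rw [isUnit_integralClosure_iff, isUnit_integralClosure_iff, ← pow_ne_zero_iff hpn, ← h,
      map_ne_zero, ← IsIntegral.pow_iff (Nat.pos_of_ne_zero hpn), inv_pow, ← h, ← map_inv₀,
      isIntegral_algebraMap_iff (algebraMap K E).injective]
  refine IsLocalRing.of_nonunits_add fun x y hx hy hxy => ?_
  obtain ⟨n, hn⟩ := hpow x
  obtain ⟨l, hl⟩ := hpow y
  obtain ⟨x', hx'⟩ := hn l
  obtain ⟨y', hy'⟩ := hl n
  rw [add_comm l n] at hy'
  have hxy' : algebraMap K E (x' + y' : integralClosure A K) =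
      ((x + y : integralClosure A E) : E) ^ p ^ (n + l) := by
    change algebraMap K E ((x' : K) + y') = ((x : E) + y) ^ p ^ (n + l)
    rw [map_add, hx', hy', add_pow_expChar_pow]
  exact IsLocalRing.nonunits_add (fun h => hx ((hunit x x' _ hx').2 h))
    (fun h => hy ((hunit y y' _ hy').2 h)) ((hunit _ _ _ hxy').1 hxy)

end HenselianLocal

/-! ### Finiteness of Frobenius on a henselization. -/

section FrobeniusFinite

open IsLocalRing

variable {R : Type*} [CommRing R] {p : ℕ} {R₀ : Subring R} {S : Subalgebra R₀ R}

/-- The inverse is `x^(p-1) (x⁻¹)^p`, and the second factor lies in `R₀`. -/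
theorem isUnit_of_pow_mem (hp : 0 < p) (hR : ∀ x : R, x ^ p ∈ R₀) {x : S} (hx : IsUnit (x : R)) :
    IsUnit x := by
  obtain ⟨y, hy⟩ := hx.exists_right_inv
  refine IsUnit.of_mul_eq_one (x ^ (p - 1) * algebraMap R₀ S ⟨y ^ p, hR y⟩) (Subtype.ext ?_)
  change (x : R) * (x ^ (p - 1) * y ^ p) = 1
  rw [← mul_assoc, ← pow_succ', Nat.sub_add_cancel hp, ← mul_pow, hy, one_pow]

theorem isLocalHom_of_pow_mem (hp : 0 < p) (hR : ∀ x : R, x ^ p ∈ R₀) :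
    IsLocalHom S.val.toRingHom :=
  ⟨fun _ hx => isUnit_of_pow_mem hp hR hx⟩

/-- Every subring of a henselian local ring which contains the `p`-th powers is henselian. -/
theorem henselianLocalRing_of_pow_mem [HenselianLocalRing R] (hp : 0 < p)
    (hR : ∀ x : R, x ^ p ∈ R₀) : HenselianLocalRing S := by
  have hloc := isLocalHom_of_pow_mem (S := S) hp hR
  have : IsLocalRing S := RingHom.domain_isLocalRing S.val.toRingHom
  have hnon : ∀ x : S, x ∈ maximalIdeal S ↔ (x : R) ∈ maximalIdeal R := fun x => by
    rw [IsLocalRing.mem_maximalIdeal, IsLocalRing.mem_maximalIdeal, mem_nonunits_iff,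
      mem_nonunits_iff]
    exact not_congr ⟨fun h => h.map S.val, isUnit_of_pow_mem hp hR⟩
  refine ⟨fun f hf a₀ h0 h1 => ?_⟩
  obtain ⟨a, ha, haa⟩ := HenselianLocalRing.is_henselian (f.map S.val.toRingHom) (hf.map _) (a₀ : R)
    (by
      rw [show (a₀ : R) = S.val.toRingHom a₀ from rfl, Polynomial.eval_map_apply]
      exact (hnon _).1 h0)
    (by
      rw [show (a₀ : R) = S.val.toRingHom a₀ from rfl, Polynomial.derivative_map,
        Polynomial.eval_map_apply]
      exact h1.map _)
  suffices h : a - a₀ ∈ S by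
    have haS : a ∈ S := by simpa using add_mem h a₀.2
    refine ⟨⟨a, haS⟩, ?_, (hnon _).2 haa⟩
    refine Subtype.ext ?_
    have := ha.eq_zero
    rw [show a = S.val.toRingHom ⟨a, haS⟩ from rfl, Polynomial.eval_map_apply] at this
    exact this
  set b := a - a₀ with hb
  -- The root exists in `R`; it must be shown to lie in `S`. Taylor expansion gives `f(a₀) + b v =
  -- 0` with `v = f'(a₀) + b l(b)` a unit of `R`, whose inverse lies in `S[b]`; so `b` is `f(a₀)`
  -- times an element of `S[b]`.
  let g := Polynomial.taylor a₀ f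
  have hgb : Polynomial.aeval b g = 0 := by
    rw [show g = f.comp (Polynomial.X + Polynomial.C a₀) from Polynomial.taylor_apply _ _, Polynomial.aeval_comp, map_add, Polynomial.aeval_X,
      Polynomial.aeval_C, show b + algebraMap S R a₀ = a from sub_add_cancel a _]
    exact (Polynomial.eval_map_algebraMap f a).symm.trans ha.eq_zero
  obtain ⟨l, hl⟩ : ∃ l : Polynomial S, g = Polynomial.C (f.eval a₀) + Polynomial.X *
      (Polynomial.C ((Polynomial.derivative f).eval a₀) + Polynomial.X * l) := by
    refine ⟨g.divX.divX, ?_⟩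
    rw [← Polynomial.taylor_coeff_one, ← Polynomial.taylor_coeff_zero,
      show (Polynomial.taylor a₀ f).coeff 1 = g.divX.coeff 0 from (Polynomial.coeff_divX).symm,
      add_comm (Polynomial.C (g.divX.coeff 0)), mul_comm Polynomial.X g.divX.divX,
      Polynomial.divX_mul_X_add, add_comm, mul_comm]
    exact (Polynomial.divX_mul_X_add g).symm
  let M := Algebra.adjoin S {b}
  have hbM : b ∈ M := Algebra.self_mem_adjoin_singleton S b
  let v := algebraMap S R ((Polynomial.derivative f).eval a₀) + b * Polynomial.aeval b l
  have hvM : v ∈ M := add_mem (Subalgebra.algebraMap_mem _ _) (mul_mem hbM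
    (Polynomial.aeval_mem_adjoin_singleton _ _))
  have hbv : b * v = - algebraMap S R (f.eval a₀) := by
    rw [hl] at hgb
    simp only [map_add, map_mul, Polynomial.aeval_C, Polynomial.aeval_X] at hgb
    exact (neg_eq_of_add_eq_zero_right hgb).symm
  have hv : IsUnit v := by
    refine IsLocalRing.notMem_maximalIdeal.1 fun hv => ?_
    have h2 : algebraMap S R ((Polynomial.derivative f).eval a₀) ∈ maximalIdeal R := by
      have := sub_mem hv (Ideal.mul_mem_right (Polynomial.aeval b l) _ haa)
      rwa [add_sub_cancel_right] at this
    exact (IsLocalRing.mem_maximalIdeal _).1 h2 (h1.map _)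
  obtain ⟨w, hw⟩ := hv.exists_right_inv
  have hwM : w ∈ M := by
    have h3 : w = v ^ (p - 1) * algebraMap S R (algebraMap R₀ S ⟨w ^ p, hR w⟩) := by
      change w = v ^ (p - 1) * w ^ p
      rw [show w ^ p = w ^ (p - 1) * w by rw [← pow_succ, Nat.sub_add_cancel hp], ← mul_assoc,
        ← mul_pow, hw, one_pow, one_mul]
    rw [h3]
    exact mul_mem (pow_mem hvM _) (Subalgebra.algebraMap_mem _ _)
  have hbm : b = (-f.eval a₀) • w := by
    rw [Algebra.smul_def, map_neg, ← hbv, mul_assoc, hw, mul_one]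
  have hint : IsIntegral S b := by
    refine IsIntegral.of_pow hp ?_
    exact isIntegral_algebraMap (R := S) (A := R) (x := algebraMap R₀ S ⟨b ^ p, hR b⟩)
  -- `S[b]` is finite over `S` because `b^p` lies in `S`, and it is contained in `S + 𝔪 S[b]`;
  -- Nakayama gives `S[b] = S`.
  have hM : Subalgebra.toSubmodule M ≤ Subalgebra.toSubmodule (⊥ : Subalgebra S R) := by
    refine Submodule.le_of_le_smul_of_le_jacobson_bot (I := maximalIdeal S)
      hint.fg_adjoin_singleton (IsLocalRing.maximalIdeal_le_jacobson _) ?_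
    intro x hx
    change x ∈ Algebra.adjoin S {b} at hx
    rw [Algebra.adjoin_singleton_eq_range_aeval] at hx
    obtain ⟨h, rfl⟩ : ∃ h, Polynomial.aeval b h = x := hx
    rw [← Polynomial.divX_mul_X_add h, map_add, map_mul, Polynomial.aeval_X, Polynomial.aeval_C,
      add_comm]
    refine Submodule.add_mem_sup (Subalgebra.algebraMap_mem _ _) ?_
    rw [hbm, mul_smul_comm]
    have h4 : Polynomial.aeval b h.divX ∈ M := Polynomial.aeval_mem_adjoin_singleton _ _
    rw [hbm] at h4
    exact Submodule.smul_mem_smul (neg_mem h0) (show _ ∈ M from mul_mem h4 hwM)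
  obtain ⟨c, hc⟩ := Algebra.mem_bot.1 (hM hbM)
  rw [← hc]
  exact c.2

end FrobeniusFinite

/-- As `S` is henselian, `φ` extends to a map `R → S`; followed by the inclusion it is the identity
of `R` by uniqueness, so the inclusion is onto. -/
theorem IsHenselization.eq_top_of_range_le {A R : Type u} [CommRing A] [IsLocalRing A] [CommRing R]
    {φ : A →+* R} (hφ : IsHenselization φ) {p : ℕ} (hp : 0 < p) {R₀ : Subring R}
    (hR : ∀ x : R, x ^ p ∈ R₀) {S : Subalgebra R₀ R} (hS : ∀ a, φ a ∈ S) : S = ⊤ := by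
  have := hφ.henselian
  have := hφ.isLocalHom
  have := isLocalHom_of_pow_mem (S := S) hp hR
  have := henselianLocalRing_of_pow_mem (S := S) hp hR
  let g : A →+* S := φ.codRestrict S.toSubring hS
  have hcomp : S.val.toRingHom.comp g = φ := rfl
  have hg : IsLocalHom g := ⟨fun a ha => hφ.isLocalHom.map_nonunit a (ha.map S.val.toRingHom)⟩
  obtain ⟨h, ⟨hh, hhg⟩, -⟩ := hφ.existsUnique_lift S g hg
  have huniq := (hφ.existsUnique_lift R φ hφ.isLocalHom).unique
    (y₁ := S.val.toRingHom.comp h) (y₂ := RingHom.id R)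
    ⟨RingHom.isLocalHom_comp _ _, by rw [RingHom.comp_assoc, hhg, hcomp]⟩
    ⟨isLocalHom_id R, RingHom.id_comp _⟩
  refine eq_top_iff.2 fun x _ => ?_
  have := RingHom.congr_fun huniq x
  change ((h x : S) : R) = x at this
  exact this ▸ (h x).2

/-- Adjoin to `R^p` the images of finitely many algebra generators of `A`. The result is finite over
`R^p` and contains the image of the localization: constants are `p`-th powers since `k` is perfect,
and denominators invert as in `isUnit_of_pow_mem`. Hence it is all of `R`. -/
theorem IsHenselization.finite_frobenius {k A R : Type u} [Field k] [PerfectField k] [CommRing A]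
    [Algebra k A] [Algebra.FiniteType k A] [CommRing R] [Algebra k R] {P : Ideal A} [P.IsPrime]
    {φ : Localization.AtPrime P →ₐ[k] R} (hφ : IsHenselization φ.toRingHom) (p : ℕ) [Fact p.Prime]
    [CharP R p] : (frobenius R p).Finite := by
  have hp : 0 < p := (Fact.out : p.Prime).pos
  have := hφ.henselian
  have : CharP k p := (RingHom.charP_iff (algebraMap k R) (algebraMap k R).injective p).2 inferInstance
  have : PerfectRing k p := PerfectField.toPerfectRing p
  obtain ⟨s, hs⟩ := (inferInstance : Algebra.FiniteType k A).out
  let ψ : A →ₐ[k] R := φ.comp (IsScalarTower.toAlgHom k A (Localization.AtPrime P))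
  let R₀ : Subring R := (frobenius R p).range
  have hR : ∀ x : R, x ^ p ∈ R₀ := fun x => ⟨x, rfl⟩
  let S : Subalgebra R₀ R := Algebra.adjoin R₀ (ψ '' s)
  have hfin : Module.Finite R₀ S := Algebra.finite_adjoin_of_finite_of_isIntegral
    (s.finite_toSet.image _) fun x _ => by
      refine IsIntegral.of_pow hp ?_
      exact isIntegral_algebraMap (R := R₀) (A := R) (x := ⟨x ^ p, hR x⟩)
  have hpow : ∀ x : R, x ^ p ∈ S := fun x => S.algebraMap_mem ⟨x ^ p, hR x⟩
  have hψ : ∀ a, ψ a ∈ S := fun a => by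
    have ha : a ∈ Algebra.adjoin k (s : Set A) := by rw [hs]; trivial
    induction ha using Algebra.adjoin_induction with
    | mem x hx => exact Algebra.subset_adjoin ⟨x, hx, rfl⟩
    | algebraMap c =>
      obtain ⟨d, rfl⟩ := surjective_frobenius k p c
      rw [AlgHom.commutes, frobenius_def, map_pow]
      exact hpow _
    | add x y _ _ hx hy => rw [map_add]; exact add_mem hx hy
    | mul x y _ _ hx hy => rw [map_mul]; exact mul_mem hx hy
  have hφS : ∀ x, φ.toRingHom x ∈ S := fun x => by
    obtain ⟨a, b, rfl⟩ := IsLocalization.exists_mk'_eq P.primeCompl x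
    have hb : IsUnit (ψ b) := (IsLocalization.map_units (Localization.AtPrime P) b).map φ
    obtain ⟨y, hy⟩ := hb.exists_right_inv
    have h1 : φ (IsLocalization.mk' (Localization.AtPrime P) a b) * ψ b = ψ a := by
      change φ _ * φ _ = φ _
      rw [← map_mul]
      congr 1
      exact IsLocalization.mk'_spec _ a b
    have h2 : φ (IsLocalization.mk' (Localization.AtPrime P) a b) = ψ a * (ψ b ^ (p - 1) * y ^ p) := by
      rw [← h1, mul_assoc, ← mul_assoc (ψ b), ← pow_succ', Nat.sub_add_cancel hp, ← mul_pow, hy,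
        one_pow, mul_one]
    change φ _ ∈ S
    rw [h2]
    exact mul_mem (hψ a) (mul_mem (pow_mem (hψ b) _) (hpow y))
  have htop := hφ.eq_top_of_range_le hp hR hφS
  have h3 : Module.Finite R₀ R := by
    rw [htop] at hfin
    exact Module.Finite.equiv Subalgebra.topEquiv.toLinearEquiv
  have h4 : (R₀.subtype).Finite := RingHom.finite_algebraMap.2 h3
  exact h4.comp (RingHom.Finite.of_surjective (frobenius R p).rangeRestrict
    (frobenius R p).rangeRestrict_surjective)

theorem IsGeometricHenselianDVF.isHenselDVF {k F : Type u} [Field k] [PerfectField k] [Field F]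
    [Algebra k F] {O : Subalgebra k F} (h : IsGeometricHenselianDVF k O) : IsHenselDVF k O := by
  have := h.isFractionRing
  have := h.isDiscreteValuationRing
  obtain ⟨A, _, _, P, _, φ, hA, -, hφ⟩ := h.exists_smooth
  have := hφ.henselian
  exact ⟨h.isFractionRing, h.isDiscreteValuationRing,
    fun E _ _ _ => HenselianLocalRing.isLocalRing_integralClosure O F E,
    fun p _ _ => hφ.finite_frobenius p⟩

/-! ### Uniqueness and composition of separable traces; restriction of forms. -/

section SeparableTrace

variable {k F E : Type u} [Field k] [Field F] [Algebra k F] [Field E] [Algebra k E]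
  [Algebra F E] [IsScalarTower k F E]

theorem span_range_kaehlerDifferential_map_eq_top [Algebra.IsSeparable F E] :
    Submodule.span E (KaehlerDifferential.map k k F E '' (⊤ : Submodule F Ω[F⁄k])) = ⊤ := by
  have : Algebra.FormallyEtale F E := Algebra.FormallyEtale.of_isSeparable F E
  refine eq_top_iff.2 fun w _ => ?_
  obtain ⟨x, rfl⟩ := (KaehlerDifferential.tensorKaehlerEquivOfFormallyEtale k F E).surjective w
  clear * -
  induction x using TensorProduct.induction_on with
  | zero => rw [map_zero]; exact zero_mem _
  | add x y hx hy => rw [map_add]; exact add_mem hx hy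
  | tmul b v =>
    have : KaehlerDifferential.tensorKaehlerEquivOfFormallyEtale k F E (b ⊗ₜ v) =
        b • KaehlerDifferential.map k k F E v := KaehlerDifferential.mapBaseChange_tmul k F E b v
    rw [this]
    exact Submodule.smul_mem _ _ (Submodule.subset_span ⟨v, trivial, rfl⟩)

/-- Forms on a separable extension are sums of products of functions and forms on the base. -/
theorem addMonoidHom_ext_of_isSeparable [Algebra.IsSeparable F E] {G : Type*} [AddCommGroup G]
    {q : ℕ} {T T' : Forms k E q →+ G}
    (h : ∀ (b : E) (ω : Forms k F q), T (b • formsMap k F E q ω) = T' (b • formsMap k F E q ω)) : T = T' := by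
  refine AddMonoidHom.ext fun x => ?_
  have hx : x ∈ Submodule.span E (formsMap k F E q ''
      {ω | ω ∈ wedgePow (L := F) (⊤ : Submodule F Ω[F⁄k]) q}) := by
    refine wedgePow_span_le (KaehlerDifferential.map k k F E) ⊤ q ?_
    rw [span_range_kaehlerDifferential_map_eq_top]
    have h1 := exteriorPower.ιMulti_span E q Ω[E⁄k]
    have h2 : x ∈ Submodule.span E (Set.range (exteriorPower.ιMulti E q (M := Ω[E⁄k]))) := by
      rw [h1]; trivial
    refine Submodule.span_le.2 ?_ h2
    rintro _ ⟨v, rfl⟩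
    exact ιMulti_mem_wedgePow q v fun _ => trivial
  suffices ∀ c : E, T (c • x) = T' (c • x) by simpa using this 1
  induction hx using Submodule.span_induction with
  | zero => intro c; rw [smul_zero, map_zero, map_zero]
  | add a b _ _ ha hb => intro c; rw [smul_add, map_add, map_add, ha, hb]
  | smul d a _ ha => intro c; rw [smul_smul]; exact ha (c * d)
  | mem a ha =>
    obtain ⟨ω, hω, rfl⟩ := ha
    exact fun c => h c ω

theorem IsSeparableFormTrace.unique [Algebra.IsSeparable F E]
    {T T' : ∀ q, Forms k E q →+ Forms k F q} (hT : IsSeparableFormTrace k F E T)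
    (hT' : IsSeparableFormTrace k F E T') : T = T' :=
  funext fun q => addMonoidHom_ext_of_isSeparable fun b ω => by rw [hT, hT']

variable {K : Type u} [Field K] [Algebra k K] [Algebra F K] [Algebra E K] [IsScalarTower F E K]
  [IsScalarTower k F K] [IsScalarTower k E K]

theorem kaehlerDifferential_map_map (w : Ω[F⁄k]) :
    KaehlerDifferential.map k k E K (KaehlerDifferential.map k k F E w) =
      KaehlerDifferential.map k k F K w := by
  have hw : w ∈ Submodule.span F (Set.range (KaehlerDifferential.D k F)) := by
    rw [KaehlerDifferential.span_range_derivation]; trivial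
  induction hw using Submodule.span_induction with
  | mem w hw =>
    obtain ⟨x, rfl⟩ := hw
    rw [KaehlerDifferential.map_D, KaehlerDifferential.map_D, KaehlerDifferential.map_D,
      ← IsScalarTower.algebraMap_apply]
  | zero => rw [map_zero, map_zero, map_zero]
  | add x y _ _ hx hy => rw [map_add, map_add, map_add, hx, hy]
  | smul c x _ hx =>
    rw [map_smul (KaehlerDifferential.map k k F E), map_smul (KaehlerDifferential.map k k F K),
      ← algebraMap_smul E c (KaehlerDifferential.map k k F E x), map_smul, hx, algebraMap_smul]

theorem formsMap_formsMap (q : ℕ) (ω : Forms k F q) :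
    formsMap k E K q (formsMap k F E q ω) = formsMap k F K q ω := by
  have : ((formsMap k E K q).restrictScalars F).comp (formsMap k F E q) = formsMap k F K q := by
    apply exteriorPower.linearMap_ext
    ext v
    simp only [LinearMap.compAlternatingMap_apply, LinearMap.comp_apply, formsMap,
      exteriorPowerMapAlong_ιMulti, LinearMap.restrictScalars_apply, kaehlerDifferential_map_map]
  exact LinearMap.congr_fun this ω

theorem formsMap_smul_formsMap (q : ℕ) (b : E) (ω : Forms k F q) :
    formsMap k E K q (b • formsMap k F E q ω) = algebraMap E K b • formsMap k F K q ω := by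
  rw [map_smul, formsMap_formsMap, algebraMap_smul]

theorem IsSeparableFormTrace.comp [FiniteDimensional F E] [FiniteDimensional E K]
    {T : ∀ q, Forms k E q →+ Forms k F q} (hT : IsSeparableFormTrace k F E T)
    {S : ∀ q, Forms k K q →+ Forms k E q} (hS : IsSeparableFormTrace k E K S) :
    IsSeparableFormTrace k F K fun q => (T q).comp (S q) := fun q b ω => by
  rw [← formsMap_formsMap (E := E), AddMonoidHom.comp_apply, hS, hT, Algebra.trace_trace]

/-- Up to the degree, the trace from `E` is the trace from `K ⊇ E` of the restriction to `K`. -/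
theorem IsSeparableFormTrace.finrank_nsmul [FiniteDimensional F E] [FiniteDimensional E K]
    [Algebra.IsSeparable F E]
    {T : ∀ q, Forms k E q →+ Forms k F q} (hT : IsSeparableFormTrace k F E T)
    {S : ∀ q, Forms k K q →+ Forms k F q} (hS : IsSeparableFormTrace k F K S) (q : ℕ)
    (x : Forms k E q) : Module.finrank E K • T q x = S q (formsMap k E K q x) := by
  have : Module.finrank E K • T q = (S q).comp (formsMap k E K q).toAddMonoidHom :=
    addMonoidHom_ext_of_isSeparable fun b ω => by
      rw [AddMonoidHom.smul_apply, AddMonoidHom.comp_apply, hT]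
      change _ = S q (formsMap k E K q (b • formsMap k F E q ω))
      rw [formsMap_smul_formsMap, hS, ← Algebra.trace_trace (S := E) (T := K), Algebra.trace_algebraMap,
        map_nsmul, smul_assoc]
  exact DFunLike.congr_fun this x

variable {O : Subalgebra k F} {B : Subalgebra k E} {t : F} {s : E} {e : ℕ}

/-- From `r > ⌈r⌉ - 1`: the pole of `t^(-⌈r⌉+1)`, of order `e (⌈r⌉ - 1)` upstairs, is within the
order `⌈r e⌉ - 1` allowed there. -/
theorem IsTracePair.ceil_le {r : ℚ≥0} (hr : r ≠ 0) (he : 0 < e) :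
    e * (⌈r⌉₊ - 1) + 1 ≤ ⌈r * e⌉₊ := by
  have h0 : 0 < ⌈r⌉₊ := Nat.ceil_pos.2 (pos_iff_ne_zero.2 hr)
  rw [Nat.succ_le_iff, Nat.lt_ceil, Nat.cast_mul, mul_comm]
  refine mul_lt_mul_of_pos_right ?_ (by exact_mod_cast he)
  rw [← Nat.lt_ceil]
  omega

/-- Restriction of forms to an extension is compatible with the logarithmic filtrations. -/
theorem IsTracePair.formsMap_mem_logFiltration (h : IsTracePair O B t s e)
    [IsDiscreteValuationRing O] [IsDiscreteValuationRing B]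
    (ht : Irreducible (⟨t, h.t_mem⟩ : O)) (hs : Irreducible (⟨s, h.s_mem⟩ : B)) (q : ℕ) (r : ℚ≥0)
    {x : Forms k F q} (hx : x ∈ logFiltration k q F O r) :
    formsMap k F E q x ∈ logFiltration k q E B (r * e) := by
  have hR : ∀ a : O, ∃ b : B, algebraMap F E (algebraMap O F a) = algebraMap B E b :=
    fun a => ⟨⟨_, h.algebraMap_mem a a.2⟩, rfl⟩
  have hdiff : ∀ w ∈ diffSpan O, KaehlerDifferential.map k k F E w ∈ diffSpan B := fun w hw => by
    induction hw using Submodule.span_induction with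
    | mem w hw =>
      obtain ⟨a, rfl⟩ := hw
      rw [KaehlerDifferential.map_D]
      exact D_mem_diffSpan B (h.algebraMap_mem a a.2)
    | zero => rw [map_zero]; exact zero_mem _
    | add x y _ _ hx hy => rw [map_add]; exact add_mem hx hy
    | smul a x _ hx =>
      rw [show a • x = (a : F) • x from rfl, map_smul, ← algebraMap_smul E (a : F)]
      exact smul_mem_of_mem _ (h.algebraMap_mem a a.2) hx
  rcases eq_or_ne r 0 with rfl | hr
  · rw [zero_mul, mem_logFiltration_zero]
    exact exteriorPowerMapAlong_mem_wedgePow _ _ _ hR hdiff q ((mem_logFiltration_zero q O x).1 hx)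
  · have he : (e : ℚ≥0) ≠ 0 := by exact_mod_cast h.e_pos.ne'
    rw [logFiltration_eq_scaledForms q B ⟨s, h.s_mem⟩ hs (mul_ne_zero hr he)]
    rw [logFiltration_eq_scaledForms q O ⟨t, h.t_mem⟩ ht hr] at hx
    obtain ⟨ω, hω, rfl⟩ := hx
    have hlog : ∀ w ∈ logDiffSpan O t, KaehlerDifferential.map k k F E w ∈ logDiffSpan B s :=
        fun w hw => by
      obtain ⟨w₁, hw₁, w₂, hw₂, rfl⟩ := Submodule.mem_sup.1 hw
      obtain ⟨a, rfl⟩ := Submodule.mem_span_singleton.1 hw₂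
      rw [map_add]
      refine add_mem (Submodule.mem_sup_left (hdiff _ hw₁)) ?_
      rw [show a • dlog k t = (a : F) • dlog k t from rfl, map_smul, ← algebraMap_smul E (a : F)]
      refine smul_mem_of_mem _ (h.algebraMap_mem a a.2) ?_
      obtain ⟨u, hu, hu', hu0, h1⟩ := h.exists_dlog_eq
      rw [eq_sub_iff_add_eq] at h1
      rw [← h1]
      refine add_mem (Submodule.mem_sup_right ?_) (Submodule.mem_sup_left
        (smul_mem_of_mem _ hu' (D_mem_diffSpan B hu)))
      exact smul_mem_of_mem _ (natCast_mem B e) (Submodule.mem_span_singleton_self _)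
    have hω' := exteriorPowerMapAlong_mem_wedgePow (L' := E) _ _ _ hR hlog q hω
    obtain ⟨u, hu, hu', hu0, h1⟩ := h.unit
    obtain ⟨j, hj⟩ := Nat.le.dest (IsTracePair.ceil_le hr h.e_pos)
    have hc : 0 < ⌈r⌉₊ := Nat.ceil_pos.2 (pos_iff_ne_zero.2 hr)
    have hs0 := h.s_ne
    change formsMap k F E q (t ^ (-(⌈r⌉₊ : ℤ) + 1) • ω) ∈ _
    obtain ⟨M, hM⟩ : ∃ M, ⌈r⌉₊ = M + 1 := Nat.exists_eq_succ_of_ne_zero hc.ne'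
    rw [map_smul, ← algebraMap_smul E, map_zpow₀, h1, ← hj, hM, Nat.add_sub_cancel]
    have h2 : (u * s ^ e) ^ (-((M + 1 : ℕ) : ℤ) + 1) =
        s ^ (-((e * M + 1 + j : ℕ) : ℤ) + 1) * (u⁻¹ ^ M * s ^ j) := by
      rw [show -((M + 1 : ℕ) : ℤ) + 1 = -(M : ℤ) by push_cast; ring,
        show -((e * M + 1 + j : ℕ) : ℤ) + 1 = -((e * M + j : ℕ) : ℤ) by push_cast; ring,
        zpow_neg, zpow_neg, zpow_natCast, zpow_natCast, mul_pow, ← pow_mul, pow_add, inv_pow]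
      field_simp
    rw [h2]
    exact smul_mul_mem_scaledForms _ (mul_mem (pow_mem hu' _) (pow_mem h.s_mem _)) hω'

theorem smul_mem_logFiltration (O : Subalgebra k F) [IsDiscreteValuationRing O] (q : ℕ) (r : ℚ≥0)
    {a : F} (ha : a ∈ O) {x : Forms k F q} (hx : x ∈ logFiltration k q F O r) :
    a • x ∈ logFiltration k q F O r := by
  have key : ∀ (d : F) (W : Submodule O Ω[F⁄k]), ∀ x ∈ scaledForms d W q,
      a • x ∈ scaledForms d W q := by
    rintro d W _ ⟨ω, hω, rfl⟩
    change a • d • ω ∈ _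
    rw [smul_smul, mul_comm]
    exact smul_mul_mem_scaledForms d ha hω
  obtain ⟨t, ht⟩ := IsDiscreteValuationRing.exists_irreducible O
  rcases eq_or_ne r 0 with rfl | hr
  · rw [logFiltration_zero_eq] at hx ⊢
    exact key _ _ _ hx
  · rw [logFiltration_eq_scaledForms q O t ht hr] at hx ⊢
    exact key _ _ _ hx

theorem Subalgebra.eq_of_mul_pow_eq_mul_pow [IsDiscreteValuationRing O] {s s' u u' : F} (hs : s ∈ O)
    (hs' : s' ∈ O) (hsi : Irreducible (⟨s, hs⟩ : O)) (hsi' : Irreducible (⟨s', hs'⟩ : O))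
    (hu : u ∈ O) (hu0 : u ≠ 0) (hui : u⁻¹ ∈ O) (hu' : u' ∈ O) (hu0' : u' ≠ 0) (hui' : u'⁻¹ ∈ O)
    {m n : ℕ} (h : u * s ^ m = u' * s' ^ n) : m = n := by
  let v : Oˣ := ⟨⟨u, hu⟩, ⟨u⁻¹, hui⟩, Subtype.ext (mul_inv_cancel₀ hu0),
    Subtype.ext (inv_mul_cancel₀ hu0)⟩
  let v' : Oˣ := ⟨⟨u', hu'⟩, ⟨u'⁻¹, hui'⟩, Subtype.ext (mul_inv_cancel₀ hu0'),
    Subtype.ext (inv_mul_cancel₀ hu0')⟩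
  exact IsDiscreteValuationRing.unit_mul_pow_congr_pow hsi hsi' v v' m n (Subtype.ext h)

theorem Subalgebra.inv_mem_of_isUnit {u : O} (hu : IsUnit u) : (u : F) ≠ 0 ∧ (u : F)⁻¹ ∈ O := by
  obtain ⟨v, hv⟩ := hu.exists_right_inv
  have h1 : (u : F) * v = 1 := congrArg Subtype.val hv
  exact ⟨left_ne_zero_of_mul_eq_one h1, inv_eq_of_mul_eq_one_right h1 ▸ v.2⟩

end SeparableTrace

/-- The traces of the separable extension `E` of `F ⊇ O` are compatible with the logarithmic
filtrations. -/
def HasSeparableTraceBound {k F : Type u} [Field k] [Field F] [Algebra k F] (O : Subalgebra k F)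
    (E : Type u) [Field E] [Algebra k E] [Algebra F E] [IsScalarTower k F E] : Prop :=
  ∀ T : ∀ q, Forms k E q →+ Forms k F q, IsSeparableFormTrace k F E T →
    HasTraceBound O (extensionRing O E) T

/-! ### Towers, and descent along extensions of invertible degree. -/

section Devissage

variable {k F E : Type u} [Field k] [Field F] [Algebra k F] [Field E] [Algebra k E]
  [Algebra F E] [IsScalarTower k F E] [FiniteDimensional F E] [Algebra.IsSeparable F E]
  {K : Type u} [Field K] [Algebra k K] [Algebra F K] [Algebra E K] [IsScalarTower F E K]
  [IsScalarTower k F K] [IsScalarTower k E K] [FiniteDimensional E K] [Algebra.IsSeparable E K]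
  {O : Subalgebra k F}

theorem IsHenselDVF.extensionRing_of_isSeparable (h : IsHenselDVF k O) :
    IsHenselDVF k (extensionRing O E) :=
  have := h.finite_integralClosure_of_isSeparable E
  h.isHenselDVF_extensionRing

/-- The given trace is the composite of traces of the two steps, by their existence and the
uniqueness of separable traces. -/
theorem HasSeparableTraceBound.trans (h : IsHenselDVF k O)
    (h1 : HasSeparableTraceBound O E) (h2 : HasSeparableTraceBound (extensionRing O E) K) :
    HasSeparableTraceBound O K := by
  intro T hT
  have : Algebra.IsSeparable F K := Algebra.IsSeparable.trans F E K
  obtain ⟨T₁, hT₁⟩ := exists_separable k F E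
  obtain ⟨T₂, hT₂⟩ := exists_separable k E K
  rw [hT.unique (hT₁.comp hT₂)]
  have := (h.extensionRing_of_isSeparable (E := E)).isDiscreteValuationRing
  have h3 := h2 T₂ hT₂
  rw [IsHenselDVF.extensionRing_extensionRing] at h3
  exact (h1 T₁ hT₁).comp (fun b hb => by
    exact IsIntegral.algebraMap hb) h3

theorem HasSeparableTraceBound.of_finrank_ne_zero (h : IsHenselDVF k O)
    (hn : (Module.finrank F E : k) ≠ 0) : HasSeparableTraceBound O E := fun _ hT =>
  have := h.finite_integralClosure_of_isSeparable E
  h.hasTraceBound_of_finrank_ne_zero hn hT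

theorem HasSeparableTraceBound.of_finrank_prime (h : IsHenselDVF k O)
    (hp : (Module.finrank F E).Prime) : HasSeparableTraceBound O E := fun _ hT =>
  have := h.finite_integralClosure_of_isSeparable E
  h.hasTraceBound_of_finrank_prime hp fun _ hx hgen hO hB =>
    isMonogenicTrace_of_isSeparable hT hx hgen hO hB

/-- Restriction to `K` multiplies the index by `f` and the trace from `K` divides it by `e f`, which
leaves `r / e`. The composite is `[K : E]` times the trace from `E`, and this degree is a unit of
`O`. -/
theorem HasSeparableTraceBound.of_extension (h : IsHenselDVF k O)
    (hn : (Module.finrank E K : k) ≠ 0) (hK : HasSeparableTraceBound O K) :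
    HasSeparableTraceBound O E := by
  intro T hT
  have : Algebra.IsSeparable F K := Algebra.IsSeparable.trans F E K
  have : FiniteDimensional F K := FiniteDimensional.trans F E K
  obtain ⟨S, hS⟩ := exists_separable k F K
  obtain ⟨e₀, he₀, ⟨t', σ', u', ht', hσ', hu', h0⟩, hbound⟩ := hK S hS
  have hO := h.isDiscreteValuationRing
  have hB := h.extensionRing_of_isSeparable (E := E)
  have hBd := hB.isDiscreteValuationRing
  have hCd := (h.extensionRing_of_isSeparable (E := K)).isDiscreteValuationRing
  have hf1 := h.finite_integralClosure_of_isSeparable E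
  have hf2 := hB.finite_integralClosure_of_isSeparable K
  obtain ⟨s, e, he, hs, hassoc⟩ := h.exists_associated_pow (E := E) ht'
  have hp1 := h.isTracePair he ht' hs hassoc
  obtain ⟨σ, f, hf, hσ, hassoc'⟩ := hB.exists_associated_pow (E := K) (t := s) hs
  have hp2 := hB.isTracePair hf (t := s) hs hσ hassoc'
  have hσi : ∀ (C : Subalgebra k K) (_ : C = extensionRing (extensionRing O E) K)
      (hm : (σ : K) ∈ C), Irreducible (⟨σ, hm⟩ : C) := by
    rintro _ rfl _
    exact hσ
  have hCeq := IsHenselDVF.extensionRing_extensionRing (E := E) O K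
  rw [hCeq] at hp2
  have hσC := hσi _ hCeq.symm hp2.s_mem
  obtain ⟨u, hu, hui, hu0, h1⟩ := hp1.unit
  obtain ⟨v, hv, hvi, hv0, h2⟩ := hp2.unit
  -- The index in the bound for `K` belongs to another choice of uniformizer; both expressions for
  -- `t'` have the same valuation.
  have hef : f * e = e₀ := by
    obtain ⟨hu0', hui'⟩ := Subalgebra.inv_mem_of_isUnit hu'
    refine Subalgebra.eq_of_mul_pow_eq_mul_pow (u := algebraMap E K u * v ^ e) hp2.s_mem σ'.2 hσC
      hσ' (mul_mem (hp2.algebraMap_mem u hu) (pow_mem hv _))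
      (mul_ne_zero ((map_ne_zero _).2 hu0) (pow_ne_zero _ hv0)) ?_ u'.2 hu0' hui' ?_
    · rw [mul_inv, ← map_inv₀, ← inv_pow]
      exact mul_mem (hp2.algebraMap_mem _ hui) (pow_mem hvi _)
    · rw [← h0, IsScalarTower.algebraMap_apply F E K, h1, map_mul, map_pow, h2, mul_pow, mul_assoc,
        ← pow_mul]
  refine ⟨e, he, ⟨t', s, ⟨u, hu⟩, ht', hs, ?_, h1⟩, ?_⟩
  · exact IsUnit.of_mul_eq_one ⟨u⁻¹, hui⟩ (Subtype.ext (mul_inv_cancel₀ hu0))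
  rintro q r _ ⟨x, hx, rfl⟩
  have hxK := hp2.formsMap_mem_logFiltration hs hσC q r hx
  have h3 := hbound q _ ⟨_, hxK, rfl⟩
  change S q (formsMap k E K q x) ∈ _ at h3
  rw [← hT.finrank_nsmul hS, ← hef, Nat.cast_mul, mul_comm r, mul_div_mul_left _ _
    (by exact_mod_cast hf.ne')] at h3
  have hnF : (Module.finrank E K : F) ≠ 0 := by
    rw [← map_natCast (algebraMap k F)]
    exact (map_ne_zero _).2 hn
  have hnO : (Module.finrank E K : F)⁻¹ ∈ O := by
    rw [← map_natCast (algebraMap k F), ← map_inv₀]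
    exact O.algebraMap_mem _
  have h4 := smul_mem_logFiltration O q _ hnO h3
  rw [← Nat.cast_smul_eq_nsmul F, smul_smul, inv_mul_cancel₀ hnF, one_smul] at h4
  exact h4

end Devissage

/-! ### Reduction of separable extensions by Sylow theory. -/

section GaloisDevissage

open IntermediateField

theorem exists_ringHom_of_le_fieldRange {F E N : Type*} [Field F] [Field E] [Field N] [Algebra F E]
    [Algebra F N] [Algebra E N] [IsScalarTower F E N] (K : IntermediateField F N)
    (h : K ≤ (IsScalarTower.toAlgHom F E N).fieldRange) :
    ∃ g : K →+* E, ∀ x, algebraMap E N (g x) = x := by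
  have h1 : ∀ x : K, ∃ y : E, algebraMap E N y = x := fun x => h x.2
  choose g hg using h1
  have hinj := (algebraMap E N).injective
  exact ⟨{ toFun := g
           map_one' := hinj (by rw [hg, map_one]; rfl)
           map_zero' := hinj (by rw [hg, map_zero]; rfl)
           map_mul' := fun x y => hinj (by rw [hg, map_mul, hg, hg]; rfl)
           map_add' := fun x y => hinj (by rw [hg, map_add, hg, hg]; rfl) }, hg⟩

theorem finrank_fieldRange_eq {F E N : Type*} [Field F] [Field E] [Field N] [Algebra F E]
    [Algebra F N] [Algebra E N] [IsScalarTower F E N] :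
    Module.finrank F (IsScalarTower.toAlgHom F E N).fieldRange = Module.finrank F E :=
  (LinearEquiv.finrank_eq (AlgEquiv.ofInjectiveField
    (IsScalarTower.toAlgHom F E N)).toLinearEquiv).symm

/-- In a `p`-group, a proper subgroup lies in one of index `p`. So a nontrivial `E` contains an
extension `K` of `F` of degree `p`, and the induction continues with `K`, `E`, `N`. -/
theorem HasSeparableTraceBound.of_finrank_eq_prime_pow {k : Type u} [Field k] {p : ℕ}
    [Fact p.Prime] (m : ℕ) : ∀ {F E N : Type u} [Field F] [Algebra k F] [Field E] [Algebra k E]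
    [Algebra F E] [IsScalarTower k F E] [FiniteDimensional F E] [Algebra.IsSeparable F E]
    [Field N] [Algebra k N] [Algebra F N] [Algebra E N] [IsScalarTower F E N] [IsScalarTower k F N]
    [IsScalarTower k E N] [FiniteDimensional F N] [IsGalois F N] {O : Subalgebra k F}
    (_ : IsHenselDVF k O) (_ : Module.finrank F N = p ^ m), HasSeparableTraceBound O E := by
  induction m with
  | zero =>
    intro F E N _ _ _ _ _ _ _ _ _ _ _ _ _ _ _ _ _ O h hN
    refine HasSeparableTraceBound.of_finrank_ne_zero h ?_
    have h1 := Module.finrank_mul_finrank F E N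
    rw [hN, pow_zero] at h1
    rw [Nat.eq_one_of_mul_eq_one_right h1, Nat.cast_one]
    exact one_ne_zero
  | succ m ih =>
    intro F E N _ _ _ _ _ _ _ _ _ _ _ _ _ _ _ _ _ O h hN
    have hp : p.Prime := Fact.out
    rcases eq_or_ne (Module.finrank F E) 1 with h1 | h1
    · refine HasSeparableTraceBound.of_finrank_ne_zero h ?_
      rw [h1, Nat.cast_one]
      exact one_ne_zero
    set E₁ := (IsScalarTower.toAlgHom F E N).fieldRange with hE₁
    have hG : Nat.card Gal(N/F) = p ^ (m + 1) := by rw [IsGalois.card_aut_eq_finrank, hN]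
    -- The subgroup fixing `E` is proper because `E ≠ F`, which gives `n ≤ m` and leaves room for a
    -- subgroup of order `p^m` above it.
    obtain ⟨n, hn, hQ⟩ : ∃ n ≤ m, Nat.card E₁.fixingSubgroup = p ^ n := by
      have h2 := E₁.fixingSubgroup.card_subgroup_dvd_card
      rw [hG] at h2
      obtain ⟨n, hn, hQ⟩ := (Nat.dvd_prime_pow hp).1 h2
      refine ⟨n, Nat.le_of_lt_succ (lt_of_le_of_ne hn ?_), hQ⟩
      rintro rfl
      rw [IsGalois.card_fixingSubgroup_eq_finrank] at hQ
      have h3 := Module.finrank_mul_finrank F E₁ N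
      rw [hQ, hN, hE₁, finrank_fieldRange_eq] at h3
      exact h1 (Nat.eq_of_mul_eq_mul_right (pow_pos hp.pos _) (h3.trans (one_mul _).symm))
    obtain ⟨M, hM, hQM⟩ := Sylow.exists_subgroup_card_pow_prime_le p
      (by rw [hG]; exact pow_dvd_pow p (Nat.le_succ m)) E₁.fixingSubgroup hQ hn
    let K := fixedField M
    have hKN : Module.finrank K N = p ^ m := by rw [finrank_fixedField_eq_card, hM]
    have hFK : Module.finrank F K = p := by
      have h2 := Module.finrank_mul_finrank F K N
      rw [hKN, hN, pow_succ'] at h2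
      exact Nat.eq_of_mul_eq_mul_right (pow_pos hp.pos _) h2
    have hKE : K ≤ E₁ := by
      rw [← IsGalois.fixedField_fixingSubgroup E₁, le_iff_le, fixingSubgroup_fixedField]
      exact hQM
    obtain ⟨g, hg⟩ := exists_ringHom_of_le_fieldRange K hKE
    let _ : Algebra K E := g.toAlgebra
    have hinj := (algebraMap E N).injective
    have : IsScalarTower K E N := IsScalarTower.of_algebraMap_eq fun x => (hg x).symm
    have : IsScalarTower F K E := IsScalarTower.of_algebraMap_eq fun x => hinj (by
      rw [← IsScalarTower.algebraMap_apply F E N]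
      exact (hg (algebraMap F K x)).symm)
    have : IsScalarTower k K E := IsScalarTower.of_algebraMap_eq fun x => hinj (by
      rw [← IsScalarTower.algebraMap_apply k E N]
      exact (hg (algebraMap k K x)).symm)
    have : IsScalarTower k K N := IsScalarTower.of_algebraMap_eq fun _ => rfl
    have : FiniteDimensional K E := FiniteDimensional.right F K E
    have : Algebra.IsSeparable K E := Algebra.isSeparable_tower_top_of_isSeparable F K E
    have : Algebra.IsSeparable F K := Algebra.isSeparable_tower_bot_of_isSeparable F K N
    have hFKp : HasSeparableTraceBound O K :=
      HasSeparableTraceBound.of_finrank_prime h (by rw [hFK]; exact hp)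
    exact HasSeparableTraceBound.trans h hFKp
      (ih (N := N) (h.extensionRing_of_isSeparable (E := K)) hKN)

variable {k F E : Type u} [Field k] [Field F] [Algebra k F] [Field E] [Algebra k E]
  [Algebra F E] [IsScalarTower k F E] [FiniteDimensional F E] [Algebra.IsSeparable F E]
  {O : Subalgebra k F}

/-- With `Q` a Sylow `p`-subgroup of `Gal(N/E)`, `P ⊇ Q` one of `Gal(N/F)`, and fixed fields `E₀`
and `F'`, the degrees `[F' : F]` and `[E₀ : E]` are prime to `p`, while `E₀ / F'` lies in the
`p`-power Galois extension `N / F'`. -/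
theorem IsHenselDVF.hasSeparableTraceBound_of_isGalois (h : IsHenselDVF k O) (N : Type u) [Field N]
    [Algebra k N] [Algebra F N] [Algebra E N] [IsScalarTower F E N] [IsScalarTower k F N]
    [IsScalarTower k E N] [FiniteDimensional F N] [IsGalois F N] : HasSeparableTraceBound O E := by
  obtain ⟨p, hpk⟩ := CharP.exists k
  rcases CharP.char_is_prime_or_zero k p with hp | rfl
  swap
  -- In characteristic `0` every degree is invertible and the tame case suffices.
  · have : CharZero k := CharP.charP_to_charZero k
    exact HasSeparableTraceBound.of_finrank_ne_zero h
      (Nat.cast_ne_zero.2 Module.finrank_pos.ne')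
  have : Fact p.Prime := ⟨hp⟩
  set E₁ := (IsScalarTower.toAlgHom F E N).fieldRange with hE₁
  let H := E₁.fixingSubgroup
  let S : Sylow p H := Classical.arbitrary _
  let Q := (S : Subgroup H).map H.subtype
  have hQH : Q ≤ H := Subgroup.map_subtype_le _
  obtain ⟨P, hQP⟩ := (S.2.map H.subtype : IsPGroup p Q).exists_le_sylow
  let F' := fixedField (P : Subgroup Gal(N/F))
  let E₀ := fixedField Q
  have hF'E₀ : F' ≤ E₀ := by
    rw [le_iff_le, fixingSubgroup_fixedField]
    exact hQP
  have hE₁E₀ : E₁ ≤ E₀ := by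
    rw [le_iff_le]
    exact hQH
  let _ : Algebra F' E₀ := (inclusion hF'E₀).toRingHom.toAlgebra
  let g : E →+* E₀ := (algebraMap E N).codRestrict E₀.toSubfield fun x => hE₁E₀ ⟨x, rfl⟩
  let _ : Algebra E E₀ := g.toAlgebra
  have : IsScalarTower F' E₀ N := IsScalarTower.of_algebraMap_eq fun _ => rfl
  have : IsScalarTower k F' N := IsScalarTower.of_algebraMap_eq fun _ => rfl
  have : IsScalarTower k E₀ N := IsScalarTower.of_algebraMap_eq fun _ => rfl
  have : IsScalarTower F F' E₀ := IsScalarTower.of_algebraMap_eq fun _ => rfl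
  have : IsScalarTower k F' E₀ := IsScalarTower.of_algebraMap_eq fun _ => rfl
  have : IsScalarTower F E E₀ := IsScalarTower.of_algebraMap_eq fun x =>
    Subtype.ext (IsScalarTower.algebraMap_apply F E N x)
  have : IsScalarTower k E E₀ := IsScalarTower.of_algebraMap_eq fun x =>
    Subtype.ext (IsScalarTower.algebraMap_apply k E N x)
  have : FiniteDimensional F' E₀ := FiniteDimensional.right F F' E₀
  have : FiniteDimensional E E₀ := FiniteDimensional.right F E E₀
  have : Algebra.IsSeparable F E₀ := Algebra.isSeparable_tower_bot_of_isSeparable F E₀ N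
  have : Algebra.IsSeparable F F' := Algebra.isSeparable_tower_bot_of_isSeparable F F' N
  have : Algebra.IsSeparable F' E₀ := Algebra.isSeparable_tower_top_of_isSeparable F F' E₀
  have : Algebra.IsSeparable E E₀ := Algebra.isSeparable_tower_top_of_isSeparable F E E₀
  have hF'N : Module.finrank F' N = Nat.card P := finrank_fixedField_eq_card _
  have hE₀N : Module.finrank E₀ N = Nat.card S := by
    rw [finrank_fixedField_eq_card]
    exact Subgroup.card_subtype H S
  have h1 : (Module.finrank F F' : k) ≠ 0 := by
    rw [Ne, CharP.cast_eq_zero_iff k p]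
    have h2 := Module.finrank_mul_finrank F F' N
    rw [hF'N, ← IsGalois.card_aut_eq_finrank F N, ← (P : Subgroup Gal(N/F)).card_mul_index, mul_comm] at h2
    rw [Nat.eq_of_mul_eq_mul_left Nat.card_pos h2]
    exact P.not_dvd_index
  have h2 : (Module.finrank E E₀ : k) ≠ 0 := by
    rw [Ne, CharP.cast_eq_zero_iff k p]
    have h3 := Module.finrank_mul_finrank F E₁ N
    rw [hE₁, finrank_fieldRange_eq, ← hE₁, ← IsGalois.card_fixingSubgroup_eq_finrank,
      ← (S : Subgroup H).card_mul_index, ← Module.finrank_mul_finrank F E₀ N, hE₀N,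
      ← Module.finrank_mul_finrank F E E₀, mul_assoc, mul_comm (Module.finrank E E₀)] at h3
    have h4 := Nat.eq_of_mul_eq_mul_left Module.finrank_pos h3
    rw [← Nat.eq_of_mul_eq_mul_left Nat.card_pos h4]
    exact S.not_dvd_index
  obtain ⟨m, hm⟩ := IsPGroup.iff_card.1 P.2
  refine HasSeparableTraceBound.of_extension (K := E₀) h h2 ?_
  exact HasSeparableTraceBound.trans h (HasSeparableTraceBound.of_finrank_ne_zero h h1)
    (HasSeparableTraceBound.of_finrank_eq_prime_pow (p := p) m (N := N)
      (h.extensionRing_of_isSeparable (E := F')) (hF'N.trans hm))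

theorem IsHenselDVF.hasSeparableTraceBound (h : IsHenselDVF k O) : HasSeparableTraceBound O E := by
  have : Algebra.IsSeparable F (SeparableClosure E) := Algebra.IsSeparable.trans F E _
  have : IsSepClosure F (SeparableClosure E) := ⟨inferInstance, inferInstance⟩
  have : IsGalois F (SeparableClosure E) := inferInstance
  let N := IntermediateField.normalClosure F E (SeparableClosure E)
  let _ : Algebra k N := ((algebraMap F N).comp (algebraMap k F)).toAlgebra
  have : IsScalarTower k F N := IsScalarTower.of_algebraMap_eq fun _ => rfl
  have : IsScalarTower k E N := IsScalarTower.of_algebraMap_eq fun x => by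
    rw [IsScalarTower.algebraMap_apply k F N, IsScalarTower.algebraMap_apply k F E,
      ← IsScalarTower.algebraMap_apply F E N]
  exact h.hasSeparableTraceBound_of_isGalois N

end GaloisDevissage

/-! ### Arbitrary finite extensions and the theorem. -/

section FormTrace

variable {k F E : Type u} [Field k] [Field F] [Algebra k F] [Field E] [Algebra k E]
  [Algebra F E] [IsScalarTower k F E] {O : Subalgebra k F}

theorem IsHenselDVF.hasTraceBound_of_isInseparableFormTrace (h : IsHenselDVF k O) {p : ℕ}
    (hp : p.Prime) [CharP F p] {a : F} {θ : E} (hθ : θ ^ p = algebraMap F E a)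
    (hθF : θ ∉ Set.range (algebraMap F E)) (hgen : Algebra.adjoin F {θ} = ⊤)
    {T : ∀ q, Forms k E q →+ Forms k F q} (hT : IsInseparableFormTrace k F E p a θ T) :
    IsHenselDVF k (extensionRing O E) ∧ HasTraceBound O (extensionRing O E) T := by
  let pb := PowerBasis.ofAdjoinEqTop (isIntegral_of_pow_eq hp hθ.symm) hgen
  have : FiniteDimensional F E := pb.finite
  have hrank : Module.finrank F E = p := by
    rw [pb.finrank, show pb.dim = (minpoly F θ).natDegree from rfl,
      minpoly_eq_X_pow_sub_C hp hθ hθF, Polynomial.natDegree_X_pow_sub_C]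
  have := h.finite_integralClosure_of_pow (E := E) hp (exists_algebraMap_eq_pow hp hθ hgen)
  exact ⟨h.isHenselDVF_extensionRing, h.hasTraceBound_of_finrank_prime (by rwa [hrank])
    fun x hx hxgen hO hB => hT.isMonogenicTrace hp hθ hθF hgen hx hxgen hO hB⟩

/-- Induction on the tower in `IsFormTrace`. That the intermediate ring is again henselian with
finite Frobenius is carried along, since the next inseparable step needs it. -/
theorem IsFormTrace.hasTraceBound {T : ∀ q, Forms k E q →+ Forms k F q}
    (hT : IsFormTrace k F E T) (h : IsHenselDVF k O) :
    IsHenselDVF k (extensionRing O E) ∧ HasTraceBound O (extensionRing O E) T := by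
  induction hT with
  | separable E T hT => exact ⟨h.extensionRing_of_isSeparable, h.hasSeparableTraceBound T hT⟩
  | inseparable F E T _ p hp hchar a θ hθ hθF hgen S hS ih =>
    obtain ⟨hF, hTF⟩ := ih h
    obtain ⟨hE, hSE⟩ := hF.hasTraceBound_of_isInseparableFormTrace hp hθ hθF hgen hS
    rw [IsHenselDVF.extensionRing_extensionRing] at hE hSE
    have := hF.isDiscreteValuationRing
    exact ⟨hE, hTF.comp (fun b hb => IsIntegral.algebraMap hb) hSE⟩

end FormTrace

theorem ramificationIdx_eq_of_associated {A E : Type*} (F : Type*) [CommRing A] [IsDomain A]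
    [IsDiscreteValuationRing A] [Field F] [Algebra A F] [IsFractionRing A F] [Field E]
    [Algebra F E] [Algebra A E] [IsScalarTower A F E]
    [FiniteDimensional F E] [IsDiscreteValuationRing (integralClosure A E)] {t : A} (ht : Irreducible t)
    {s : integralClosure A E} (hs : Irreducible s) {e : ℕ}
    (he : Associated (algebraMap A (integralClosure A E) t) (s ^ e))
    (m : Ideal (integralClosure A E)) [hm : m.IsMaximal] : m.ramificationIdx A = e := by
  have := faithfulSMul_integralClosure A F E
  obtain rfl := IsLocalRing.eq_maximalIdeal hm
  have : (IsLocalRing.maximalIdeal (integralClosure A E)).LiesOver (IsLocalRing.maximalIdeal A) :=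
    inferInstance
  rw [← ramificationIdx'_eq_of_associated ht hs he]
  refine (Ideal.ramificationIdx'_eq_ramificationIdx' _ _ ?_).symm
  rw [Ne, Ideal.map_eq_bot_iff_of_injective (algebraMap_integralClosure_injective A F E)]
  exact IsDiscreteValuationRing.not_a_field A

theorem mainTheorem11 (k : Type u) [Field k] [PerfectField k] (q : ℕ) :
    IsRamificationFiltration k q (logFiltration k q) where
  monotone L _ _ O hO := by
    have := hO.isDiscreteValuationRing
    exact monotone_logFiltration q O
  integralForms_le L _ _ O _ := by
    rw [logFiltration, if_pos rfl]
  trace_le L _ _ O hO L' _ _ _ _ _ Tr hTr 𝔪 _ r := by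
    obtain ⟨hB, e, he, ⟨t, s, u, ht, hs, hu, h1⟩, hbound⟩ := hTr.hasTraceBound hO.isHenselDVF
    have := hO.isFractionRing
    have := hO.isDiscreteValuationRing
    have : IsDiscreteValuationRing (integralClosure O L') := hB.isDiscreteValuationRing
    -- The `e` of the bound is read off from `t = u s^e`, and `𝔪` is the only maximal ideal.
    have h2 : 𝔪.ramificationIdx O = e := by
      obtain ⟨v, hv⟩ := hu
      refine ramificationIdx_eq_of_associated L ht hs (Associated.symm ⟨v, Subtype.ext ?_⟩) 𝔪
      rw [mul_comm, hv]
      exact h1.symm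
    rw [h2]
    exact hbound q r
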